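/- A translation surface $(X,\omega)$ is a connected surface $X$ with a maximal atlas $\omega$ of charts in $\mathbb{R}^2$ whose transition functions are (locally) translations. Let $\overline{X}$ be its metric completion with respect to the path metric induced by the Euclidean metric in the charts; the points of $\overline{X}\setminus X$ are called singularities. A simple closed curve in a space $Y$ is a continuous map $\gamma\colon[0,1]\to Y$ with $\gamma(0)=\gamma(1)$ that is injective on $[0,1)$. A family of curves in $Y$ is called non-separating if $Y$ with the images of all curves of the family removed is connected. \textbf{Lemma} (Non-separating curves in $\overline{X}$ give rise to non-separating curves in $X$). Let $(X,\omega)$ be a translation surface, $\sigma$ a singularity, $n\in\mathbb{N}$, and $\gamma_1,\ldots,\gamma_n$ simple closed curves in $X\cup\{\sigma\}$ with $\gamma_i(t)=\sigma$ exactly for the start point $t=0$ and the end point $t=1$, which meet pairwise exactly in $\sigma$, i.e. $\operatorname{im}(\gamma_i)\cap\operatorname{im}(\gamma_j)=\{\sigma\}$ for $i\neq j$. Suppose that they form a non-separating family in $\overline{X}$, i.e. that $\overline{X}\setminus\bigcup_i\operatorname{im}(\gamma_i)$ is connected. Then there exist a point $x\in X$ and simple closed curves $\gamma_1',\ldots,\gamma_n'$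 in $X$, all passing through $x$ and with $\operatorname{im}(\gamma_i')\cap\operatorname{im}(\gamma_j')=\{x\}$ for $i\neq j$, which form a non-separating family, i.e. $X\setminus\bigcup_i\operatorname{im}(\gamma_i')$ is connected. -/

import Mathlib

open Set Topology
open scoped ENNReal

noncomputable section

/-- The Euclidean plane `ℝ²`. -/
abbrev Plane : Type := EuclideanSpace ℝ (Fin 2)

/-- `f` agrees near every point of `u` (within `u`) with a translation of the plane. -/
def LocallyTranslationOn (f : Plane → Plane) (u : Set Plane) : Prop :=
  ∀ x ∈ u, ∃ v : Set Plane, IsOpen v ∧ x ∈ v ∧ ∃ c : Plane, ∀ y ∈ u ∩ v, f y = y + c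

/-- The pseudogroup of the homeomorphisms between open subsets of the plane which are,
on each connected component, translations. -/
def translationGroupoid : StructureGroupoid Plane :=
  Pregroupoid.groupoid
    { property := LocallyTranslationOn
      comp := by
        intro f g u v hf hg _ _ _ x hx
        obtain ⟨a, ha, hxa, c, hc⟩ := hf x hx.1
        obtain ⟨b, hb, hxb, d, hd⟩ := hg (f x) hx.2
        refine ⟨a ∩ (fun y => y + c) ⁻¹' b,
          ha.inter (hb.preimage (continuous_id.add continuous_const)), ⟨hxa, ?_⟩, c + d, ?_⟩
        · have := hc x ⟨hx.1, hxa⟩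
          simpa [this] using hxb
        · rintro y ⟨⟨hyu, hyv⟩, hya, hyb⟩
          have h1 := hc y ⟨hyu, hya⟩
          have h2 := hd (f y) ⟨hyv, by simpa [h1] using hyb⟩
          rw [Function.comp_apply, h2, h1, add_assoc]
      id_mem := fun x _ => ⟨univ, isOpen_univ, mem_univ x, 0, fun y _ => by simp⟩
      locality := by
        intro f u _ h x hx
        obtain ⟨v, hv, hxv, hf⟩ := h x hx
        obtain ⟨w, hw, hxw, c, hc⟩ := hf x ⟨hx, hxv⟩
        exact ⟨v ∩ w, hv.inter hw, ⟨hxv, hxw⟩, c, fun y hy => hc y ⟨⟨hy.1, hy.2.1⟩, hy.2.2⟩⟩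
      congr := by
        intro f g u _ hfg hf x hx
        obtain ⟨v, hv, hxv, c, hc⟩ := hf x hx
        exact ⟨v, hv, hxv, c, fun y hy => (hfg y hy.1).trans (hc y hy)⟩ }

/-- A translation surface: a connected surface (a Hausdorff, second countable space with charts
in the plane) whose transition functions are translations. The translation structure itself is the
maximal atlas `translationGroupoid.maximalAtlas X`. -/
class TranslationSurface (X : Type*) [TopologicalSpace X] [ChartedSpace Plane X] : Prop
    extends HasGroupoid X translationGroupoid, T2Space X, SecondCountableTopology X,
      ConnectedSpace X

namespace TranslationSurface

variable {X : Type*} [TopologicalSpace X] [ChartedSpace Plane X]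

/-- `L` is the length of the curve `γ` for the Euclidean metric pulled back by the charts of the
translation structure: `γ` is cut into finitely many pieces, each inside the domain of a chart, and
`L` is the sum of the Euclidean lengths of the pieces read in these charts. -/
def HasLength {x y : X} (γ : Path x y) (L : ℝ≥0∞) : Prop :=
  ∃ (m : ℕ) (t : ℕ → ℝ) (e : ℕ → OpenPartialHomeomorph X Plane),
    Monotone t ∧ t 0 = 0 ∧ t m = 1 ∧
    (∀ k < m, e k ∈ translationGroupoid.maximalAtlas X) ∧
    (∀ k < m, ∀ s ∈ Icc (t k) (t (k + 1)), γ.extend s ∈ (e k).source) ∧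
    L = ∑ k ∈ Finset.range m, eVariationOn (e k ∘ γ.extend) (Icc (t k) (t (k + 1)))

theorem HasLength.refl [TranslationSurface X] (x : X) : HasLength (Path.refl x) 0 := by
  refine ⟨1, fun k => (k : ℝ), fun _ => chartAt Plane x, Nat.mono_cast, by simp, by simp, ?_, ?_, ?_⟩
  · exact fun _ _ => translationGroupoid.chart_mem_maximalAtlas x
  · intro k _ s _
    simp
  · symm
    simp only [Finset.range_one, Finset.sum_singleton]
    apply eVariationOn.constant_on
    rintro _ ⟨a, _, rfl⟩ _ ⟨b, _, rfl⟩
    simp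

theorem HasLength.symm {x y : X} {γ : Path x y} {L : ℝ≥0∞} (h : HasLength γ L) :
    HasLength γ.symm L := by
  obtain ⟨m, t, e, ht, h0, h1, he, hs, rfl⟩ := h
  have key : ∀ k < m, m - k = m - 1 - k + 1 ∧ m - (k + 1) = m - 1 - k ∧ m - 1 - k < m := by
    intro k hk
    omega
  refine ⟨m, fun k => 1 - t (m - k), fun k => e (m - 1 - k), ?_, ?_, ?_, ?_, ?_, ?_⟩
  · intro a b hab
    have := ht (show m - b ≤ m - a by omega)
    simp only
    linarith
  · simp [h1]
  · simp [h0]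
  · intro k hk
    exact he _ (key k hk).2.2
  · intro k hk s hks
    simp only [(key k hk).1, (key k hk).2.1] at hks
    rw [Path.extend_symm_apply]
    exact hs _ (key k hk).2.2 _ ⟨by linarith [hks.2], by linarith [hks.1]⟩
  · rw [← Finset.sum_range_reflect]
    refine Finset.sum_congr rfl fun k hk => ?_
    rw [Finset.mem_range] at hk
    simp only [(key k hk).1, (key k hk).2.1]
    have hφ : AntitoneOn (fun s : ℝ => 1 - s) (Icc (1 - t (m - 1 - k + 1)) (1 - t (m - 1 - k))) :=
      fun a _ b _ hab => by simp only; linarith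
    have := eVariationOn.comp_eq_of_antitoneOn (e (m - 1 - k) ∘ γ.extend) _ hφ
    rw [Set.image_const_sub_Icc, sub_sub_cancel, sub_sub_cancel] at this
    rw [← this, Path.extend_symm]
    rfl

theorem HasLength.trans {x y z : X} {γ : Path x y} {γ' : Path y z} {L L' : ℝ≥0∞}
    (h : HasLength γ L) (h' : HasLength γ' L') : HasLength (γ.trans γ') (L + L') := by
  obtain ⟨m, t, e, ht, h0, h1, he, hs, rfl⟩ := h
  obtain ⟨m', t', e', ht', h0', h1', he', hs', rfl⟩ := h'
  set u : ℕ → ℝ := fun k => if k ≤ m then t k / 2 else (t' (k - m) + 1) / 2 with hu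
  have hu1 : ∀ k ≤ m, u k = t k / 2 := fun k hk => by simp [hu, hk]
  have hu2 : ∀ k, u (m + k) = (t' k + 1) / 2 := by
    intro k
    rcases Nat.eq_zero_or_pos k with rfl | hk
    · simp [hu, h1, h0']
    · simp [hu, show ¬ k = 0 by omega]
  have hp : ∀ k, 0 ≤ t' k := fun k => h0' ▸ ht' (Nat.zero_le k)
  have hq : ∀ k ≤ m, t k ≤ 1 := fun k hk => h1 ▸ ht hk
  refine ⟨m + m', u, fun k => if k < m then e k else e' (k - m), ?_, ?_, ?_, ?_, ?_, ?_⟩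
  · intro a b hab
    rcases le_or_gt b m with hb | hb
    · rw [hu1 a (hab.trans hb), hu1 b hb]
      linarith [ht hab]
    · obtain ⟨j, rfl⟩ := Nat.exists_eq_add_of_le hb.le
      rcases le_or_gt a m with ha | ha
      · rw [hu1 a ha, hu2]
        linarith [hq a ha, hp j]
      · obtain ⟨i, rfl⟩ := Nat.exists_eq_add_of_le ha.le
        rw [hu2, hu2]
        linarith [ht' (show i ≤ j by omega)]
  · rw [hu1 0 (Nat.zero_le m), h0, zero_div]
  · rw [hu2, h1']
    norm_num
  · intro k hk
    simp only
    split_ifs with hkm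
    · exact he k hkm
    · exact he' _ (by omega)
  · intro k hk s hks
    simp only
    split_ifs with hkm
    · rw [hu1 k hkm.le, hu1 (k + 1) hkm] at hks
      rw [Path.extend_trans_of_le_half _ _ (by linarith [hks.2, hq (k + 1) hkm])]
      exact hs k hkm _ ⟨by linarith [hks.1], by linarith [hks.2]⟩
    · obtain ⟨i, rfl⟩ := Nat.exists_eq_add_of_le (not_lt.1 hkm)
      rw [add_assoc, hu2, hu2] at hks
      rw [Path.extend_trans_of_half_le _ _ (by linarith [hks.1, hp i]), Nat.add_sub_cancel_left]
      exact hs' i (by omega) _ ⟨by linarith [hks.1], by linarith [hks.2]⟩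
  · rw [Finset.sum_range_add]
    congr 1
    · refine Finset.sum_congr rfl fun k hk => ?_
      rw [Finset.mem_range] at hk
      simp only
      rw [if_pos hk, hu1 k hk.le, hu1 (k + 1) hk]
      have hφ : MonotoneOn (fun s : ℝ => 2 * s) (Icc (t k / 2) (t (k + 1) / 2)) :=
        fun a _ b _ hab => by simp only; linarith
      have := eVariationOn.comp_eq_of_monotoneOn (e k ∘ γ.extend) _ hφ
      rw [Set.image_mul_left_Icc' (by norm_num), mul_div_cancel₀ _ two_ne_zero,
        mul_div_cancel₀ _ two_ne_zero] at this
      rw [← this]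
      refine eVariationOn.congr fun s hs => ?_
      simp only [Function.comp_apply]
      rw [Path.extend_trans_of_le_half _ _ (by linarith [hs.2, hq (k + 1) hk])]
    · refine Finset.sum_congr rfl fun k hk => ?_
      rw [Finset.mem_range] at hk
      simp only
      rw [if_neg (show ¬ m + k < m by omega), Nat.add_sub_cancel_left, add_assoc, hu2, hu2]
      have hφ : MonotoneOn (fun s : ℝ => 2 * s - 1)
          (Icc ((t' k + 1) / 2) ((t' (k + 1) + 1) / 2)) :=
        fun a _ b _ hab => by simp only; linarith
      have := eVariationOn.comp_eq_of_monotoneOn (e' k ∘ γ'.extend) _ hφ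
      have him : (fun s : ℝ => 2 * s - 1) '' (Icc ((t' k + 1) / 2) ((t' (k + 1) + 1) / 2))
          = Icc (t' k) (t' (k + 1)) := by
        ext s
        constructor
        · rintro ⟨r, hr, rfl⟩
          exact ⟨by linarith [hr.1], by linarith [hr.2]⟩
        · intro hs
          exact ⟨(s + 1) / 2, ⟨by linarith [hs.1], by linarith [hs.2]⟩, by ring⟩
      rw [him] at this
      rw [← this]
      refine eVariationOn.congr fun s hs => ?_
      simp only [Function.comp_apply]
      rw [Path.extend_trans_of_half_le _ _ (by linarith [hs.1, hp k])]

variable (X) in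
/-- The underlying set of the translation surface `X`, to be endowed with the translation metric. -/
def WithTranslationMetric : Type _ := X

/-- The translation metric: the distance of two points is the infimum of the lengths of the curves
which connect them. -/
instance [TranslationSurface X] : PseudoEMetricSpace (WithTranslationMetric X) where
  edist x y := sInf {L | ∃ γ : Path (X := X) x y, HasLength γ L}
  edist_self x := le_antisymm (sInf_le ⟨_, HasLength.refl (X := X) x⟩) bot_le
  edist_comm x y := by
    apply le_antisymm <;>
    · refine le_sInf ?_
      rintro L ⟨γ, hγ⟩
      exact sInf_le ⟨_, hγ.symm⟩
  edist_triangle x y z := by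
    simp only [ENNReal.sInf_add, ENNReal.add_sInf]
    refine le_iInf₂ fun L' hL' => le_iInf₂ fun L hL => ?_
    obtain ⟨γ, hγ⟩ := hL
    obtain ⟨γ', hγ'⟩ := hL'
    exact sInf_le ⟨_, hγ.trans hγ'⟩

variable (X) in
/-- The metric completion `X̄` of a translation surface. -/
abbrev MetricCompletion [TranslationSurface X] : Type _ :=
  UniformSpace.Completion (WithTranslationMetric X)

/-- The canonical map `X → X̄`. -/
def toCompletion [TranslationSurface X] (x : X) : MetricCompletion X :=
  ((show WithTranslationMetric X from x : WithTranslationMetric X) :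
    UniformSpace.Completion (WithTranslationMetric X))

variable (X) in
/-- The singularities of a translation surface: the points of `X̄ \ X`. -/
def singularities [TranslationSurface X] : Set (MetricCompletion X) :=
  (range (toCompletion : X → MetricCompletion X))ᶜ

end TranslationSurface

/-- A simple closed curve: its endpoints coincide, and it is injective otherwise. -/
def IsSimpleClosedCurve {Y : Type*} [TopologicalSpace Y] (γ : C(unitInterval, Y)) : Prop :=
  γ 0 = γ 1 ∧ InjOn γ (Ico 0 1)

/-- A family of curves in `Y` is non-separating if `Y` with all their images removed is
connected. -/
def IsNonSeparating {Y ι : Type*} [TopologicalSpace Y] (γ : ι → C(unitInterval, Y)) : Prop :=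
  IsConnected (univ \ ⋃ i, range (γ i))

end

/-! The new loops are not deformations of the given curves but are dual to them. Since `σ` is not a
point of `X`, the given curves without `σ` are disjoint open arcs `ℓ j` in `X` that leave every
compact set at both ends. The completion belongs to a path metric, so points of `X` close to a point
of `X̄` are joined by short curves close to it (`exists_nhds_joinedIn`). Hence the complement `S` of
the arcs in `X` is still connected (`isConnected_preimage_toCompletion`), and the two ends of each
arc, both tending to `σ`, are joined outside any given compact subset of `X` (`exists_properLines`).
After this, only the topology of the surface matters.

The loop with index `j` crosses `ℓ j` within a short segment `I j` and returns from both ends of `I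
j` to a base point `x₀` along legs in `S`. It does not separate: one passes from one side of `I j`
to the other by following `ℓ j` and closing up near its ends, outside the compact union `W` of the
loops. To make this precise, let `Wᶜ` be the union of disjoint open sets `U` and `V`. It suffices
that these have no common limit point. There is none on the interior of `I j`, because the same set
lies on both sides (`CrossingDisc.notMem_inter_closure`); this propagates along the legs up to `x₀`,
and then to `x₀` itself (`isPreconnected_compl_of_legs`).

As the arcs are only continuous, "crossing" is expressed by logarithms. A piece `J` of `ℓ j` in a
chart is closed up by a set `G` made of two segments, and `J ∪ G` separates `a` from `b` when `(z -
a) / (z - b)` has no continuous logarithm on it. Such points exist near the arc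
(`not_logEquiv_of_single_crossing`, `exists_crossing`). If different sets lay on the two sides of
`[a, b]`, while `J ∩ G` lay in one of them, then adding `2πi` to the principal logarithm on part of
`J` would produce a logarithm (`logEquiv_of_sides`).

The legs are built one at a time from straight segments and ambient homeomorphisms (`exists_legs`).
Each complementary region of the legs built so far reaches `x₀` (`mem_closure_of_star`), and near
`x₀` these legs form a cone, so a further leg can arrive along a radius. -/

noncomputable section

/-! ### The translation metric and the topology of the surface -/

namespace TranslationSurface

variable {X : Type*} [TopologicalSpace X] [ChartedSpace Plane X]

theorem transition_locallyTranslationOn [TranslationSurface X] {e e' : OpenPartialHomeomorph X Plane}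
    (he : e ∈ translationGroupoid.maximalAtlas X) (he' : e' ∈ translationGroupoid.maximalAtlas X) :
    LocallyTranslationOn (e.symm.trans e') (e.symm.trans e').source :=
  (translationGroupoid.compatible_of_mem_maximalAtlas he he').1

/-- Transition maps are translations only locally, with a vector that may depend on the component of
the overlap. Along a curve this vector is locally constant, hence constant. -/
theorem exists_translation_along [TranslationSurface X] {e e' : OpenPartialHomeomorph X Plane}
    (he : e ∈ translationGroupoid.maximalAtlas X) (he' : e' ∈ translationGroupoid.maximalAtlas X)
    {f : ℝ → X} {a b : ℝ} (hf : ContinuousOn f (Icc a b)) (hs : MapsTo f (Icc a b) e.source)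
    (hs' : MapsTo f (Icc a b) e'.source) {s t : ℝ} (hsI : s ∈ Icc a b) (htI : t ∈ Icc a b) :
    e' (f s) - e (f s) = e' (f t) - e (f t) := by
  refine isPreconnected_Icc.induction₂
    (fun s t => e' (f s) - e (f s) = e' (f t) - e (f t)) ?_ (fun _ _ _ _ _ _ h1 h2 => h1.trans h2)
    (fun _ _ _ _ h => h.symm) hsI htI
  intro r hr
  have hsrc : e (f r) ∈ (e.symm.trans e').source := by
    rw [OpenPartialHomeomorph.trans_source]
    exact ⟨by simpa using e.map_source (hs hr), by simpa [e.left_inv (hs hr)] using hs' hr⟩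
  obtain ⟨v, hv, hrv, c, hc⟩ := transition_locallyTranslationOn he he' _ hsrc
  have hcont : ContinuousWithinAt (fun s => e (f s)) (Icc a b) r :=
    (e.continuousAt (hs hr)).comp_continuousWithinAt (hf r hr)
  have key : ∀ q ∈ Icc a b, e (f q) ∈ v → e' (f q) - e (f q) = c := by
    intro q hq hqv
    have := hc (e (f q)) ⟨?_, hqv⟩
    · rw [OpenPartialHomeomorph.coe_trans, Function.comp_apply, e.left_inv (hs hq)] at this
      rw [this]; abel
    · rw [OpenPartialHomeomorph.trans_source]
      exact ⟨by simpa using e.map_source (hs hq), by simpa [e.left_inv (hs hq)] using hs' hq⟩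
  filter_upwards [hcont.preimage_mem_nhdsWithin (hv.mem_nhds hrv), self_mem_nhdsWithin] with q hq hqI
  rw [key r hr hrv, key q hqI hq]

/-- The charts that measure the length need not be `e`, but on each piece they differ from `e` by a
fixed translation, so the displacements agree. The subdivision is cut off at `τ`, and the triangle
inequality is applied to its points. -/
theorem edist_chart_le_length [TranslationSurface X] {x y : X} {γ : Path x y} {L : ℝ≥0∞}
    (h : HasLength γ L) {e : OpenPartialHomeomorph X Plane}
    (he : e ∈ translationGroupoid.maximalAtlas X) {τ : ℝ} (hτ : τ ∈ Icc (0 : ℝ) 1)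
    (hsrc : MapsTo γ.extend (Icc 0 τ) e.source) :
    edist (e x) (e (γ.extend τ)) ≤ L := by
  obtain ⟨m, t, e', ht, h0, h1, he', hs', rfl⟩ := h
  have h2 := edist_le_range_sum_edist (fun k => e (γ.extend (min (t k) τ))) m
  simp only [h0, h1, min_eq_left hτ.1, min_eq_right hτ.2, Path.extend_zero] at h2
  refine h2.trans (Finset.sum_le_sum fun k hk => ?_)
  rw [Finset.mem_range] at hk
  rcases le_or_gt τ (t k) with hτk | hτk
  · rw [min_eq_right hτk, min_eq_right (hτk.trans (ht (Nat.le_succ k))), edist_self]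
    exact zero_le
  · have hk0 : 0 ≤ t k := h0 ▸ ht (Nat.zero_le k)
    have hle : t k ≤ min (t (k + 1)) τ := le_min (ht (Nat.le_succ k)) hτk.le
    have hsub : Icc (t k) (min (t (k + 1)) τ) ⊆ Icc (t k) (t (k + 1)) :=
      Icc_subset_Icc_right (min_le_left _ _)
    have hsub' : Icc (t k) (min (t (k + 1)) τ) ⊆ Icc 0 τ :=
      Icc_subset_Icc hk0 (min_le_right _ _)
    rw [min_eq_left hτk.le]
    have htr := exists_translation_along (he' k hk) he γ.continuous_extend.continuousOn
      (fun r hr => hs' k hk r (hsub hr)) (fun r hr => hsrc (hsub' hr))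
      (left_mem_Icc.2 hle) (right_mem_Icc.2 hle)
    have : edist (e (γ.extend (t k))) (e (γ.extend (min (t (k + 1)) τ)))
        = edist (e' k (γ.extend (t k))) (e' k (γ.extend (min (t (k + 1)) τ))) := by
      rw [edist_eq_enorm_sub, edist_eq_enorm_sub]
      congr 1
      rw [sub_eq_sub_iff_add_eq_add] at htr ⊢
      rw [htr]; abel
    rw [this]
    exact eVariationOn.edist_le (e' k ∘ γ.extend) (hsub (left_mem_Icc.2 hle))
      (hsub (right_mem_Icc.2 hle))

/-- A short curve cannot leave the chart. Before the first exit time it stays in the compact set `K`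
that corresponds to the closed ball of radius `L`, so at that time it would still be in `K`, hence
in the chart. -/
theorem mem_source_of_length_lt [TranslationSurface X] {x y : X} {γ : Path x y} {L : ℝ≥0∞}
    (h : HasLength γ L) {e : OpenPartialHomeomorph X Plane}
    (he : e ∈ translationGroupoid.maximalAtlas X) (hx : x ∈ e.source) {ρ : ℝ}
    (hρ : Metric.ball (e x) ρ ⊆ e.target) (hL : L < ENNReal.ofReal ρ) :
    y ∈ e.source ∧ edist (e x) (e y) ≤ L := by
  have hLtop : L ≠ ⊤ := (hL.trans ENNReal.ofReal_lt_top).ne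
  set K : Set X := e.symm '' Metric.closedBall (e x) L.toReal with hK
  have hball : Metric.closedBall (e x) L.toReal ⊆ e.target := by
    refine (Metric.closedBall_subset_ball ?_).trans hρ
    exact (ENNReal.lt_ofReal_iff_toReal_lt hLtop).1 hL
  have hKc : IsClosed K :=
    ((isCompact_closedBall _ _).image_of_continuousOn (e.continuousOn_symm.mono hball)).isClosed
  have hKs : K ⊆ e.source := by
    rintro _ ⟨z, hz, rfl⟩
    exact e.map_target (hball hz)
  have hmem : ∀ τ ∈ Icc (0 : ℝ) 1, MapsTo γ.extend (Icc 0 τ) e.source → γ.extend τ ∈ K := by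
    intro τ hτ hm
    refine ⟨e (γ.extend τ), ?_, e.left_inv (hm (right_mem_Icc.2 hτ.1))⟩
    have := edist_chart_le_length h he hτ hm
    rw [Metric.mem_closedBall, dist_comm, dist_edist]
    exact ENNReal.toReal_mono hLtop this
  have hall : MapsTo γ.extend (Icc 0 1) e.source := by
    by_contra hcon
    set B : Set ℝ := Icc 0 1 ∩ γ.extend ⁻¹' e.sourceᶜ with hB
    have hBne : B.Nonempty := by
      simp only [MapsTo, not_forall] at hcon
      obtain ⟨r, hr, hr'⟩ := hcon
      exact ⟨r, hr, hr'⟩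
    have hBc : IsCompact B :=
      isCompact_Icc.inter_right (e.open_source.isClosed_compl.preimage γ.continuous_extend)
    obtain ⟨τ, hτB, hmin⟩ := hBc.exists_isLeast hBne
    have hτ0 : 0 < τ := by
      rcases hτB.1.1.eq_or_lt with h0 | h0
      · exfalso
        apply hτB.2
        rw [← h0, Path.extend_zero]
        exact hx
      · exact h0
    have hIco : Ico 0 τ ⊆ γ.extend ⁻¹' K := by
      intro r hr
      refine hmem r ⟨hr.1, hr.2.le.trans hτB.1.2⟩ fun q hq => ?_
      by_contra hqs
      have := hmin (show q ∈ B from ⟨⟨hq.1, hq.2.trans (hr.2.le.trans hτB.1.2)⟩, hqs⟩)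
      linarith [hq.2, hr.2]
    have hcl := (hKc.preimage γ.continuous_extend).closure_subset_iff.2 hIco
    rw [closure_Ico hτ0.ne] at hcl
    exact hτB.2 (hKs (hcl (right_mem_Icc.2 hτ0.le)))
  have h1 := hall (right_mem_Icc.2 zero_le_one)
  have h2 := edist_chart_le_length h he (right_mem_Icc.2 zero_le_one) hall
  rw [Path.extend_one] at h1 h2
  exact ⟨h1, h2⟩

/-- The translation distance on `X`. -/
def tdist [TranslationSurface X] (x y : X) : ℝ≥0∞ :=
  edist (α := WithTranslationMetric X) x y

theorem tdist_def [TranslationSurface X] (x y : X) :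
    tdist x y = sInf {L | ∃ γ : Path x y, HasLength γ L} := rfl

theorem tdist_le_length [TranslationSurface X] {x y : X} {γ : Path x y} {L : ℝ≥0∞}
    (h : HasLength γ L) : tdist x y ≤ L :=
  sInf_le (a := L) (s := {L | ∃ γ : Path x y, HasLength γ L}) ⟨γ, h⟩

/-- The segment read in the chart is one of the competing curves, and its affine parametrization is
Lipschitz with constant the distance of the end points. -/
theorem tdist_le_of_segment [TranslationSurface X] {e : OpenPartialHomeomorph X Plane}
    (he : e ∈ translationGroupoid.maximalAtlas X) {x y : X} (hx : x ∈ e.source)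
    (hy : y ∈ e.source) (hseg : segment ℝ (e x) (e y) ⊆ e.target) :
    tdist x y ≤ edist (e x) (e y) := by
  have hmem : ∀ t : ℝ, t ∈ Icc (0 : ℝ) 1 → AffineMap.lineMap (e x) (e y) t ∈ e.target := by
    intro t ht
    apply hseg
    rw [segment_eq_image_lineMap]
    exact ⟨t, ht, rfl⟩
  let γ : Path x y :=
    { toFun := fun t => e.symm (AffineMap.lineMap (e x) (e y) (t : ℝ))
      continuous_toFun := by
        refine e.continuousOn_symm.comp_continuous ?_ fun t => hmem _ t.2
        exact (AffineMap.lineMap_continuous).comp continuous_subtype_val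
      source' := by simp [e.left_inv hx]
      target' := by simp [e.left_inv hy] }
  have hγ : ∀ t ∈ Icc (0 : ℝ) 1, γ.extend t = e.symm (AffineMap.lineMap (e x) (e y) t) := by
    intro t ht
    rw [Path.extend_apply _ ht]
    rfl
  have hlen : HasLength γ (eVariationOn (e ∘ γ.extend) (Icc 0 1)) := by
    refine ⟨1, fun k => (k : ℝ), fun _ => e, Nat.mono_cast, by simp, by simp, fun _ _ => he, ?_, ?_⟩
    · intro k hk s hs
      obtain rfl : k = 0 := by omega
      have hs' : s ∈ Icc (0 : ℝ) 1 := by simpa using hs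
      rw [hγ s hs']
      exact e.map_target (hmem s hs')
    · simp
  refine (tdist_le_length hlen).trans ?_
  have h1 : eVariationOn (e ∘ γ.extend) (Icc 0 1)
      = eVariationOn ((fun t : ℝ => AffineMap.lineMap (e x) (e y) t) ∘ id) (Icc 0 1) := by
    refine eVariationOn.congr fun t ht => ?_
    simp only [Function.comp_apply, id]
    rw [hγ t ht, e.right_inv (hmem t ht)]
  rw [h1]
  have hlip : LipschitzOnWith (nndist (e x) (e y))
      (fun t : ℝ => (AffineMap.lineMap (e x) (e y) t : Plane)) univ := by
    refine LipschitzWith.lipschitzOnWith (LipschitzWith.of_dist_le_mul fun s t => ?_)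
    rw [dist_lineMap_lineMap, coe_nndist, mul_comm]
  refine (hlip.comp_eVariationOn_le (mapsTo_univ _ _)).trans ?_
  have h2 : eVariationOn (id : ℝ → ℝ) (Icc 0 1) ≤ 1 := by
    have := (monotone_id.monotoneOn (Icc (0 : ℝ) 1)).eVariationOn_eq
      (left_mem_Icc.2 zero_le_one) (right_mem_Icc.2 zero_le_one)
    simp only [inter_self] at this
    simp [this]
  calc _ ≤ (nndist (e x) (e y) : ℝ≥0∞) * 1 := by gcongr
    _ = edist (e x) (e y) := by rw [mul_one, edist_nndist]

theorem tdist_lt_iff_path [TranslationSurface X] {x y : X} {r : ℝ≥0∞} (h : tdist x y < r) :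
    ∃ (γ : Path x y) (L : ℝ≥0∞), HasLength γ L ∧ L < r := by
  rw [tdist_def, sInf_lt_iff] at h
  obtain ⟨L, ⟨γ, hγ⟩, hL⟩ := h
  exact ⟨γ, L, hγ, hL⟩

/-- Along a curve, the distance from the starting point is bounded by the length. -/
theorem tdist_extend_le_length [TranslationSurface X] {x y : X} {γ : Path x y} {L : ℝ≥0∞}
    (h : HasLength γ L) {s : ℝ} (hs : s ∈ Icc (0 : ℝ) 1) : tdist x (γ.extend s) ≤ L := by
  obtain ⟨m, t, e, ht, h0, h1, he, hsrc, rfl⟩ := h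
  let γ' : Path x (γ.extend s) :=
    { toFun := fun r => γ.extend (min (r : ℝ) s)
      continuous_toFun := γ.continuous_extend.comp (continuous_subtype_val.min continuous_const)
      source' := by simp [hs.1]
      target' := by simp [hs.2] }
  have hγ' : ∀ r ∈ Icc (0 : ℝ) 1, γ'.extend r = γ.extend (min r s) := by
    intro r hr
    rw [Path.extend_apply _ hr]
    rfl
  have ht01 : ∀ k ≤ m, t k ∈ Icc (0 : ℝ) 1 := fun k hk =>
    ⟨h0 ▸ ht (Nat.zero_le k), h1 ▸ ht hk⟩
  -- After time `s` the truncated curve rests at `γ.extend s`, which may lie outside the later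
  -- charts `e k`; a chart at this point replaces them.
  set e' : ℕ → OpenPartialHomeomorph X Plane :=
    fun k => if t k ≤ s then e k else chartAt Plane (γ.extend s) with he'
  have hlen : HasLength γ' (∑ k ∈ Finset.range m,
      eVariationOn (e' k ∘ γ'.extend) (Icc (t k) (t (k + 1)))) := by
    refine ⟨m, t, e', ht, h0, h1, ?_, ?_, rfl⟩
    · intro k hk
      simp only [he']
      split_ifs
      · exact he k hk
      · exact translationGroupoid.chart_mem_maximalAtlas _
    · intro k hk r hr
      rw [hγ' r ⟨(ht01 k hk.le).1.trans hr.1, hr.2.trans (ht01 (k + 1) hk).2⟩]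
      simp only [he']
      split_ifs with hks
      · exact hsrc k hk _ ⟨le_min hr.1 hks, (min_le_left _ _).trans hr.2⟩
      · rw [min_eq_right ((not_le.1 hks).le.trans hr.1)]
        exact mem_chart_source _ _
  refine (tdist_le_length hlen).trans (Finset.sum_le_sum fun k hk => ?_)
  rw [Finset.mem_range] at hk
  have hmin : ∀ r ∈ Icc (t k) (t (k + 1)), γ'.extend r = γ.extend (min r s) := fun r hr =>
    hγ' r ⟨(ht01 k hk.le).1.trans hr.1, hr.2.trans (ht01 (k + 1) hk).2⟩
  rcases le_or_gt (t k) s with hks | hks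
  · have : eVariationOn (e' k ∘ γ'.extend) (Icc (t k) (t (k + 1)))
        = eVariationOn ((e k ∘ γ.extend) ∘ fun r => min r s) (Icc (t k) (t (k + 1))) := by
      refine eVariationOn.congr fun r hr => ?_
      simp only [Function.comp_apply, he', if_pos hks, hmin r hr]
    rw [this]
    refine eVariationOn.comp_le_of_monotoneOn _ _ ?_ ?_
    · exact fun a _ b _ hab => min_le_min_right s hab
    · exact fun r hr => ⟨le_min hr.1 hks, (min_le_left _ _).trans hr.2⟩
  · have : eVariationOn (e' k ∘ γ'.extend) (Icc (t k) (t (k + 1))) = 0 := by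
      apply eVariationOn.constant_on
      rintro _ ⟨a, ha, rfl⟩ _ ⟨b, hb, rfl⟩
      simp only [Function.comp_apply, hmin a ha, hmin b hb, min_eq_right (hks.le.trans ha.1),
        min_eq_right (hks.le.trans hb.1)]
    rw [this]
    exact zero_le

/-- The translation metric induces the topology of the surface. -/
theorem nhds_eq_tdist [TranslationSurface X] (x : X) :
    (𝓝 x).HasBasis (fun r : ℝ≥0∞ => 0 < r) fun r => {y | tdist x y < r} := by
  set e := chartAt Plane x
  have he : e ∈ translationGroupoid.maximalAtlas X := translationGroupoid.chart_mem_maximalAtlas x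
  have hx : x ∈ e.source := mem_chart_source _ x
  obtain ⟨ρ, hρ, hball⟩ := Metric.isOpen_iff.1 e.open_target (e x) (e.map_source hx)
  refine ⟨fun N => ⟨fun hN => ?_, ?_⟩⟩
  · have hN' : e.symm ⁻¹' N ∈ 𝓝 (e x) := by
      apply (e.continuousAt_symm (e.map_source hx)).preimage_mem_nhds
      rwa [e.left_inv hx]
    obtain ⟨r, hr, hrN⟩ := Metric.mem_nhds_iff.1 hN'
    refine ⟨ENNReal.ofReal (min r ρ), by simp [hr, hρ], fun y hy => ?_⟩
    obtain ⟨γ, L, hγ, hL⟩ := tdist_lt_iff_path hy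
    obtain ⟨hys, hd⟩ := mem_source_of_length_lt hγ he hx
      ((Metric.ball_subset_ball (min_le_right r ρ)).trans hball) hL
    have : e y ∈ Metric.ball (e x) r := by
      rw [Metric.mem_ball, dist_comm, ← edist_lt_ofReal]
      exact (hd.trans_lt hL).trans_le (ENNReal.ofReal_le_ofReal (min_le_left _ _))
    simpa [e.left_inv hys] using hrN this
  · rintro ⟨r, hr, hrN⟩
    have h1 : e ⁻¹' (Metric.ball (e x) ρ ∩ Metric.eball (e x) r) ∈ 𝓝 x :=
      (e.continuousAt hx).preimage_mem_nhds
        (Filter.inter_mem (Metric.ball_mem_nhds _ hρ) (Metric.eball_mem_nhds _ hr))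
    filter_upwards [h1, e.open_source.mem_nhds hx] with y hy hys
    apply hrN
    refine (tdist_le_of_segment he hx hys ?_).trans_lt ?_
    · exact ((convex_ball _ _).segment_subset (Metric.mem_ball_self hρ) hy.1).trans hball
    · rw [edist_comm]
      exact hy.2

theorem isInducing_toCompletion [TranslationSurface X] :
    IsInducing (toCompletion : X → MetricCompletion X) := by
  have h1 := (UniformSpace.Completion.isUniformInducing_coe (WithTranslationMetric X)).isInducing
  let j : X → WithTranslationMetric X := fun x => x
  have h2 : IsInducing j := by
    rw [isInducing_iff_nhds]
    intro x
    refine (nhds_eq_tdist x).eq_of_same_basis ?_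
    have h3 := (Metric.nhds_basis_eball (x := j x)).comap j
    refine h3.congr (fun _ => Iff.rfl) fun r _ => ?_
    ext y
    exact Metric.mem_eball' (α := WithTranslationMetric X)
  exact h1.comp h2

/-- An inducing map from a T₀ space is injective, so it is the Hausdorff property of `X` that turns
the pseudometric into a metric. -/
theorem isEmbedding_toCompletion [TranslationSurface X] :
    IsEmbedding (toCompletion : X → MetricCompletion X) :=
  isInducing_toCompletion.isEmbedding

theorem denseRange_toCompletion [TranslationSurface X] :
    DenseRange (toCompletion : X → MetricCompletion X) :=
  UniformSpace.Completion.denseRange_coe (α := WithTranslationMetric X)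

/-- Points of the surface which are close to a given point of the completion are joined by curves
which stay close to that point. -/
theorem exists_nhds_joinedIn [TranslationSurface X] (τ : MetricCompletion X)
    {N : Set (MetricCompletion X)} (hN : N ∈ 𝓝 τ) :
    ∃ N' ∈ 𝓝 τ, ∀ x y : X, toCompletion x ∈ N' → toCompletion y ∈ N' →
      JoinedIn (toCompletion ⁻¹' N) x y := by
  obtain ⟨V, hV, hVN⟩ := UniformSpace.mem_nhds_iff.1 hN
  -- `V₁` is half of `V`: one half is spent on the step from `τ` to `x`, the other on the way from
  -- `x` along the curve. A curve shorter than `ε` stays `V₁`-close to `x`, and `V₃`-closeness to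
  -- `τ` forces `x` and `y` to be less than `ε` apart.
  obtain ⟨V₁, hV₁, hV₁s, hV₁V⟩ := comp_symm_mem_uniformity_sets hV
  have hc := (UniformSpace.Completion.isUniformInducing_coe (WithTranslationMetric X)).comap_uniformity
  have hV₁' : (fun p : WithTranslationMetric X × WithTranslationMetric X =>
      ((p.1 : MetricCompletion X), (p.2 : MetricCompletion X))) ⁻¹' V₁
      ∈ uniformity (WithTranslationMetric X) := by
    rw [← hc]
    exact Filter.preimage_mem_comap hV₁
  obtain ⟨ε, hε, hεV⟩ := mem_uniformity_edist.1 hV₁'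
  have hE : {p : WithTranslationMetric X × WithTranslationMetric X | edist p.1 p.2 < ε}
      ∈ uniformity (WithTranslationMetric X) := edist_mem_uniformity hε
  rw [← hc] at hE
  obtain ⟨V₂, hV₂, hV₂E⟩ := hE
  obtain ⟨V₃, hV₃, hV₃s, hV₃V⟩ := comp_symm_mem_uniformity_sets hV₂
  refine ⟨UniformSpace.ball τ (V₁ ∩ V₃), UniformSpace.ball_mem_nhds τ (Filter.inter_mem hV₁ hV₃), ?_⟩
  intro x y hx hy
  have hxy : tdist x y < ε := by
    refine hV₂E (a := ((x : WithTranslationMetric X), (y : WithTranslationMetric X))) (hV₃V ?_)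
    exact ⟨τ, SetRel.symm V₃ hx.2, hy.2⟩
  obtain ⟨γ, L, hγ, hL⟩ := tdist_lt_iff_path hxy
  refine ⟨γ, fun t => hVN (hV₁V ?_)⟩
  refine ⟨toCompletion x, hx.1, ?_⟩
  refine hεV (a := (x : WithTranslationMetric X)) (b := γ t) ?_
  have h1 := tdist_extend_le_length hγ t.2
  rw [Path.extend_apply _ t.2] at h1
  exact h1.trans_lt hL

end TranslationSurface

/-! ### Common limit points of disjoint open sets, and walkable paths -/

namespace SurfaceCurves

variable {X : Type*} [TopologicalSpace X]

/-- The criterion behind all connectedness proofs below: a set covered by the closures of `U` and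
`V` is split by them unless it contains a common limit point. -/
theorem subset_closure_or_of_isPreconnected {C U V : Set X} (hC : IsPreconnected C)
    (hcov : C ⊆ closure (U ∪ V)) (hZ : Disjoint C (closure U ∩ closure V)) :
    C ⊆ closure U ∨ C ⊆ closure V := by
  rw [closure_union] at hcov
  exact isPreconnected_iff_subset_of_disjoint_closed.1 hC _ _ isClosed_closure isClosed_closure hcov
    (disjoint_iff_inter_eq_empty.1 hZ)

/-- A point of `V` in `D` would be off `ρ`, hence a limit of points of `U`, although `V` is open and
disjoint from `U`. -/
theorem notMem_closure_of_subset_closure {U V D ρ : Set X} (hV : IsOpen V) (hUV : Disjoint U V)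
    (hD : IsOpen D) (hρ : Disjoint V ρ) (hsub : D \ ρ ⊆ closure U) {w : X} (hw : w ∈ D) :
    w ∉ closure V := by
  intro hwV
  obtain ⟨z, hzD, hzV⟩ := mem_closure_iff.1 hwV D hD hw
  have hzU : z ∈ closure U := hsub ⟨hzD, fun h => hρ.le_bot ⟨hzV, h⟩⟩
  obtain ⟨y, hyV, hyU⟩ := mem_closure_iff.1 hzU V hV hzV
  exact hUV.le_bot ⟨hyU, hyV⟩

/-- If removing a set `ρ`, which avoids `U` and `V`, from the neighbourhood `D` of `w` leaves
a preconnected set without common limit points of `U` and `V`, then `w` is not a common limit point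
of `U` and `V` either. -/
theorem notMem_inter_closure {U V D ρ : Set X} (hU : IsOpen U) (hV : IsOpen V) (hUV : Disjoint U V)
    (hD : IsOpen D) (hρ : Disjoint (U ∪ V) ρ) (hpre : IsPreconnected (D \ ρ))
    (hcov : D ⊆ closure (U ∪ V)) (hZ : Disjoint (D \ ρ) (closure U ∩ closure V)) {w : X}
    (hw : w ∈ D) : w ∉ closure U ∩ closure V := by
  rw [disjoint_union_left] at hρ
  rcases subset_closure_or_of_isPreconnected hpre (sdiff_subset.trans hcov) hZ with h | h
  · exact fun hw' => notMem_closure_of_subset_closure hV hUV hD hρ.2 h hw hw'.2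
  · exact fun hw' => notMem_closure_of_subset_closure hU hUV.symm hD hρ.1 h hw hw'.1

/-- A path is walkable if, for two disjoint open sets which avoid it, the property that the points
are not common limit points of both sets propagates along it, from its starting point on. -/
def Walkable {a b : X} (p : Path a b) : Prop :=
  ∀ U V : Set X, IsOpen U → IsOpen V → Disjoint U V → Disjoint (U ∪ V) (range p) →
    (∀ s, s ≠ 1 → ∃ N ∈ 𝓝 (p s), N ⊆ closure (U ∪ V) ∧ N ∩ (closure U ∩ closure V) ⊆ range p) →
    ∀ s, s ≠ 1 → p s ∉ closure U ∩ closure V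

/-- Consider the first parameter `s₀` at which a common limit point occurs. Near `p s₀` all common
limit points lie on the remaining part `p '' Ici s₀`, and `notMem_inter_closure` with this part as
`ρ` excludes `p s₀`. -/
theorem walkable_of_isPreconnected_diff {a b : X} (p : Path a b)
    (h : ∀ s, s ≠ 1 → ∀ N ∈ 𝓝 (p s), ∃ D ⊆ N, IsOpen D ∧ p s ∈ D ∧
      IsPreconnected (D \ p '' Ici s)) : Walkable p := by
  intro U V hU hV hUV hd hN s hs hsZ
  obtain ⟨s₀, hs₀, hmin⟩ := ((isClosed_closure.inter isClosed_closure).preimage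
    p.continuous).isCompact.exists_isLeast (s := p ⁻¹' (closure U ∩ closure V)) ⟨s, hsZ⟩
  have hs₀1 : s₀ ≠ 1 := fun h1 => hs (le_antisymm unitInterval.le_one' (h1 ▸ hmin hsZ))
  obtain ⟨N, hN, hNc, hNZ⟩ := hN s₀ hs₀1
  obtain ⟨D, hDN, hDo, hD, hpre⟩ := h s₀ hs₀1 N hN
  refine notMem_inter_closure hU hV hUV hDo (hd.mono_right (image_subset_range _ _)) hpre
    (hDN.trans hNc) ?_ hD hs₀
  rw [disjoint_left]
  rintro z ⟨hzD, hz⟩ hzZ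
  obtain ⟨s', rfl⟩ := hNZ ⟨hDN hzD, hzZ⟩
  exact hz ⟨s', hmin hzZ, rfl⟩

theorem Walkable.map {Y : Type*} [TopologicalSpace Y] {a b : X} {p : Path a b} (hp : Walkable p)
    (Ψ : X ≃ₜ Y) : Walkable (p.map Ψ.continuous) := by
  intro U V hU hV hUV hd hN s hs
  have key := hp (Ψ ⁻¹' U) (Ψ ⁻¹' V) (hU.preimage Ψ.continuous) (hV.preimage Ψ.continuous)
    (hUV.preimage _) ?_ ?_ s hs
  · rwa [← Ψ.preimage_closure, ← Ψ.preimage_closure, ← preimage_inter] at key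
  · rw [disjoint_left] at hd ⊢
    rintro _ hz ⟨t, rfl⟩
    exact hd hz ⟨t, rfl⟩
  · intro t ht
    obtain ⟨N, hN, hNc, hNZ⟩ := hN t ht
    refine ⟨Ψ ⁻¹' N, Ψ.continuous.continuousAt.preimage_mem_nhds hN, ?_, ?_⟩
    · rw [← preimage_union, ← Ψ.preimage_closure]
      exact preimage_mono hNc
    · rw [← Ψ.preimage_closure, ← Ψ.preimage_closure, ← preimage_inter, ← preimage_inter]
      intro z hz
      obtain ⟨t', ht'⟩ := hNZ hz
      exact ⟨t', Ψ.injective ht'⟩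

theorem exists_trans_eq_left {a b c : X} (p : Path a b) (q : Path b c) {s : unitInterval} :
    ∃ t, (p.trans q) t = p s ∧ t ≠ 1 := by
  have hs := s.2
  refine ⟨⟨(s : ℝ) / 2, by constructor <;> linarith [hs.1, hs.2]⟩, ?_, ?_⟩
  · rw [Path.trans_apply, dif_pos (by simp only; linarith [hs.2])]
    congr 1
    ext
    simp only
    ring
  · intro h
    have := congrArg Subtype.val h
    simp only [Icc.coe_one] at this
    linarith [hs.2]

theorem exists_trans_eq_right {a b c : X} (p : Path a b) (q : Path b c) {s : unitInterval}
    (hs1 : s ≠ 1) : ∃ t, (p.trans q) t = q s ∧ t ≠ 1 := by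
  have hs := s.2
  have hlt : (s : ℝ) < 1 := lt_of_le_of_ne hs.2 fun h => hs1 (Subtype.ext h)
  by_cases h0 : s = 0
  · subst h0
    obtain ⟨t, ht, ht1⟩ := exists_trans_eq_left p q (s := 1)
    exact ⟨t, by rw [ht, p.target, q.source], ht1⟩
  have hpos : (0 : ℝ) < s := lt_of_le_of_ne hs.1 fun h => h0 (Subtype.ext h.symm)
  refine ⟨⟨((s : ℝ) + 1) / 2, by constructor <;> linarith⟩, ?_, ?_⟩
  · rw [Path.trans_apply, dif_neg (by simp only; linarith)]
    congr 1
    ext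
    simp only
    ring
  · intro h
    have := congrArg Subtype.val h
    simp only [Icc.coe_one] at this
    linarith

theorem trans_eq_left_or_right {a b c : X} (p : Path a b) (q : Path b c) {t : unitInterval}
    (ht : t ≠ 1) : (∃ s, s ≠ 1 ∧ (p.trans q) t = p s) ∨ ∃ s, s ≠ 1 ∧ (p.trans q) t = q s := by
  have hlt : (t : ℝ) < 1 := lt_of_le_of_ne t.2.2 fun h => ht (Subtype.ext h)
  rcases lt_or_ge (t : ℝ) (1 / 2) with h | h
  · left
    refine ⟨⟨2 * t, by constructor <;> linarith [t.2.1]⟩, ?_, ?_⟩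
    · intro h1
      have := congrArg Subtype.val h1
      simp only [Icc.coe_one] at this
      linarith
    · rw [Path.trans_apply, dif_pos h.le]
  · right
    refine ⟨⟨2 * t - 1, by constructor <;> linarith [t.2.1]⟩, ?_, ?_⟩
    · intro h1
      have := congrArg Subtype.val h1
      simp only [Icc.coe_one] at this
      linarith
    · rcases h.eq_or_lt with h' | h'
      · rw [Path.trans_apply, dif_pos h'.ge]
        have e1 : (⟨2 * (t : ℝ), (unitInterval.mul_pos_mem_iff zero_lt_two).2 ⟨t.2.1, h'.ge⟩⟩ :
            unitInterval) = 1 := by ext; simp only [Icc.coe_one]; linarith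
        have e2 : (⟨2 * (t : ℝ) - 1, by constructor <;> linarith [t.2.1]⟩ : unitInterval) = 0 := by
          ext; simp only [Icc.coe_zero]; linarith
        rw [e1, e2, p.target, q.source]
      · rw [Path.trans_apply, dif_neg (not_le.2 h')]

/-- Before its end, `p` has neighbourhoods that avoid the closed set `range q`, so one can walk
along `p`. Then the only point of `p` that could still be a common limit point is its end, which
also lies on `q`, so one can walk on along `q`. -/
theorem Walkable.trans [T2Space X] {a b c : X} {p : Path a b} {q : Path b c} (hp : Walkable p)
    (hq : Walkable q) (hpq : ∀ s, s ≠ 1 → p s ∉ range q) : Walkable (p.trans q) := by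
  intro U V hU hV hUV hd hN
  rw [Path.trans_range, disjoint_union_right] at hd
  have hpZ : ∀ s, s ≠ 1 → p s ∉ closure U ∩ closure V := by
    refine hp U V hU hV hUV hd.1 fun s hs => ?_
    obtain ⟨t, ht, ht1⟩ := exists_trans_eq_left p q (s := s)
    obtain ⟨N, hN, hNc, hNZ⟩ := hN t ht1
    rw [ht] at hN
    refine ⟨N ∩ (range q)ᶜ, Filter.inter_mem hN
      ((isCompact_range q.continuous).isClosed.isOpen_compl.mem_nhds (hpq s hs)),
      inter_subset_left.trans hNc, ?_⟩
    rintro z ⟨⟨hzN, hzq⟩, hz⟩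
    have := hNZ ⟨hzN, hz⟩
    rw [Path.trans_range] at this
    exact this.resolve_right hzq
  have hqZ : ∀ s, s ≠ 1 → q s ∉ closure U ∩ closure V := by
    refine hq U V hU hV hUV hd.2 fun s hs => ?_
    obtain ⟨t, ht, ht1⟩ := exists_trans_eq_right p q hs
    obtain ⟨N, hN, hNc, hNZ⟩ := hN t ht1
    rw [ht] at hN
    refine ⟨N, hN, hNc, ?_⟩
    rintro z ⟨hzN, hz⟩
    have := hNZ ⟨hzN, hz⟩
    rw [Path.trans_range] at this
    rcases this with ⟨s', rfl⟩ | h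
    · by_cases h1 : s' = 1
      · exact ⟨0, by rw [h1, p.target, q.source]⟩
      · exact absurd hz (hpZ s' h1)
    · exact h
  intro t ht
  rcases trans_eq_left_or_right p q ht with ⟨s, hs, h⟩ | ⟨s, hs, h⟩
  · rw [h]; exact hpZ s hs
  · rw [h]; exact hqZ s hs

theorem injective_trans {a b c : X} {p : Path a b} {q : Path b c} (hp : Function.Injective p)
    (hq : Function.Injective q) (hpq : ∀ s, s ≠ 1 → p s ∉ range q) :
    Function.Injective (p.trans q) := by
  have key : ∀ t t' : unitInterval, (t : ℝ) ≤ 1 / 2 → (1 / 2 : ℝ) < t' →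
      (p.trans q) t ≠ (p.trans q) t' := by
    intro t t' ht ht' h
    rw [Path.trans_apply, Path.trans_apply, dif_pos ht, dif_neg (not_le.2 ht')] at h
    by_cases h1 : (⟨2 * (t : ℝ), (unitInterval.mul_pos_mem_iff zero_lt_two).2 ⟨t.2.1, ht⟩⟩ :
      unitInterval) = 1
    · rw [h1, p.target] at h
      have := congrArg Subtype.val (hq (q.source.trans h))
      simp only [Icc.coe_zero] at this
      linarith
    · exact hpq _ h1 ⟨_, h.symm⟩
  intro t t' h
  rcases le_or_gt (t : ℝ) (1 / 2) with ht | ht <;> rcases le_or_gt (t' : ℝ) (1 / 2) with ht' | ht'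
  · rw [Path.trans_apply, Path.trans_apply, dif_pos ht, dif_pos ht'] at h
    have := congrArg Subtype.val (hp h)
    simp only at this
    ext; linarith
  · exact absurd h (key t t' ht ht')
  · exact absurd h.symm (key t' t ht' ht)
  · rw [Path.trans_apply, Path.trans_apply, dif_neg (not_le.2 ht), dif_neg (not_le.2 ht')] at h
    have := congrArg Subtype.val (hq h)
    simp only at this
    ext; linarith

/-! ### Discs, straight arcs in charts, and complements of arcs -/

/-- Removing an initial piece of a ray from its centre leaves a ball connected. -/
theorem isPreconnected_ball_diff_segment {z w : ℂ} {r : ℝ} (hr : r ≤ dist z w) :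
    IsPreconnected (Metric.ball z r \ segment ℝ z w) := by
  rcases le_or_gt r 0 with hr0 | hr0
  · rw [Metric.ball_eq_empty.2 hr0, empty_sdiff]
    exact isPreconnected_empty
  have hd : 0 < ‖w - z‖ := by
    rw [← dist_eq_norm, dist_comm]; exact hr0.trans_le hr
  set δ : ℝ := r / (2 * ‖w - z‖) with hδ
  have hδ0 : 0 < δ := by positivity
  have hδr : δ * ‖w - z‖ = r / 2 := by rw [hδ]; field_simp
  -- The point `c` lies on the opposite ray; the slit ball is star-shaped about it.
  set c : ℂ := z - δ • (w - z) with hc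
  have hmem : ∀ p : ℂ, p ∈ segment ℝ z w ↔ ∃ τ ∈ Icc (0 : ℝ) 1, p = z + τ • (w - z) := by
    intro p
    rw [segment_eq_image']
    constructor
    · rintro ⟨τ, hτ, rfl⟩; exact ⟨τ, hτ, rfl⟩
    · rintro ⟨τ, hτ, rfl⟩; exact ⟨τ, hτ, rfl⟩
  have hcb : c ∈ Metric.ball z r := by
    rw [Metric.mem_ball, dist_eq_norm, hc, sub_sub_cancel_left, norm_neg, norm_smul,
      Real.norm_of_nonneg hδ0.le, hδr]
    linarith
  have hwz : w - z ≠ 0 := norm_pos_iff.1 hd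
  have hcs : c ∉ segment ℝ z w := by
    rw [hmem]
    rintro ⟨τ, hτ, h⟩
    rw [hc, sub_eq_add_neg, ← neg_smul] at h
    have : -δ = τ := smul_left_injective ℝ hwz (add_left_cancel h)
    linarith [hτ.1]
  refine (StarConvex.isPathConnected (s := Metric.ball z r \ segment ℝ z w) (a := c) ?_ ⟨hcb, hcs⟩).isConnected.isPreconnected
  rw [starConvex_iff_segment_subset]
  rintro p ⟨hpb, hps⟩ q hq
  refine ⟨(convex_ball z r).segment_subset hcb hpb hq, fun hqs => hps ?_⟩
  rw [segment_eq_image'] at hq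
  obtain ⟨s, hs, rfl⟩ := hq
  rw [hmem] at hqs ⊢
  obtain ⟨τ, hτ, h⟩ := hqs
  have hs0 : s ≠ 0 := by
    rintro rfl
    apply hcs
    rw [hmem]
    exact ⟨τ, hτ, by simpa using h⟩
  have hspos : 0 < s := lt_of_le_of_ne hs.1 hs0.symm
  -- If the segment from `c` to `p` meets the slit, then `p` lies on the line of the slit, with
  -- coordinate `κ ≥ 0`; as `p` is in the ball and `r ≤ dist z w`, also `κ ≤ 1`.
  set κ : ℝ := (τ + (1 - s) * δ) / s with hκ
  have hsκ : s * κ = τ + (1 - s) * δ := by rw [hκ]; field_simp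
  have hp : p = z + κ • (w - z) := by
    have h2 : s • p = s • (z + κ • (w - z)) := by
      have : s • p = (z + τ • (w - z)) - (1 - s) • c := by
        rw [← h]
        module
      rw [this, smul_add, smul_smul, hsκ, hc]
      module
    exact smul_right_injective ℂ hs0 h2
  have hκ0 : 0 ≤ κ := div_nonneg (add_nonneg hτ.1 (mul_nonneg (by linarith [hs.2]) hδ0.le)) hspos.le
  refine ⟨κ, ⟨hκ0, ?_⟩, hp⟩
  rw [hp, Metric.mem_ball, dist_eq_norm, add_sub_cancel_left, norm_smul, Real.norm_of_nonneg hκ0] at hpb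
  rw [dist_comm, dist_eq_norm] at hr
  by_contra hcon
  nlinarith

/-- The punctured ball is the union of two balls slit along opposite radii, which share the point `z
+ (r / 2) i`. -/
theorem isPreconnected_ball_diff_singleton (z : ℂ) (r : ℝ) :
    IsPreconnected (Metric.ball z r \ {z}) := by
  rcases le_or_gt r 0 with hr0 | hr0
  · rw [Metric.ball_eq_empty.2 hr0, empty_sdiff]
    exact isPreconnected_empty
  have h1 := isPreconnected_ball_diff_segment (z := z) (w := z + r) (r := r)
    (by simp [abs_of_pos hr0])
  have h2 := isPreconnected_ball_diff_segment (z := z) (w := z - r) (r := r)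
    (by simp [abs_of_pos hr0])
  have hre : ∀ (p : ℂ) (σ : ℝ), p ∈ segment ℝ z (z + (σ : ℂ)) →
      ∃ τ ∈ Icc (0 : ℝ) 1, p = z + ((τ * σ : ℝ) : ℂ) := by
    intro p σ hp
    rw [segment_eq_image'] at hp
    obtain ⟨τ, hτ, rfl⟩ := hp
    exact ⟨τ, hτ, by simp⟩
  have hI : z + ((r / 2 : ℝ) : ℂ) * Complex.I ∈ Metric.ball z r := by
    simp [abs_of_pos hr0]
    linarith
  have hIn : ∀ σ : ℝ, z + ((r / 2 : ℝ) : ℂ) * Complex.I ∉ segment ℝ z (z + (σ : ℂ)) := by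
    intro σ h
    obtain ⟨τ, -, h⟩ := hre _ _ h
    have := congrArg Complex.im (add_left_cancel h)
    simp at this
    linarith
  have hunion : Metric.ball z r \ {z} = (Metric.ball z r \ segment ℝ z (z + r))
      ∪ (Metric.ball z r \ segment ℝ z (z - r)) := by
    ext p
    simp only [mem_sdiff, mem_singleton_iff, mem_union]
    constructor
    · rintro ⟨hp, hpz⟩
      by_contra hcon
      push Not at hcon
      obtain ⟨τ, hτ, h⟩ := hre p r (hcon.1 hp)
      have h' := hcon.2 hp
      rw [sub_eq_add_neg, ← Complex.ofReal_neg] at h'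
      obtain ⟨τ', hτ', h'⟩ := hre p (-r) h'
      rw [h] at h'
      have h3 := Complex.ofReal_injective (add_left_cancel h')
      have h4 : τ = 0 := by
        have : τ * r ≤ 0 := by rw [h3]; nlinarith [hτ'.1]
        nlinarith [hτ.1]
      apply hpz
      rw [h, h4]
      simp
    · rintro (⟨hp, hps⟩ | ⟨hp, hps⟩)
      · exact ⟨hp, fun h => hps (h ▸ left_mem_segment _ _ _)⟩
      · exact ⟨hp, fun h => hps (h ▸ left_mem_segment _ _ _)⟩
  rw [hunion]
  refine IsPreconnected.union (z + ((r / 2 : ℝ) : ℂ) * Complex.I) ⟨hI, hIn r⟩ ⟨hI, ?_⟩ h1 h2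
  have := hIn (-r)
  rwa [Complex.ofReal_neg, ← sub_eq_add_neg] at this

theorem exists_disc_chart [ChartedSpace ℂ X] (x : X) {N : Set X} (hN : N ∈ 𝓝 x) :
    ∃ (e : OpenPartialHomeomorph X ℂ) (r : ℝ), 0 < r ∧ x ∈ e.source ∧ e.source ⊆ N ∧
      e.target = Metric.ball (e x) r := by
  set e₀ := chartAt ℂ x
  have hx : x ∈ e₀.source := mem_chart_source ℂ x
  obtain ⟨N', hN', hN'o, hxN'⟩ := mem_nhds_iff.1 hN
  have hT : IsOpen (e₀.target ∩ e₀.symm ⁻¹' N') := e₀.isOpen_inter_preimage_symm hN'o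
  obtain ⟨r, hr, hball⟩ := Metric.isOpen_iff.1 hT (e₀ x)
    ⟨e₀.map_source hx, by simpa [e₀.left_inv hx] using hxN'⟩
  have hsrc : ∀ y, y ∈ (e₀.trans (OpenPartialHomeomorph.ofSet (Metric.ball (e₀ x) r)
      Metric.isOpen_ball)).source ↔ y ∈ e₀.source ∧ e₀ y ∈ Metric.ball (e₀ x) r := by
    intro y
    rw [OpenPartialHomeomorph.trans_source]
    rfl
  refine ⟨e₀.trans (OpenPartialHomeomorph.ofSet (Metric.ball (e₀ x) r) Metric.isOpen_ball), r, hr,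
    (hsrc x).2 ⟨hx, Metric.mem_ball_self hr⟩, ?_, ?_⟩
  · intro y hy
    rw [hsrc] at hy
    have := (hball hy.2).2
    rw [mem_preimage, e₀.left_inv hy.1] at this
    exact hN' this
  · rw [OpenPartialHomeomorph.trans_target]
    simp only [OpenPartialHomeomorph.ofSet_target, OpenPartialHomeomorph.ofSet_symm,
      OpenPartialHomeomorph.coe_trans, OpenPartialHomeomorph.ofSet_apply, Function.comp_apply, id]
    exact inter_eq_left.2 fun z hz => (hball hz).1

/-- The path which is read as a straight segment in a chart. -/
def chartSegment (e : OpenPartialHomeomorph X ℂ) (z w : ℂ) (h : segment ℝ z w ⊆ e.target) :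
    Path (e.symm z) (e.symm w) where
  toFun t := e.symm (AffineMap.lineMap z w (t : ℝ))
  continuous_toFun := by
    refine e.continuousOn_symm.comp_continuous
      (AffineMap.lineMap_continuous.comp continuous_subtype_val) fun t => h ?_
    rw [segment_eq_image_lineMap]
    exact ⟨t, t.2, rfl⟩
  source' := by simp
  target' := by simp

theorem chartSegment_apply (e : OpenPartialHomeomorph X ℂ) {z w : ℂ} (h : segment ℝ z w ⊆ e.target)
    (t : unitInterval) : chartSegment e z w h t = e.symm (AffineMap.lineMap z w (t : ℝ)) := rfl

theorem range_chartSegment (e : OpenPartialHomeomorph X ℂ) {z w : ℂ}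
    (h : segment ℝ z w ⊆ e.target) : range (chartSegment e z w h) = e.symm '' segment ℝ z w := by
  rw [segment_eq_image_lineMap, image_image]
  ext x
  constructor
  · rintro ⟨t, rfl⟩
    exact ⟨t, t.2, rfl⟩
  · rintro ⟨t, ht, rfl⟩
    exact ⟨⟨t, ht⟩, rfl⟩

theorem chartSegment_symm (e : OpenPartialHomeomorph X ℂ) {z w : ℂ}
    (h : segment ℝ z w ⊆ e.target) :
    (chartSegment e z w h).symm = chartSegment e w z (segment_symm ℝ z w ▸ h) := by
  ext t
  rw [Path.symm_apply, Function.comp_apply, chartSegment_apply, chartSegment_apply, unitInterval.coe_symm_eq,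
    AffineMap.lineMap_apply_one_sub]

theorem injective_chartSegment (e : OpenPartialHomeomorph X ℂ) {z w : ℂ}
    (h : segment ℝ z w ⊆ e.target) (hzw : z ≠ w) : Function.Injective (chartSegment e z w h) := by
  intro s t hst
  have hm : ∀ s : unitInterval, AffineMap.lineMap z w (s : ℝ) ∈ e.target := fun s => h (by
    rw [segment_eq_image_lineMap]
    exact ⟨s, s.2, rfl⟩)
  exact Subtype.ext (AffineMap.lineMap_injective ℝ hzw (e.symm.injOn (hm s) (hm t) hst))

/-- About a point `y` of the segment, a disc of radius at most `dist y w` minus the rest of the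
segment is a disc slit along a radius, which is connected. -/
theorem walkable_chartSegment (e : OpenPartialHomeomorph X ℂ) {z w : ℂ}
    (h : segment ℝ z w ⊆ e.target) (hzw : z ≠ w) : Walkable (chartSegment e z w h) := by
  refine walkable_of_isPreconnected_diff _ fun s hs N hN => ?_
  set y : ℂ := AffineMap.lineMap z w (s : ℝ) with hy
  have hyt : y ∈ e.target := h (by rw [segment_eq_image_lineMap]; exact ⟨s, s.2, rfl⟩)
  rw [chartSegment_apply] at hN
  have hyw : 0 < dist y w := by
    rw [dist_pos]
    intro hyw
    apply hs
    have : (AffineMap.lineMap z w (s : ℝ) : ℂ) = AffineMap.lineMap z w (1 : ℝ) := by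
      rw [← hy, hyw, AffineMap.lineMap_apply_one]
    exact Subtype.ext (AffineMap.lineMap_injective ℝ hzw this)
  have hN' : e.symm ⁻¹' N ∩ e.target ∈ 𝓝 y :=
    Filter.inter_mem ((e.continuousAt_symm hyt).preimage_mem_nhds hN) (e.open_target.mem_nhds hyt)
  obtain ⟨r, hr, hball⟩ := Metric.mem_nhds_iff.1 hN'
  set r' := min r (dist y w)
  have hr' : 0 < r' := lt_min hr hyw
  have hball' : Metric.ball y r' ⊆ e.symm ⁻¹' N ∩ e.target :=
    (Metric.ball_subset_ball (min_le_left _ _)).trans hball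
  have himg : chartSegment e z w h '' Ici s = e.symm '' segment ℝ y w := by
    ext x
    constructor
    · rintro ⟨t, ht, rfl⟩
      refine ⟨_, ?_, rfl⟩
      have ht' : (s : ℝ) ≤ t := ht
      have : (AffineMap.lineMap z w (t : ℝ) : ℂ) ∈ (AffineMap.lineMap z w : ℝ →ᵃ[ℝ] ℂ) ''
          segment ℝ (s : ℝ) 1 := ⟨t, by rw [segment_eq_Icc s.2.2]; exact ⟨ht', t.2.2⟩, rfl⟩
      rwa [image_segment, AffineMap.lineMap_apply_one] at this
    · rintro ⟨q, hq, rfl⟩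
      have : q ∈ (AffineMap.lineMap z w : ℝ →ᵃ[ℝ] ℂ) '' segment ℝ (s : ℝ) 1 := by
        rwa [image_segment, AffineMap.lineMap_apply_one]
      obtain ⟨t, ht, rfl⟩ := this
      rw [segment_eq_Icc s.2.2] at ht
      exact ⟨⟨t, s.2.1.trans ht.1, ht.2⟩, ht.1, rfl⟩
  have hsegt : segment ℝ y w ⊆ e.target := by
    refine Subset.trans ((convex_segment z w).segment_subset ?_ (right_mem_segment _ _ _)) h
    rw [segment_eq_image_lineMap]; exact ⟨s, s.2, rfl⟩
  have image_sdiff_ball : e.symm '' (Metric.ball y r' \ segment ℝ y w)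
      = e.symm '' Metric.ball y r' \ e.symm '' segment ℝ y w := by
    refine Subset.antisymm ?_ ?_
    swap
    · rintro _ ⟨⟨q, hq, rfl⟩, hqs⟩
      exact ⟨q, ⟨hq, fun h' => hqs ⟨q, h', rfl⟩⟩, rfl⟩
    rintro _ ⟨q, ⟨hq, hqs⟩, rfl⟩
    refine ⟨⟨q, hq, rfl⟩, ?_⟩
    rintro ⟨q', hq', h'⟩
    exact hqs (e.symm.injOn (hsegt hq') (hball' hq).2 h' ▸ hq')
  refine ⟨e.symm '' Metric.ball y r', ?_, ?_, ⟨y, Metric.mem_ball_self hr', rfl⟩, ?_⟩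
  · rintro _ ⟨q, hq, rfl⟩
    exact (hball' hq).1
  · exact e.isOpen_image_symm_of_subset_target Metric.isOpen_ball fun q hq => (hball' hq).2
  · rw [himg, ← image_sdiff_ball]
    exact (isPreconnected_ball_diff_segment (min_le_right _ _)).image _
      (e.continuousOn_symm.mono fun q hq => (hball' hq.1).2)

theorem exists_isPreconnected_diff_singleton [ChartedSpace ℂ X] (x : X) {N : Set X} (hN : N ∈ 𝓝 x) :
    ∃ D ⊆ N, IsOpen D ∧ x ∈ D ∧ IsPreconnected (D \ {x}) := by
  obtain ⟨e, r, hr, hx, hsub, htar⟩ := exists_disc_chart x hN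
  refine ⟨e.source, hsub, e.open_source, hx, ?_⟩
  have : e.source \ {x} = e.symm '' (Metric.ball (e x) r \ {e x}) := by
    ext y
    constructor
    · rintro ⟨hy, hyx⟩
      refine ⟨e y, ⟨htar ▸ e.map_source hy, fun h => hyx (e.injOn hy hx h)⟩, e.left_inv hy⟩
    · rintro ⟨q, ⟨hq, hqx⟩, rfl⟩
      rw [← htar] at hq
      exact ⟨e.map_target hq, fun h => hqx (by rw [mem_singleton_iff] at h ⊢; rw [← h, e.right_inv hq])⟩
  rw [this]
  exact (isPreconnected_ball_diff_singleton _ _).image _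
    (e.continuousOn_symm.mono fun q hq => htar ▸ hq.1)

theorem disjoint_inter_closure {U V : Set X} (hU : IsOpen U) (hV : IsOpen V) (hUV : Disjoint U V) :
    Disjoint (U ∪ V) (closure U ∩ closure V) := by
  rw [disjoint_left]
  rintro x (hx | hx) ⟨hxU, hxV⟩
  · exact (hUV.closure_right hU).le_bot ⟨hx, hxV⟩
  · exact (hUV.closure_left hV).le_bot ⟨hxU, hx⟩

/-- A splitting of `G` into open sets without common limit points in `C` would extend to a splitting
of `C` by their closures, because `G` is dense in `C`. -/
theorem isPreconnected_of_forall_disjoint_closure {C G : Set X} (hC : IsPreconnected C)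
    (hG : IsOpen G) (hGC : G ⊆ C) (hCG : C ⊆ closure G)
    (h : ∀ U V : Set X, IsOpen U → IsOpen V → Disjoint U V → U ∪ V = G →
      Disjoint C (closure U ∩ closure V)) : IsPreconnected G := by
  rw [isPreconnected_iff_subset_of_disjoint]
  intro u v hu hv huv hdisj
  have hd : Disjoint (u ∩ G) (v ∩ G) := by
    rw [disjoint_left]
    rintro x ⟨hxu, hxG⟩ ⟨hxv, -⟩
    have : x ∈ G ∩ (u ∩ v) := ⟨hxG, hxu, hxv⟩
    rw [hdisj] at this
    exact this
  have hun : (u ∩ G) ∪ (v ∩ G) = G := by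
    rw [← union_inter_distrib_right]
    exact inter_eq_right.2 huv
  have hZ := h _ _ (hu.inter hG) (hv.inter hG) hd hun
  rcases subset_closure_or_of_isPreconnected hC (by rwa [hun]) hZ with h' | h'
  · left
    intro x hx
    rcases huv hx with hxu | hxv
    · exact hxu
    · exact (hZ.le_bot ⟨hGC hx, h' (hGC hx), subset_closure ⟨hxv, hx⟩⟩).elim
  · right
    intro x hx
    rcases huv hx with hxu | hxv
    · exact (hZ.le_bot ⟨hGC hx, subset_closure ⟨hxu, hx⟩, h' (hGC hx)⟩).elim
    · exact hxv

theorem IsOpen.subset_closure_diff {C W : Set X} (hC : IsOpen C) (hW : interior W = ∅) :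
    C ⊆ closure (C \ W) := by
  intro x hx
  rw [mem_closure_iff]
  intro o ho hxo
  have : ¬ (o ∩ C ⊆ W) := fun hsub => by
    have : x ∈ interior W := mem_interior.2 ⟨o ∩ C, hsub, ho.inter hC, hxo, hx⟩
    rw [hW] at this
    exact this
  obtain ⟨y, hy, hyW⟩ := not_subset.1 this
  exact ⟨y, hy.1, hy.2, hyW⟩

/-- Walking along `p` excludes common limit points everywhere except at the end of `p`; walking
along `p.symm` excludes that one as well. -/
theorem isPreconnected_diff_range [T2Space X] {C : Set X} (hC : IsPreconnected C) (hCo : IsOpen C)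
    {a b : X} {p : Path a b} (hp : Walkable p) (hp' : Walkable p.symm) (hpC : range p ⊆ C)
    (hint : interior (range p) = ∅) : IsPreconnected (C \ range p) := by
  have hcl : IsClosed (range p) := (isCompact_range p.continuous).isClosed
  refine isPreconnected_of_forall_disjoint_closure hC (hCo.sdiff hcl) sdiff_subset
    (IsOpen.subset_closure_diff hCo hint) fun U V hU hV hUV hun => ?_
  have hd : Disjoint (U ∪ V) (range p) := by rw [hun]; exact disjoint_sdiff_left
  have hZ := disjoint_inter_closure hU hV hUV
  have hN : ∀ x ∈ range p, ∃ N ∈ 𝓝 x, N ⊆ closure (U ∪ V) ∧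
      N ∩ (closure U ∩ closure V) ⊆ range p := by
    intro x hx
    refine ⟨C, hCo.mem_nhds (hpC hx), ?_, ?_⟩
    · rw [hun]; exact IsOpen.subset_closure_diff hCo hint
    · rintro z ⟨hzC, hz⟩
      by_contra hzp
      exact hZ.le_bot ⟨by rw [hun]; exact ⟨hzC, hzp⟩, hz⟩
  have h1 := hp U V hU hV hUV hd fun s _ => hN _ ⟨s, rfl⟩
  have h2 := hp' U V hU hV hUV (by rwa [Path.symm_range]) fun s _ => by
    rw [Path.symm_range]
    exact hN _ (by rw [← Path.symm_range]; exact ⟨s, rfl⟩)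
  rw [disjoint_left]
  intro x hxC hx
  by_cases hxp : x ∈ range p
  · obtain ⟨s, rfl⟩ := hxp
    by_cases hs : s = 1
    · subst hs
      refine h2 0 (by simp) ?_
      rwa [p.symm.source, ← p.target]
    · exact h1 s hs hx
  · exact hZ.le_bot ⟨by rw [hun]; exact ⟨hxC, hxp⟩, hx⟩

/-- An arc with interior would contain a punctured disc, which is connected; but its parameters
would lie on both sides of the parameter of the puncture. -/
theorem interior_range_path_eq_empty [ChartedSpace ℂ X] [T2Space X] {a b : X} {p : Path a b}
    (hp : Function.Injective p) : interior (range p) = ∅ := by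
  by_contra hne
  obtain ⟨x, hx⟩ := nonempty_iff_ne_empty.2 hne
  obtain ⟨s₀, rfl⟩ := interior_subset hx
  have hcl : closure (Ioo (0 : unitInterval) 1) = Icc 0 1 := closure_Ioo zero_ne_one
  have hs₀ : s₀ ∈ closure (Ioo (0 : unitInterval) 1) := by
    rw [hcl]; exact ⟨unitInterval.nonneg', unitInterval.le_one'⟩
  obtain ⟨s, hs, hs01⟩ := mem_closure_iff.1 hs₀ _ (isOpen_interior.preimage p.continuous) hx
  obtain ⟨D, hDN, hDo, hsD, hpre⟩ :=
    exists_isPreconnected_diff_singleton (p s) (isOpen_interior.mem_nhds hs)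
  have hemb := p.continuous.isClosedEmbedding hp
  have himg : p '' (p ⁻¹' (D \ {p s})) = D \ {p s} :=
    image_preimage_eq_of_subset fun z hz => interior_subset (hDN hz.1)
  rw [← himg, hemb.isInducing.isPreconnected_image] at hpre
  have hA : p ⁻¹' D ∈ 𝓝 s := p.continuous.continuousAt.preimage_mem_nhds (hDo.mem_nhds hsD)
  obtain ⟨l, hl, hlA⟩ := exists_Ioc_subset_of_mem_nhds hA ⟨0, hs01.1⟩
  obtain ⟨u, hu, huA⟩ := exists_Ico_subset_of_mem_nhds hA ⟨1, hs01.2⟩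
  obtain ⟨s₁, hs₁l, hs₁⟩ := exists_between hl
  obtain ⟨s₂, hs₂, hs₂u⟩ := exists_between hu
  have h1 : s₁ ∈ p ⁻¹' (D \ {p s}) := ⟨hlA ⟨hs₁l, hs₁.le⟩, fun h => hs₁.ne (hp h)⟩
  have h2 : s₂ ∈ p ⁻¹' (D \ {p s}) := ⟨huA ⟨hs₂.le, hs₂u⟩, fun h => hs₂.ne' (hp h)⟩
  have h3 := hpre.ordConnected.out h1 h2 ⟨hs₁.le, hs₂.le⟩
  exact h3.2 rfl

/-! ### Homeomorphisms supported in small discs -/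

/-- A homeomorphism of the plane which moves the centre of a ball and is the identity
outside of it. -/
theorem exists_homeomorph_ball {c y : ℂ} {r : ℝ} (hy : y ∈ Metric.ball c r) :
    ∃ f : ℂ ≃ₜ ℂ, f c = y ∧ ∀ w, w ∉ Metric.ball c r → f w = w := by
  rw [Metric.mem_ball, dist_eq_norm] at hy
  have hr : 0 < r := (norm_nonneg _).trans_lt hy
  set v := y - c
  -- A push by `v`, damped linearly to zero towards the boundary. It differs from the identity by a
  -- map with Lipschitz constant `‖v‖ / r < 1`, which makes it a homeomorphism.
  set f : ℂ → ℂ := fun w => w + (max 0 (r - dist w c) / r) • v with hf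
  obtain ⟨k, hk⟩ : ∃ k : NNReal, (k : ℝ) = ‖v‖ / r := ⟨⟨‖v‖ / r, by positivity⟩, rfl⟩
  have happ : ApproximatesLinearOn f ((ContinuousLinearEquiv.refl ℝ ℂ : ℂ ≃L[ℝ] ℂ) : ℂ →L[ℝ] ℂ)
      univ k := by
    intro x _ x' _
    have h1 : f x - f x' - (ContinuousLinearEquiv.refl ℝ ℂ : ℂ →L[ℝ] ℂ) (x - x')
        = ((max 0 (r - dist x c) - max 0 (r - dist x' c)) / r) • v := by
      simp only [hf, ContinuousLinearEquiv.coe_refl, ContinuousLinearMap.coe_id', id]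
      module
    rw [h1, norm_smul, norm_div, Real.norm_of_nonneg hr.le, hk]
    have h2 : ‖max 0 (r - dist x c) - max 0 (r - dist x' c)‖ ≤ ‖x - x'‖ := by
      have h3 := abs_max_sub_max_le_abs (r - dist x c) (r - dist x' c) 0
      rw [max_comm _ (0 : ℝ), max_comm _ (0 : ℝ)] at h3
      refine h3.trans ?_
      rw [← dist_eq_norm]
      have := abs_dist_sub_le x x' c
      rwa [sub_sub_sub_cancel_left, abs_sub_comm]
    calc _ ≤ ‖x - x'‖ / r * ‖v‖ := by gcongr
      _ = _ := by ring
  have hc : Subsingleton ℂ ∨ k < ‖((ContinuousLinearEquiv.refl ℝ ℂ).symm : ℂ →L[ℝ] ℂ)‖₊⁻¹ := by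
    right
    have : ‖((ContinuousLinearEquiv.refl ℝ ℂ).symm : ℂ →L[ℝ] ℂ)‖₊ = 1 := by
      ext
      exact ContinuousLinearMap.norm_id
    rw [this, inv_one, ← NNReal.coe_lt_coe, hk, NNReal.coe_one, div_lt_one hr]
    exact hy
  refine ⟨happ.toHomeomorph f hc, ?_, ?_⟩
  · change f c = y
    simp only [hf, dist_self, sub_zero, max_eq_right hr.le, div_self hr.ne', one_smul, v]
    ring
  · intro w hw
    change f w = w
    rw [Metric.mem_ball, not_lt] at hw
    simp [hf, max_eq_left (sub_nonpos.2 hw)]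

/-- A homeomorphism of the plane supported in a ball extends from a chart to the surface. -/
theorem exists_homeomorph_extend [T2Space X] (e : OpenPartialHomeomorph X ℂ) {c : ℂ} {r : ℝ}
    (hb : Metric.closedBall c r ⊆ e.target) (f : ℂ ≃ₜ ℂ)
    (hf : ∀ w, w ∉ Metric.ball c r → f w = w) :
    ∃ Ψ : X ≃ₜ X, (∀ x ∈ e.source, Ψ x = e.symm (f (e x))) ∧
      ∀ x, x ∉ e.symm '' Metric.ball c r → Ψ x = x := by
  classical
  set K : Set X := e.symm '' Metric.closedBall c r with hK
  have hKc : IsClosed K :=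
    ((isCompact_closedBall _ _).image_of_continuousOn (e.continuousOn_symm.mono hb)).isClosed
  -- Stated for every such homeomorphism in order to be applied to `f` and to its inverse.
  -- Continuity outside of the chart uses that `K` is closed in `X`, as the image of a compact ball.
  have gen : ∀ f : ℂ ≃ₜ ℂ, (∀ w, w ∉ Metric.ball c r → f w = w) →
      (∀ w ∈ e.target, f w ∈ e.target) ∧ Continuous (e.source.piecewise (fun x => e.symm (f (e x))) id) ∧
      ∀ w, w ∉ Metric.ball c r → f.symm w = w := by
    intro f hf
    have hsym : ∀ w, w ∉ Metric.ball c r → f.symm w = w := fun w hw => by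
      rw [Homeomorph.symm_apply_eq, hf w hw]
    have hmap : ∀ w ∈ e.target, f w ∈ e.target := by
      intro w hw
      by_cases h : w ∈ Metric.ball c r
      · by_cases h' : f w ∈ Metric.ball c r
        · exact hb (Metric.ball_subset_closedBall h')
        · have h2 := hsym _ h'
          rw [f.symm_apply_apply] at h2
          rwa [← h2]
      · rwa [hf w h]
    refine ⟨hmap, ?_, hsym⟩
    rw [continuous_iff_continuousAt]
    intro x
    by_cases hx : x ∈ e.source
    · have hE : (fun x => e.symm (f (e x))) =ᶠ[𝓝 x]
          e.source.piecewise (fun x => e.symm (f (e x))) id := by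
        filter_upwards [e.open_source.mem_nhds hx] with y hy
        rw [piecewise_eq_of_mem _ _ _ hy]
      refine ContinuousAt.congr ?_ hE
      have h1 : ContinuousAt (f ∘ e) x := f.continuous.continuousAt.comp (e.continuousAt hx)
      exact ContinuousAt.comp (g := e.symm) (f := f ∘ e)
        (e.continuousAt_symm (hmap _ (e.map_source hx))) h1
    · have hxK : x ∈ Kᶜ := by
        rintro ⟨w, hw, rfl⟩
        exact hx (e.map_target (hb hw))
      have hE : id =ᶠ[𝓝 x] e.source.piecewise (fun x => e.symm (f (e x))) id := by
        filter_upwards [hKc.isOpen_compl.mem_nhds hxK] with y hy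
        by_cases hys : y ∈ e.source
        · rw [piecewise_eq_of_mem _ _ _ hys, hf, e.left_inv hys]
          · rfl
          · exact fun h => hy ⟨e y, Metric.ball_subset_closedBall h, e.left_inv hys⟩
        · rw [piecewise_eq_of_notMem _ _ _ hys]
      exact continuousAt_id.congr hE
  obtain ⟨hm, hcont, hsym⟩ := gen f hf
  obtain ⟨hm', hcont', -⟩ := gen f.symm hsym
  refine ⟨⟨⟨e.source.piecewise (fun x => e.symm (f (e x))) id,
    e.source.piecewise (fun x => e.symm (f.symm (e x))) id, ?_, ?_⟩, hcont, hcont'⟩, ?_, ?_⟩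
  · intro x
    by_cases hx : x ∈ e.source
    · have h1 := hm _ (e.map_source hx)
      rw [piecewise_eq_of_mem _ _ _ hx, piecewise_eq_of_mem _ _ _ (e.map_target h1),
        e.right_inv h1, f.symm_apply_apply, e.left_inv hx]
    · rw [piecewise_eq_of_notMem _ _ _ hx, id, piecewise_eq_of_notMem _ _ _ hx, id]
  · intro x
    by_cases hx : x ∈ e.source
    · have h1 := hm' _ (e.map_source hx)
      rw [piecewise_eq_of_mem _ _ _ hx, piecewise_eq_of_mem _ _ _ (e.map_target h1),
        e.right_inv h1, f.apply_symm_apply, e.left_inv hx]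
    · rw [piecewise_eq_of_notMem _ _ _ hx, id, piecewise_eq_of_notMem _ _ _ hx, id]
  · intro x hx
    change e.source.piecewise (fun x => e.symm (f (e x))) id x = _
    exact piecewise_eq_of_mem _ _ _ hx
  · intro x hx
    change e.source.piecewise (fun x => e.symm (f (e x))) id x = x
    by_cases hxs : x ∈ e.source
    · rw [piecewise_eq_of_mem _ _ _ hxs, hf, e.left_inv hxs]
      exact fun h => hx ⟨e x, h, e.left_inv hxs⟩
    · rw [piecewise_eq_of_notMem _ _ _ hxs, id]

/-- The homeomorphisms supported in a connected open subset of a surface act transitively on it. -/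
theorem exists_homeomorph_moving [ChartedSpace ℂ X] [T2Space X] {O : Set X} (hO : IsOpen O)
    (hpre : IsPreconnected O) {z y : X} (hz : z ∈ O) (hy : y ∈ O) :
    ∃ Ψ : X ≃ₜ X, Ψ z = y ∧ ∀ x, x ∉ O → Ψ x = x := by
  refine hpre.induction₂ (fun z y => ∃ Ψ : X ≃ₜ X, Ψ z = y ∧ ∀ x, x ∉ O → Ψ x = x) ?_ ?_ ?_ hz hy
  · intro x hx
    obtain ⟨e, r, hr, hxs, hsub, htar⟩ := exists_disc_chart x (hO.mem_nhds hx)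
    have hr2 : Metric.closedBall (e x) (r / 2) ⊆ e.target := by
      rw [htar]; exact Metric.closedBall_subset_ball (by linarith)
    have h1 : e ⁻¹' Metric.ball (e x) (r / 2) ∈ 𝓝 x :=
      (e.continuousAt hxs).preimage_mem_nhds (Metric.ball_mem_nhds _ (by linarith))
    refine mem_nhdsWithin_of_mem_nhds ?_
    filter_upwards [h1, e.open_source.mem_nhds hxs] with y hy hys
    obtain ⟨f, hfc, hf⟩ := exists_homeomorph_ball hy
    obtain ⟨Ψ, hΨ, hΨ'⟩ := exists_homeomorph_extend e hr2 f hf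
    refine ⟨Ψ, by rw [hΨ x hxs, hfc, e.left_inv hys], fun q hq => hΨ' q ?_⟩
    rintro ⟨w, hw, rfl⟩
    exact hq (hsub (e.map_target (hr2 (Metric.ball_subset_closedBall hw))))
  · rintro x y z - - - ⟨Ψ, h1, h2⟩ ⟨Φ, h3, h4⟩
    exact ⟨Ψ.trans Φ, by simp [h1, h3], fun q hq => by simp [h2 q hq, h4 q hq]⟩
  · rintro x y - - ⟨Ψ, h1, h2⟩
    exact ⟨Ψ.symm, by rw [← h1, Ψ.symm_apply_apply], fun q hq => by
      rw [Homeomorph.symm_apply_eq, h2 q hq]⟩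

/-! ### Separation in the plane, expressed by logarithms -/

/-- The function `z ↦ (z - a) / (z - b)` has a continuous logarithm on `K`: the points `a` and `b`
are not separated by `K`. -/
def LogEquiv (K : Set ℂ) (a b : ℂ) : Prop :=
  ∃ g : ℂ → ℂ, ContinuousOn g K ∧ ∀ z ∈ K, Complex.exp (g z) * (z - b) = z - a

theorem LogEquiv.refl (K : Set ℂ) (a : ℂ) : LogEquiv K a a :=
  ⟨fun _ => 0, continuousOn_const, fun z _ => by simp⟩

theorem LogEquiv.symm {K : Set ℂ} {a b : ℂ} (h : LogEquiv K a b) : LogEquiv K b a := by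
  obtain ⟨g, hg, h⟩ := h
  refine ⟨fun z => -g z, hg.neg, fun z hz => ?_⟩
  rw [← h z hz, ← mul_assoc, ← Complex.exp_add]
  simp

theorem LogEquiv.trans {K : Set ℂ} {a b c : ℂ} (h : LogEquiv K a b) (h' : LogEquiv K b c) :
    LogEquiv K a c := by
  obtain ⟨g, hg, h⟩ := h
  obtain ⟨g', hg', h'⟩ := h'
  refine ⟨fun z => g z + g' z, hg.add hg', fun z hz => ?_⟩
  rw [Complex.exp_add, mul_assoc, h' z hz, h z hz]

/-- If `a'` is closer to `a` than `K` is, then `(z - a') / (z - a)` has distance less than `1` from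
`1` on `K`, where the principal logarithm is continuous. Thus the classes of `LogEquiv K` are open
off `K`. -/
theorem eventually_logEquiv {K : Set ℂ} (hK : IsClosed K) {a : ℂ} (ha : a ∉ K) :
    ∀ᶠ a' in 𝓝 a, LogEquiv K a' a := by
  obtain ⟨r, hr, hball⟩ := Metric.isOpen_iff.1 hK.isOpen_compl a ha
  filter_upwards [Metric.ball_mem_nhds a hr] with a' ha'
  have hne : ∀ z ∈ K, z - a ≠ 0 := by
    intro z hz h
    rw [sub_eq_zero] at h
    exact ha (h ▸ hz)
  have hslit : ∀ z ∈ K, (z - a') / (z - a) ∈ Complex.slitPlane := by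
    intro z hz
    have h1 : r ≤ ‖z - a‖ := by
      by_contra hcon
      exact hball (show z ∈ Metric.ball a r by rw [Metric.mem_ball, dist_eq_norm]; linarith) hz
    have h2 : (z - a') / (z - a) = 1 + (a - a') / (z - a) := by
      rw [eq_comm, ← div_self (hne z hz), ← add_div]
      ring
    rw [h2]
    apply Complex.mem_slitPlane_of_norm_lt_one
    rw [norm_div, div_lt_one (hr.trans_le h1)]
    rw [Metric.mem_ball, dist_comm, dist_eq_norm] at ha'
    linarith
  refine ⟨fun z => Complex.log ((z - a') / (z - a)), ?_, ?_⟩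
  · refine ContinuousOn.clog ?_ hslit
    exact (continuousOn_id.sub continuousOn_const).div (continuousOn_id.sub continuousOn_const) hne
  · intro z hz
    rw [Complex.exp_log (Complex.slitPlane_ne_zero (hslit z hz)), div_mul_cancel₀ _ (hne z hz)]

/-- If the quotient equals `-t` with `t ≥ 0`, then `z` is the convex combination of `a` and `b` with
weights `1 / (1 + t)` and `t / (1 + t)`. So the principal logarithm of the quotient is available off
`[a, b]`. -/
theorem div_mem_slitPlane_of_notMem_segment {a b z : ℂ} (hz : z ∉ segment ℝ a b) :
    (z - a) / (z - b) ∈ Complex.slitPlane := by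
  by_contra h
  apply hz
  by_cases hzb : z = b
  · rw [hzb]; exact right_mem_segment _ _ _
  have hne : z - b ≠ 0 := sub_ne_zero.2 hzb
  rw [Complex.mem_slitPlane_iff] at h
  push Not at h
  set t : ℝ := -((z - a) / (z - b)).re with ht
  have ht0 : 0 ≤ t := by linarith [h.1]
  have h1 : (z - a) / (z - b) = ((-t : ℝ) : ℂ) := by
    apply Complex.ext
    · rw [Complex.ofReal_re, ht, neg_neg]
    · rw [Complex.ofReal_im, h.2]
  rw [div_eq_iff hne] at h1
  refine ⟨1 / (1 + t), t / (1 + t), by positivity, by positivity, by field_simp, ?_⟩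
  have h2 : ((1 + t : ℝ) : ℂ) ≠ 0 := by
    rw [Complex.ofReal_ne_zero]; positivity
  rw [Complex.real_smul, Complex.real_smul]
  push_cast at h1 h2 ⊢
  field_simp
  linear_combination -h1

/-- A closed curve which crosses a small segment exactly once separates its endpoints. -/
theorem not_logEquiv_of_single_crossing {w u : ℂ} (hwu : w ≠ u) {R : Set ℂ} (hR : IsPreconnected R)
    (hwR : w ∈ R) (huR : u ∈ R) {ε : ℝ} (hε : 0 < ε)
    (hseg : ∀ s ∈ Icc (-ε) ε, (w + u) / 2 + s * Complex.I * (u - w) ∉ R) :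
    ¬ LogEquiv (segment ℝ w u ∪ R) ((w + u) / 2 + ε * Complex.I * (u - w))
      ((w + u) / 2 - ε * Complex.I * (u - w)) := by
  rintro ⟨g, hg, hexp⟩
  set d := u - w with hd
  set m := (w + u) / 2 with hm
  have hd0 : d ≠ 0 := sub_ne_zero.2 hwu.symm
  set a := m + ε * Complex.I * d with ha
  set b := m - ε * Complex.I * d with hb
  set K := segment ℝ w u ∪ R with hK
  have hsegab : ∀ z, z ∈ segment ℝ a b → ∃ s ∈ Icc (-ε) ε, z = m + s * Complex.I * d := by
    intro z hz
    rw [segment_eq_image'] at hz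
    obtain ⟨t, ht, rfl⟩ := hz
    refine ⟨ε - 2 * t * ε, ⟨by nlinarith [ht.2], by nlinarith [ht.1]⟩, ?_⟩
    simp only [ha, hb, Complex.real_smul]
    push_cast
    ring
  have hsegwu : ∀ z, z ∈ segment ℝ w u ↔ ∃ τ ∈ Icc (-(1 / 2) : ℝ) (1 / 2), z = m + τ * d := by
    intro z
    rw [segment_eq_image']
    constructor
    · rintro ⟨t, ht, rfl⟩
      refine ⟨t - 1 / 2, ⟨by linarith [ht.1], by linarith [ht.2]⟩, ?_⟩
      simp only [hm, hd, Complex.real_smul]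
      push_cast
      ring
    · rintro ⟨τ, hτ, rfl⟩
      refine ⟨τ + 1 / 2, ⟨by linarith [hτ.1], by linarith [hτ.2]⟩, ?_⟩
      simp only [hm, hd, Complex.real_smul]
      push_cast
      ring
  have hcross : ∀ τ s : ℝ, m + τ * d = m + s * Complex.I * d → τ = 0 := by
    intro τ s h
    have h1 := mul_right_cancel₀ hd0 (add_left_cancel h)
    have := congrArg Complex.re h1
    simpa using this
  have hns : ∀ z ∈ K \ {m}, z ∉ segment ℝ a b := by
    rintro z ⟨hz | hz, hzm⟩ hzs
    · obtain ⟨τ, hτ, rfl⟩ := (hsegwu z).1 hz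
      obtain ⟨s, hs, h⟩ := hsegab _ hzs
      apply hzm
      rw [hcross τ s h]
      simp
    · obtain ⟨s, hs, rfl⟩ := hsegab _ hzs
      exact hseg s hs hz
  -- The principal branch `L` is defined on `K` except at the crossing point `m`. A global logarithm
  -- `g` would differ from it by a constant on the connected set `K \ {m}`, but `L` has different
  -- limits at `m` from the two sides.
  set L : ℂ → ℂ := fun z => Complex.log ((z - a) / (z - b)) with hL
  have hbK : ∀ z ∈ K \ {m}, z - b ≠ 0 := fun z hz h =>
    hns z hz (by rw [sub_eq_zero.1 h]; exact right_mem_segment _ _ _)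
  have hLc : ContinuousOn L (K \ {m}) := by
    refine ContinuousOn.clog ?_ fun z hz => div_mem_slitPlane_of_notMem_segment (hns z hz)
    exact (continuousOn_id.sub continuousOn_const).div (continuousOn_id.sub continuousOn_const) hbK
  have hint : ∀ z ∈ K \ {m}, ∃ n : ℤ, g z - L z = n * (2 * Real.pi * Complex.I) := by
    intro z hz
    rw [← Complex.exp_eq_one_iff, Complex.exp_sub, hL,
      Complex.exp_log (Complex.slitPlane_ne_zero (div_mem_slitPlane_of_notMem_segment (hns z hz)))]
    have h1 := hexp z hz.1
    have h2 : z - a ≠ 0 := fun h =>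
      hns z hz (by rw [sub_eq_zero.1 h]; exact left_mem_segment _ _ _)
    have h3 := hbK z hz
    rw [← h1, mul_div_assoc, div_self h3, mul_one, div_self (Complex.exp_ne_zero _)]
  have hmR : m ∉ R := by
    have := hseg 0 ⟨by linarith, hε.le⟩
    simpa using this
  -- Without `m`, the segment falls into two halves; each contains an end of the segment, and both
  -- ends belong to the connected set `R`.
  have hKm : IsPreconnected (K \ {m}) := by
    have hcont : Continuous fun τ : ℝ => m + τ * d := by fun_prop
    have hA : IsPreconnected ((fun τ : ℝ => m + τ * d) '' Ico (-(1 / 2)) 0) :=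
      isPreconnected_Ico.image _ hcont.continuousOn
    have hB : IsPreconnected ((fun τ : ℝ => m + τ * d) '' Ioc 0 (1 / 2)) :=
      isPreconnected_Ioc.image _ hcont.continuousOn
    have hw : w = m + ((-(1 / 2) : ℝ) : ℂ) * d := by
      simp only [hm, hd]; push_cast; ring
    have hu : u = m + ((1 / 2 : ℝ) : ℂ) * d := by
      simp only [hm, hd]; push_cast; ring
    have h1 := IsPreconnected.union (s := (fun τ : ℝ => m + τ * d) '' Ico (-(1 / 2)) 0) w
      ⟨-(1 / 2), by norm_num, hw.symm⟩ hwR hA hR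
    have h2 := IsPreconnected.union (t := (fun τ : ℝ => m + τ * d) '' Ioc 0 (1 / 2)) u
      (Or.inr huR) ⟨1 / 2, by norm_num, hu.symm⟩ h1 hB
    convert h2 using 1
    ext z
    constructor
    · rintro ⟨hz | hz, hzm⟩
      · obtain ⟨τ, hτ, rfl⟩ := (hsegwu z).1 hz
        rcases lt_trichotomy τ 0 with h0 | h0 | h0
        · exact Or.inl (Or.inl ⟨τ, ⟨hτ.1, h0⟩, rfl⟩)
        · exact absurd (by simp [h0]) hzm
        · exact Or.inr ⟨τ, ⟨h0, hτ.2⟩, rfl⟩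
      · exact Or.inl (Or.inr hz)
    · have hne : ∀ τ : ℝ, τ ≠ 0 → m + τ * d ≠ m := by
        intro τ hτ h
        have : (τ : ℂ) * d = 0 := by linear_combination h
        rcases mul_eq_zero.1 this with h | h
        · exact hτ (by exact_mod_cast h)
        · exact hd0 h
      rintro ((⟨τ, hτ, rfl⟩ | hz) | ⟨τ, hτ, rfl⟩)
      · exact ⟨Or.inl ((hsegwu _).2 ⟨τ, ⟨hτ.1, by linarith [hτ.2]⟩, rfl⟩), hne τ hτ.2.ne⟩
      · exact ⟨Or.inr hz, fun h => hmR (h ▸ hz)⟩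
      · exact ⟨Or.inl ((hsegwu _).2 ⟨τ, ⟨by linarith [hτ.1], hτ.2⟩, rfl⟩), hne τ hτ.1.ne'⟩
  have hFc : ContinuousOn (fun z => g z - L z) (K \ {m}) := (hg.mono sdiff_subset).sub hLc
  have hconst : ∀ z ∈ K \ {m}, ∀ z' ∈ K \ {m}, g z - L z = g z' - L z' := by
    intro z hz z' hz'
    refine hKm.induction₂ (fun z z' => g z - L z = g z' - L z') ?_ (fun _ _ _ _ _ _ h1 h2 => h1.trans h2)
      (fun _ _ _ _ h => h.symm) hz hz'
    intro y hy
    have h1 := (hFc y hy).preimage_mem_nhdsWithin (Metric.ball_mem_nhds _ one_pos)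
    filter_upwards [h1, self_mem_nhdsWithin] with y' hy' hyK
    obtain ⟨n, hn⟩ := hint y hy
    obtain ⟨n', hn'⟩ := hint y' hyK
    rw [mem_preimage, Metric.mem_ball, dist_eq_norm, hn, hn', ← sub_mul, norm_mul] at hy'
    have h2 : ‖(2 * Real.pi * Complex.I : ℂ)‖ = 2 * Real.pi := by
      simp [abs_of_pos Real.pi_pos]
    rw [h2, ← Int.cast_sub, Complex.norm_intCast] at hy'
    -- Distinct values of `g - L` are at least `2π` apart, while the two values here differ by less
    -- than `1`.
    have h3 : n' - n = 0 := by
      by_contra hcon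
      have h4 : (1 : ℝ) ≤ |((n' - n : ℤ) : ℝ)| := by exact_mod_cast Int.one_le_abs hcon
      nlinarith [Real.pi_gt_three]
    rw [hn, hn', sub_eq_zero.1 h3]
  have hζ : ∀ τ : ℝ, (m + τ * d - a) / (m + τ * d - b)
      = (τ - ε * Complex.I) / (τ + ε * Complex.I) := by
    intro τ
    have e1 : m + τ * d - a = (τ - ε * Complex.I) * d := by rw [ha]; ring
    have e2 : m + τ * d - b = (τ + ε * Complex.I) * d := by rw [hb]; ring
    rw [e1, e2, mul_div_mul_right _ _ hd0]
  have hden : ∀ τ : ℝ, (τ : ℂ) + ε * Complex.I ≠ 0 := by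
    intro τ h
    have := congrArg Complex.im h
    simp at this
    linarith
  have hζc : Continuous fun τ : ℝ => ((τ : ℂ) - ε * Complex.I) / (τ + ε * Complex.I) :=
    Continuous.div (by fun_prop) (by fun_prop) hden
  have hζ0 : (((0 : ℝ) : ℂ) - ε * Complex.I) / (((0 : ℝ) : ℂ) + ε * Complex.I) = -1 := by
    rw [div_eq_iff (hden 0)]
    push_cast
    ring
  have him : ∀ τ : ℝ, (((τ : ℂ) - ε * Complex.I) / (τ + ε * Complex.I)).im
      = -(2 * τ * ε / (τ ^ 2 + ε ^ 2)) := by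
    intro τ
    rw [Complex.div_im]
    simp [Complex.normSq_apply]
    field_simp
    ring
  have hζt : Filter.Tendsto (fun τ : ℝ => ((τ : ℂ) - ε * Complex.I) / (τ + ε * Complex.I))
      (𝓝 0) (𝓝 (-1)) := by
    have := hζc.tendsto 0
    rwa [hζ0] at this
  have hgt : ∀ S : Set ℝ, S ⊆ Icc (-(1 / 2)) (1 / 2) → Filter.Tendsto (fun τ : ℝ => g (m + τ * d))
      (𝓝[S] 0) (𝓝 (g m)) := by
    intro S hS
    have hmK : m ∈ K := Or.inl ((hsegwu m).2 ⟨0, by norm_num, by simp⟩)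
    refine (hg m hmK).tendsto.comp (tendsto_nhdsWithin_iff.2 ⟨?_, ?_⟩)
    · have : Continuous fun τ : ℝ => m + τ * d := by fun_prop
      have h0 := this.tendsto 0
      simp only [Complex.ofReal_zero, zero_mul, add_zero] at h0
      exact h0.mono_left nhdsWithin_le_nhds
    · filter_upwards [self_mem_nhdsWithin] with τ hτ
      exact Or.inl ((hsegwu _).2 ⟨τ, hS hτ, rfl⟩)
  have hmemK : ∀ τ : ℝ, τ ∈ Icc (-(1 / 2) : ℝ) (1 / 2) → τ ≠ 0 → m + τ * d ∈ K \ {m} := by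
    intro τ hτ hτ0
    refine ⟨Or.inl ((hsegwu _).2 ⟨τ, hτ, rfl⟩), fun h => ?_⟩
    have : (τ : ℂ) * d = 0 := by
      rw [mem_singleton_iff] at h
      linear_combination h
    rcases mul_eq_zero.1 this with h | h
    · exact hτ0 (by exact_mod_cast h)
    · exact hd0 h
  -- At `m` the quotient is `-1`. It comes from below the real axis for `τ > 0` and from above for
  -- `τ < 0`, so `L` tends to `-πi` and to `πi`, respectively.
  have hLpos : Filter.Tendsto (fun τ : ℝ => L (m + τ * d)) (𝓝[Ioc 0 (1 / 2)] 0)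
      (𝓝 (-(Real.pi * Complex.I))) := by
    have h1 := Complex.tendsto_log_nhdsWithin_im_neg_of_re_neg_of_im_zero
      (z := -1) (by simp) (by simp)
    simp only [norm_neg, norm_one, Real.log_one, Complex.ofReal_zero, zero_sub] at h1
    simp only [hL, hζ]
    refine h1.comp (tendsto_nhdsWithin_iff.2 ⟨hζt.mono_left nhdsWithin_le_nhds, ?_⟩)
    filter_upwards [self_mem_nhdsWithin] with τ hτ
    rw [him]
    have := hτ.1
    have : 0 < 2 * τ * ε / (τ ^ 2 + ε ^ 2) := by positivity
    linarith
  have hLneg : Filter.Tendsto (fun τ : ℝ => L (m + τ * d)) (𝓝[Ico (-(1 / 2)) 0] 0)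
      (𝓝 (Real.pi * Complex.I)) := by
    have h1 := Complex.tendsto_log_nhdsWithin_im_nonneg_of_re_neg_of_im_zero
      (z := -1) (by simp) (by simp)
    simp only [norm_neg, norm_one, Real.log_one, Complex.ofReal_zero, zero_add] at h1
    simp only [hL, hζ]
    refine h1.comp (tendsto_nhdsWithin_iff.2 ⟨hζt.mono_left nhdsWithin_le_nhds, ?_⟩)
    filter_upwards [self_mem_nhdsWithin] with τ hτ
    rw [him]
    have : 0 ≤ -(2 * τ * ε) / (τ ^ 2 + ε ^ 2) := by
      apply div_nonneg _ (by positivity)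
      nlinarith [hτ.2]
    rw [neg_div] at this
    exact this
  set F := g (m + ((1 / 2 : ℝ) : ℂ) * d) - L (m + ((1 / 2 : ℝ) : ℂ) * d) with hF
  have hFall : ∀ τ : ℝ, τ ∈ Icc (-(1 / 2) : ℝ) (1 / 2) → τ ≠ 0 →
      g (m + τ * d) - L (m + τ * d) = F := fun τ hτ hτ0 =>
    hconst _ (hmemK τ hτ hτ0) _ (hmemK _ (by norm_num) (by norm_num))
  have hpos : g m - (-(Real.pi * Complex.I)) = F := by
    have : (𝓝[Ioc (0 : ℝ) (1 / 2)] 0).NeBot := by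
      rw [nhdsWithin_Ioc_eq_nhdsGT (by norm_num)]
      infer_instance
    refine tendsto_nhds_unique (((hgt _ fun τ hτ => ⟨by linarith [hτ.1], hτ.2⟩).sub hLpos).congr' ?_)
      tendsto_const_nhds
    filter_upwards [self_mem_nhdsWithin] with τ hτ
    exact hFall τ ⟨by linarith [hτ.1], hτ.2⟩ hτ.1.ne'
  have hneg : g m - Real.pi * Complex.I = F := by
    have : (𝓝[Ico (-(1 / 2) : ℝ) 0] 0).NeBot := by
      rw [nhdsWithin_Ico_eq_nhdsLT (by norm_num)]
      infer_instance
    refine tendsto_nhds_unique (((hgt _ fun τ hτ => ⟨hτ.1, by linarith [hτ.2]⟩).sub hLneg).congr' ?_)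
      tendsto_const_nhds
    filter_upwards [self_mem_nhdsWithin] with τ hτ
    exact hFall τ ⟨hτ.1, by linarith [hτ.2]⟩ hτ.2.ne
  have hcontra : (Real.pi : ℂ) * Complex.I = 0 := by
    linear_combination (hpos - hneg) / 2
  simp [Real.pi_ne_zero] at hcontra

/-- The class of `c` in `C \ J` and the rest of `C \ J` are both open and nonempty. As `C` is
connected and `J` has no interior, they have a common limit point in `C`, which can only lie on `J`.
Separation is thereby brought arbitrarily close to the arc. -/
theorem exists_not_logEquiv_near {C J V : Set ℂ} (hC : IsPreconnected C) (hCo : IsOpen C)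
    (hJ : IsClosed J) (hJi : interior J = ∅) (hV : IsClosed V) (hCV : Disjoint C V) {c c' : ℂ}
    (hc : c ∈ C \ J) (hc' : c' ∈ C \ J) (hne : ¬ LogEquiv (J ∪ V) c c') :
    ∃ p ∈ J ∩ C, ∀ N ∈ 𝓝 p, ∃ a ∈ N \ (J ∪ V), ∃ b ∈ N \ (J ∪ V), ¬ LogEquiv (J ∪ V) a b := by
  have hnot : ∀ a ∈ C \ J, a ∉ J ∪ V := fun a ha h =>
    h.elim ha.2 fun h => hCV.le_bot ⟨ha.1, h⟩
  set U : Set ℂ := {a ∈ C \ J | LogEquiv (J ∪ V) a c} with hU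
  set U' : Set ℂ := {a ∈ C \ J | ¬ LogEquiv (J ∪ V) a c} with hU'
  have hev : ∀ a ∈ C \ J, ∀ᶠ a' in 𝓝 a, a' ∈ C \ J ∧ LogEquiv (J ∪ V) a' a := fun a ha =>
    (show ∀ᶠ a' in 𝓝 a, a' ∈ C \ J from (hCo.sdiff hJ).mem_nhds ha).and (eventually_logEquiv (hJ.union hV) (hnot a ha))
  have hUo : IsOpen U := by
    rw [isOpen_iff_mem_nhds]
    rintro a ⟨ha, hac⟩
    filter_upwards [hev a ha] with a' ha'
    exact ⟨ha'.1, ha'.2.trans hac⟩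
  have hU'o : IsOpen U' := by
    rw [isOpen_iff_mem_nhds]
    rintro a ⟨ha, hac⟩
    filter_upwards [hev a ha] with a' ha'
    exact ⟨ha'.1, fun h => hac (ha'.2.symm.trans h)⟩
  have hd : Disjoint U U' := disjoint_left.2 fun a h h' => h'.2 h.2
  have hun : U ∪ U' = C \ J := by
    ext a
    constructor
    · rintro (h | h)
      exacts [h.1, h.1]
    · intro h
      by_cases h' : LogEquiv (J ∪ V) a c
      · exact Or.inl ⟨h, h'⟩
      · exact Or.inr ⟨h, h'⟩
  have hcU : c ∈ U := ⟨hc, LogEquiv.refl _ _⟩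
  have hcU' : c' ∈ U' := ⟨hc', fun h => hne h.symm⟩
  have hnd : ¬ Disjoint C (closure U ∩ closure U') := by
    intro hdis
    rcases subset_closure_or_of_isPreconnected hC
      (by rw [hun]; exact IsOpen.subset_closure_diff hCo hJi) hdis with h | h
    · exact (hd.closure_left hU'o).le_bot ⟨h hc'.1, hcU'⟩
    · exact (hd.closure_right hUo).le_bot ⟨hcU, h hc.1⟩
  rw [not_disjoint_iff] at hnd
  obtain ⟨p, hpC, hp⟩ := hnd
  refine ⟨p, ⟨?_, hpC⟩, fun N hN => ?_⟩
  · by_contra hpJ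
    exact (disjoint_inter_closure hUo hU'o hd).le_bot ⟨by rw [hun]; exact ⟨hpC, hpJ⟩, hp⟩
  · obtain ⟨a, haN, haU⟩ := mem_closure_iff_nhds.1 hp.1 N hN
    obtain ⟨b, hbN, hbU⟩ := mem_closure_iff_nhds.1 hp.2 N hN
    exact ⟨a, ⟨haN, hnot a haU.1⟩, b, ⟨hbN, hnot b hbU.1⟩, fun h => hbU.2 (h.symm.trans haU.2)⟩

/-- If `P` lies on one side and `Q` on the other side of a segment `[a, b]` at all points of `J` on
this segment, if `J` is covered by `P`, `Q` and the segment, and if the part of `J` which meets `V`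
lies in `Q`, then `J ∪ V` does not separate `a` and `b`. -/
theorem logEquiv_of_sides {J V P Q : Set ℂ} {a b : ℂ} (hJ : IsClosed J) (hV : IsClosed V)
    (hP : IsOpen P) (hQ : IsOpen Q) (hPQ : Disjoint P Q) (haK : a ∉ J ∪ V) (hbK : b ∉ J ∪ V)
    (hVI : Disjoint V (segment ℝ a b)) (hPI : Disjoint P (segment ℝ a b))
    (hcov : J ⊆ P ∪ Q ∪ segment ℝ a b) (hJV : J ∩ V ⊆ Q)
    (hleft : ∀ i ∈ J ∩ segment ℝ a b, ∀ᶠ z in 𝓝 i, 0 < ((z - a) / (b - a)).im → z ∈ P)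
    (hright : ∀ i ∈ J ∩ segment ℝ a b, ∀ᶠ z in 𝓝 i, ((z - a) / (b - a)).im < 0 → z ∈ Q) :
    LogEquiv (J ∪ V) a b := by
  classical
  have hna : ∀ z ∈ J ∪ V, z - a ≠ 0 := fun z hz h => haK (sub_eq_zero.1 h ▸ hz)
  have hnb : ∀ z ∈ J ∪ V, z - b ≠ 0 := fun z hz h => hbK (sub_eq_zero.1 h ▸ hz)
  set ζ : ℂ → ℂ := fun z => (z - a) / (z - b) with hζ
  -- The principal logarithm of `ζ` jumps by `2πi` across `[a, b]`. Where `J` meets the segment, its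
  -- points on the left belong to `P` and those on the right to `Q`, so the correction on `J ∩ P`
  -- cancels the jump. Off the segment the correction is locally constant on `J ∪ V`, as `J` and `V`
  -- meet only in `Q`.
  set g : ℂ → ℂ := fun z => Complex.log (ζ z) + (if z ∈ J ∩ P then 2 * Real.pi * Complex.I else 0)
    with hg
  have hζc : ∀ z ∈ J ∪ V, ContinuousAt ζ z := fun z hz =>
    (continuousAt_id.sub continuousAt_const).div (continuousAt_id.sub continuousAt_const) (hnb z hz)
  have hlogc : ∀ z ∈ J ∪ V, z ∉ segment ℝ a b → ContinuousAt (fun z => Complex.log (ζ z)) z :=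
    fun z hz hs => (hζc z hz).clog (div_mem_slitPlane_of_notMem_segment hs)
  refine ⟨g, ?_, ?_⟩
  swap
  · intro z hz
    have h1 : Complex.exp (if z ∈ J ∩ P then 2 * Real.pi * Complex.I else 0) = 1 := by
      split_ifs
      · exact Complex.exp_two_pi_mul_I
      · exact Complex.exp_zero
    rw [hg]
    simp only
    rw [Complex.exp_add, h1, mul_one, Complex.exp_log (div_ne_zero (hna z hz) (hnb z hz))]
    rw [div_mul_cancel₀ _ (hnb z hz)]
  have hzero : ∀ z ∈ J ∪ V, z ∉ segment ℝ a b → (∀ᶠ y in 𝓝 z, y ∉ J ∩ P) →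
      ContinuousWithinAt g (J ∪ V) z := by
    intro z hz hs hev
    refine ((hlogc z hz hs).congr ?_).continuousWithinAt
    filter_upwards [hev] with y hy
    simp only [hg, if_neg hy, add_zero]
  have hQev : ∀ z ∈ Q, ∀ᶠ y in 𝓝 z, y ∉ J ∩ P := by
    intro z hz
    filter_upwards [hQ.mem_nhds hz] with y hy h
    exact hPQ.le_bot ⟨h.2, hy⟩
  intro z hz
  by_cases hzJ : z ∈ J
  swap
  · have hzV : z ∈ V := hz.resolve_left hzJ
    refine hzero z hz (fun h => hVI.le_bot ⟨hzV, h⟩) ?_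
    filter_upwards [hJ.isOpen_compl.mem_nhds hzJ] with y hy h
    exact hy h.1
  by_cases hzV : z ∈ V
  · exact hzero z hz (fun h => hVI.le_bot ⟨hzV, h⟩) (hQev z (hJV ⟨hzJ, hzV⟩))
  by_cases hs : z ∈ segment ℝ a b
  swap
  · rcases hcov hzJ with (hzP | hzQ) | hzI
    · have hc : ContinuousWithinAt (fun z => Complex.log (ζ z) + 2 * Real.pi * Complex.I)
          (J ∪ V) z := ((hlogc z hz hs).add continuousAt_const).continuousWithinAt
      refine hc.congr_of_eventuallyEq ?_ ?_
      · filter_upwards [self_mem_nhdsWithin, mem_nhdsWithin_of_mem_nhds (hP.mem_nhds hzP),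
          mem_nhdsWithin_of_mem_nhds (hV.isOpen_compl.mem_nhds hzV)] with y hy hyP hyV
        simp only [hg]
        rw [if_pos ⟨hy.resolve_right hyV, hyP⟩]
      · simp only [hg]
        rw [if_pos ⟨hzJ, hzP⟩]
    · exact hzero z hz hs (hQev z hzQ)
    · exact absurd hzI hs
  have hab : b - a ≠ 0 := by
    intro h
    rw [sub_eq_zero.1 h, segment_same] at hs
    exact haK (mem_singleton_iff.1 hs ▸ hz)
  -- The affine coordinate with `a` at `0` and `b` at `1`. Then `ζ = x / (x - 1)`, so the imaginary
  -- parts of `ζ` and `x` have opposite signs.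
  set x : ℂ → ℂ := fun y => (y - a) / (b - a) with hx
  have hxa : ∀ y, y - a = x y * (b - a) := fun y => by rw [hx]; simp only; rw [div_mul_cancel₀ _ hab]
  have hζx : ∀ y, ζ y = x y / (x y - 1) := by
    intro y
    have : y - b = (x y - 1) * (b - a) := by linear_combination hxa y
    simp only [hζ]
    rw [this, hxa y, mul_div_mul_right _ _ hab]
  have hxc : Continuous x := by
    simp only [hx]
    exact (continuous_id.sub continuous_const).div_const _
  obtain ⟨σ, hσ, hσz⟩ : ∃ σ : ℝ, σ ∈ Ioo (0 : ℝ) 1 ∧ x z = σ := by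
    rw [segment_eq_image'] at hs
    obtain ⟨σ, hσ, hz'⟩ := hs
    have hxz : x z = σ := by
      simp only [hx]
      rw [div_eq_iff hab, ← hz']
      simp only [Complex.real_smul]
      ring
    refine ⟨σ, ⟨lt_of_le_of_ne hσ.1 ?_, lt_of_le_of_ne hσ.2 ?_⟩, hxz⟩
    · rintro rfl
      refine hna z hz ?_
      rw [hxa, hxz]
      simp
    · rintro rfl
      refine hnb z hz ?_
      have : z - b = (x z - 1) * (b - a) := by linear_combination hxa z
      rw [this, hxz]
      simp
  have hζz : ζ z = ((σ / (σ - 1) : ℝ) : ℂ) := by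
    rw [hζx, hσz]
    push_cast
    rfl
  have hre : (ζ z).re < 0 := by
    rw [hζz, Complex.ofReal_re]
    exact div_neg_of_pos_of_neg hσ.1 (by linarith [hσ.2])
  have him : (ζ z).im = 0 := by rw [hζz, Complex.ofReal_im]
  have hsign : ∀ y, (ζ y).im = -((x y).im / Complex.normSq (x y - 1)) := by
    intro y
    rw [hζx, Complex.div_im]
    simp only [Complex.sub_re, Complex.sub_im, Complex.one_re, Complex.one_im]
    ring
  have hzP : z ∉ P := fun h => hPI.le_bot ⟨h, hs⟩
  have hgz : g z = Complex.log (ζ z) := by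
    simp only [hg]
    rw [if_neg fun h => hzP h.2, add_zero]
  have hre01 : ∀ᶠ y in 𝓝 z, (x y).re ∈ Ioo (0 : ℝ) 1 := by
    have : Continuous fun y => (x y).re := Complex.continuous_re.comp hxc
    apply this.continuousAt.preimage_mem_nhds
    rw [hσz, Complex.ofReal_re]
    exact Ioo_mem_nhds hσ.1 hσ.2
  -- The first part is the right side together with the line, where `arg` is continuous with value
  -- `π` at `z` and the correction vanishes near `z`; the second is the left side, where `arg` tends
  -- to `-π` and the correction is present.
  have hKAB : J ∪ V = (J ∪ V) ∩ {y | 0 ≤ (ζ y).im} ∪ (J ∪ V) ∩ {y | (ζ y).im < 0} := by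
    rw [← inter_union_distrib_left]
    refine (inter_eq_left.2 fun y _ => ?_).symm
    exact le_or_gt 0 (ζ y).im
  rw [hKAB]
  refine ContinuousWithinAt.union ?_ ?_
  · have hc : ContinuousWithinAt (fun y => Complex.log (ζ y)) ((J ∪ V) ∩ {y | 0 ≤ (ζ y).im}) z :=
      (Complex.continuousWithinAt_log_of_re_neg_of_im_zero hre him).comp
        (hζc z hz).continuousWithinAt fun y hy => hy.2
    refine hc.congr_of_eventuallyEq ?_ hgz
    filter_upwards [self_mem_nhdsWithin, mem_nhdsWithin_of_mem_nhds hre01,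
      mem_nhdsWithin_of_mem_nhds (hright z ⟨hzJ, hs⟩)] with y hy hy01 hyr
    have hyP : y ∉ P := by
      intro hyP
      have h1 : (x y).im ≤ 0 := by
        by_contra hcon
        have h2 : (0 : ℝ) ≤ (ζ y).im := hy.2
        rw [hsign] at h2
        have h3 : 0 < Complex.normSq (x y - 1) := by
          rw [Complex.normSq_pos]
          intro h
          have := congrArg Complex.im h
          simp only [Complex.sub_im, Complex.one_im, sub_zero, Complex.zero_im] at this
          exact hcon this.le
        have := div_pos (not_le.1 hcon) h3
        linarith
      rcases h1.lt_or_eq with h1 | h1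
      · exact hPQ.le_bot ⟨hyP, hyr h1⟩
      · refine hPI.le_bot ⟨hyP, ?_⟩
        rw [segment_eq_image']
        refine ⟨(x y).re, ⟨hy01.1.le, hy01.2.le⟩, ?_⟩
        have h2 : x y = (((x y).re : ℝ) : ℂ) := Complex.ext (by simp) (by simp [h1])
        have h3 := hxa y
        rw [h2] at h3
        simp only [Complex.real_smul]
        linear_combination -h3
    simp only [hg]
    rw [if_neg fun h => hyP h.2, add_zero]
  · have h1 : Filter.Tendsto (fun y => Complex.log (ζ y) + 2 * Real.pi * Complex.I)
        (𝓝[(J ∪ V) ∩ {y | (ζ y).im < 0}] z) (𝓝 (g z)) := by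
      have h2 := (Complex.tendsto_log_nhdsWithin_im_neg_of_re_neg_of_im_zero hre him).comp
        (tendsto_nhdsWithin_iff.2 ⟨(hζc z hz).continuousWithinAt
          (s := (J ∪ V) ∩ {y | (ζ y).im < 0}), by
            filter_upwards [self_mem_nhdsWithin] with y hy using hy.2⟩)
      convert! h2.add_const (2 * Real.pi * Complex.I : ℂ) using 2
      rw [hgz, Complex.log, Complex.arg_eq_pi_iff.2 ⟨hre, him⟩]
      ring
    refine Filter.Tendsto.congr' ?_ h1
    filter_upwards [self_mem_nhdsWithin, mem_nhdsWithin_of_mem_nhds (hleft z ⟨hzJ, hs⟩),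
      mem_nhdsWithin_of_mem_nhds (hV.isOpen_compl.mem_nhds hzV)] with y hy hyl hyV
    have h2 : 0 < (x y).im := by
      by_contra hcon
      have h3 : (ζ y).im < 0 := hy.2
      rw [hsign] at h3
      have := div_nonpos_of_nonpos_of_nonneg (not_lt.1 hcon) (Complex.normSq_nonneg (x y - 1))
      linarith
    simp only [hg]
    rw [if_pos ⟨hy.1.resolve_right hyV, hyl h2⟩]

/-! ### Closing up a piece of an arc by two segments -/

theorem interior_image_Icc_eq_empty [ChartedSpace ℂ X] [T2Space X] {f : ℝ → X} {s₁ s₂ : ℝ}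
    (hs : s₁ < s₂) (hf : ContinuousOn f (Icc s₁ s₂)) (hinj : InjOn f (Icc s₁ s₂)) :
    interior (f '' Icc s₁ s₂) = ∅ := by
  have hm : ∀ t : unitInterval, s₁ + t * (s₂ - s₁) ∈ Icc s₁ s₂ := fun t =>
    ⟨by nlinarith [t.2.1], by nlinarith [t.2.2]⟩
  let p : Path (f s₁) (f s₂) :=
    { toFun := fun t => f (s₁ + t * (s₂ - s₁))
      continuous_toFun := hf.comp_continuous (by fun_prop) hm
      source' := by simp
      target' := by simp }
  have hp : Function.Injective p := by
    intro t t' h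
    have h1 := hinj (hm t) (hm t') h
    have h2 : (t : ℝ) = t' := mul_right_cancel₀ (sub_pos.2 hs).ne' (add_left_cancel h1)
    exact Subtype.ext h2
  have hr : range p = f '' Icc s₁ s₂ := by
    ext x
    constructor
    · rintro ⟨t, rfl⟩
      exact ⟨_, hm t, rfl⟩
    · rintro ⟨s, hsI, rfl⟩
      refine ⟨⟨(s - s₁) / (s₂ - s₁), div_nonneg (by linarith [hsI.1]) (by linarith),
        (div_le_one (by linarith)).2 (by linarith [hsI.2])⟩, ?_⟩
      change f (s₁ + (s - s₁) / (s₂ - s₁) * (s₂ - s₁)) = f s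
      rw [div_mul_cancel₀ _ (sub_pos.2 hs).ne', add_sub_cancel]
  rw [← hr]
  exact interior_range_path_eq_empty hp

/-- The complement of two segments with a common endpoint in a convex open set is connected. -/
theorem isPreconnected_diff_two_segments {D : Set ℂ} (hD : Convex ℝ D) (hDo : IsOpen D) {w u v : ℂ}
    (hw : w ∈ D) (hu : u ∈ D) (hv : v ∈ D) (hwu : w ≠ u) (hwv : w ≠ v)
    (hint : ∀ z ∈ segment ℝ w u, z ∈ segment ℝ w v → z = w) :
    IsPreconnected (D \ (segment ℝ w u ∪ segment ℝ w v)) := by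
  set e := OpenPartialHomeomorph.refl ℂ
  have huniv : ∀ z z' : ℂ, segment ℝ z z' ⊆ e.target := fun z z' => subset_univ _
  set p : Path u w := chartSegment e u w (huniv u w)
  set q : Path w v := chartSegment e w v (huniv w v)
  have hrp : range p = segment ℝ w u := by
    refine (range_chartSegment e (huniv u w)).trans ?_
    rw [segment_symm]
    exact image_id _
  have hrq : range q = segment ℝ w v := by
    refine (range_chartSegment e (huniv w v)).trans ?_
    exact image_id _
  have hpi : Function.Injective p := injective_chartSegment e (huniv u w) hwu.symm
  have hqi : Function.Injective q := injective_chartSegment e (huniv w v) hwv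
  have hpq : ∀ s, s ≠ 1 → p s ∉ range q := by
    intro s hs h
    rw [hrq] at h
    have h1 : p s ∈ segment ℝ w u := hrp ▸ mem_range_self s
    exact hs (hpi ((hint _ h1 h).trans p.target.symm))
  have hqp : ∀ s, s ≠ 1 → q.symm s ∉ range p.symm := by
    intro s hs h
    rw [Path.symm_range, hrp] at h
    have h1 : q.symm s ∈ segment ℝ w v := by rw [← hrq, ← Path.symm_range]; exact mem_range_self s
    have h2 : q.symm s = q 0 := (hint _ h h1).trans q.source.symm
    rw [Path.symm_apply, Function.comp_apply] at h2
    have h3 := hqi h2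
    exact hs (by rw [← unitInterval.symm_symm s, h3, unitInterval.symm_zero])
  have hps : Walkable p.symm := by
    have : p.symm = chartSegment e w u (huniv w u) := chartSegment_symm e (huniv u w)
    rw [this]
    exact walkable_chartSegment e _ hwu
  have hqs : Walkable q.symm := by
    have : q.symm = chartSegment e v w (huniv v w) := chartSegment_symm e (huniv w v)
    rw [this]
    exact walkable_chartSegment e _ hwv.symm
  have hW : Walkable (p.trans q) :=
    (walkable_chartSegment e _ hwu.symm).trans (walkable_chartSegment e _ hwv) hpq
  have hWs : Walkable (p.trans q).symm := by
    rw [Path.trans_symm]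
    exact hqs.trans hps hqp
  have hr : range (p.trans q) = segment ℝ w u ∪ segment ℝ w v := by
    rw [Path.trans_range, hrp, hrq]
  have := isPreconnected_diff_range hD.isPreconnected hDo hW hWs
    (by rw [hr]; exact union_subset (hD.segment_subset hw hu) (hD.segment_subset hw hv))
    (interior_range_path_eq_empty (injective_trans hpi hqi hpq))
  rwa [hr] at this

/-- The last piece of a segment which does not meet a compact set before its endpoint. -/
theorem exists_first_hit {K : Set ℂ} (hK : IsClosed K) {w p : ℂ} (hw : w ∉ K) (hp : p ∈ K) :
    ∃ τ ∈ Ioc (0 : ℝ) 1, w + (τ : ℂ) * (p - w) ∈ K ∧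
      ∀ σ ∈ Ico (0 : ℝ) τ, w + (σ : ℂ) * (p - w) ∉ K := by
  have hc : Continuous fun τ : ℝ => w + (τ : ℂ) * (p - w) := by fun_prop
  obtain ⟨τ, ⟨hτI, hτK⟩, hmin⟩ := (isCompact_Icc.inter_right (hK.preimage hc)).exists_isLeast
    (s := Icc (0 : ℝ) 1 ∩ (fun τ : ℝ => w + (τ : ℂ) * (p - w)) ⁻¹' K)
    ⟨1, by norm_num, by simpa using hp⟩
  refine ⟨τ, ⟨lt_of_le_of_ne hτI.1 ?_, hτI.2⟩, hτK, fun σ hσ h => ?_⟩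
  · rintro rfl
    exact hw (by simpa using hτK)
  · exact absurd (hmin ⟨⟨hσ.1, hσ.2.le.trans hτI.2⟩, h⟩) (not_le.2 hσ.2)

theorem mem_segment_smul_iff {w d z : ℂ} {τ : ℝ} (hτ : 0 < τ) :
    z ∈ segment ℝ w (w + (τ : ℂ) * d) ↔ ∃ σ ∈ Icc 0 τ, z = w + (σ : ℂ) * d := by
  rw [segment_eq_image']
  constructor
  · rintro ⟨t, ht, rfl⟩
    refine ⟨t * τ, ⟨mul_nonneg ht.1 hτ.le, by nlinarith [ht.2]⟩, ?_⟩
    simp only [Complex.real_smul]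
    push_cast
    ring
  · rintro ⟨σ, hσ, rfl⟩
    refine ⟨σ / τ, ⟨div_nonneg hσ.1 hτ.le, (div_le_one hτ).2 hσ.2⟩, ?_⟩
    have : (τ : ℂ) ≠ 0 := by exact_mod_cast hτ.ne'
    simp only [Complex.real_smul]
    push_cast
    field_simp
    ring

/-- Some piece of an arc in a convex region can be closed up by two segments in such a way that the
resulting closed curve separates points which are arbitrarily close to an interior point of the
piece. -/
theorem exists_crossing {D : Set ℂ} (hD : Convex ℝ D) (hDo : IsOpen D) {f : ℝ → ℂ} {s₁ s₂ : ℝ}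
    (hs : s₁ < s₂) (hf : ContinuousOn f (Icc s₁ s₂)) (hinj : InjOn f (Icc s₁ s₂))
    (hfD : MapsTo f (Icc s₁ s₂) D) :
    ∃ t₁ t₂ t : ℝ, s₁ ≤ t₁ ∧ t₂ ≤ s₂ ∧ t ∈ Ioo t₁ t₂ ∧ ∃ V : Set ℂ, IsClosed V ∧
      (∀ s ∈ Icc t₁ t₂, f s ∈ V → s = t₁ ∨ s = t₂) ∧ f t ∉ V ∧
      ∀ N ∈ 𝓝 (f t), ∃ a ∈ N \ (f '' Icc t₁ t₂ ∪ V), ∃ b ∈ N \ (f '' Icc t₁ t₂ ∪ V),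
        ¬ LogEquiv (f '' Icc t₁ t₂ ∪ V) a b := by
  set J' := f '' Icc s₁ s₂ with hJ'
  have hJ'c : IsClosed J' := (isCompact_Icc.image_of_continuousOn hf).isClosed
  have hJ'i : interior J' = ∅ := interior_image_Icc_eq_empty hs hf hinj
  set p₁ := f s₁
  set p₂ := f s₂
  have hs₁ : s₁ ∈ Icc s₁ s₂ := left_mem_Icc.2 hs.le
  have hs₂ : s₂ ∈ Icc s₁ s₂ := right_mem_Icc.2 hs.le
  have hp₁ : p₁ ∈ J' := mem_image_of_mem f hs₁
  have hp₂ : p₂ ∈ J' := mem_image_of_mem f hs₂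
  have hd : p₂ - p₁ ≠ 0 := fun h => hs.ne' (hinj hs₂ hs₁ (sub_eq_zero.1 h))
  -- A point off the line through `p₁` and `p₂` and off the arc: otherwise the arc would contain a
  -- nonempty open set.
  obtain ⟨w, hwD, hwim, hwJ⟩ : ∃ w ∈ D, ((w - p₁) / (p₂ - p₁)).im ≠ 0 ∧ w ∉ J' := by
    by_contra hcon
    push Not at hcon
    have hxc : Continuous fun w : ℂ => ((w - p₁) / (p₂ - p₁)).im :=
      Complex.continuous_im.comp ((continuous_id.sub continuous_const).div_const _)
    have hopen : IsOpen (D ∩ {w | ((w - p₁) / (p₂ - p₁)).im ≠ 0}) :=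
      hDo.inter (isOpen_ne_fun hxc continuous_const)
    have hsub : D ∩ {w | ((w - p₁) / (p₂ - p₁)).im ≠ 0} ⊆ interior J' :=
      interior_maximal (fun w hw => hcon w hw.1 hw.2) hopen
    rw [hJ'i] at hsub
    have hη : ∀ᶠ η : ℝ in 𝓝[>] 0, p₁ + (η : ℂ) * Complex.I * (p₂ - p₁) ∈ D := by
      have hc : Continuous fun η : ℝ => p₁ + (η : ℂ) * Complex.I * (p₂ - p₁) := by fun_prop
      apply mem_nhdsWithin_of_mem_nhds
      apply hc.continuousAt.preimage_mem_nhds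
      apply hDo.mem_nhds
      simpa using hfD hs₁
    obtain ⟨η, hηD, hη0⟩ := (hη.and self_mem_nhdsWithin).exists
    refine hsub (a := p₁ + (η : ℂ) * Complex.I * (p₂ - p₁)) ⟨hηD, ?_⟩
    change ((p₁ + (η : ℂ) * Complex.I * (p₂ - p₁) - p₁) / (p₂ - p₁)).im ≠ 0
    rw [add_sub_cancel_left, mul_div_assoc, div_self hd]
    simpa using (ne_of_gt hη0 : η ≠ 0)
  have hindep : ∀ σ σ' : ℝ, w + (σ : ℂ) * (p₁ - w) = w + (σ' : ℂ) * (p₂ - w) → σ = 0 ∧ σ' = 0 := by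
    intro σ σ' h
    set x := (w - p₁) / (p₂ - p₁) with hx
    have hxw : w - p₁ = x * (p₂ - p₁) := by rw [hx, div_mul_cancel₀ _ hd]
    have h1 : -(σ : ℂ) * x = σ' * (1 - x) := by
      apply mul_right_cancel₀ hd
      linear_combination h + ((σ : ℂ) - σ') * hxw
    have him := congrArg Complex.im h1
    have hre := congrArg Complex.re h1
    simp at him hre
    have h2 : σ = σ' := by
      rcases him with h | h
      · exact h
      · exact absurd h hwim
    subst h2
    constructor <;> linarith
  -- The segments from `w` towards `p₁` and `p₂` are stopped where they first meet the arc. Together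
  -- with the piece of the arc between the stopping points `u` and `v` they form a simple closed
  -- curve.
  obtain ⟨τ₁, hτ₁, hu, humin⟩ := exists_first_hit hJ'c hwJ hp₁
  obtain ⟨τ₂, hτ₂, hv, hvmin⟩ := exists_first_hit hJ'c hwJ hp₂
  set u := w + (τ₁ : ℂ) * (p₁ - w) with hudef
  set v := w + (τ₂ : ℂ) * (p₂ - w) with hvdef
  have hwu : w ≠ u := fun h => hwJ (h ▸ hu)
  have hwv : w ≠ v := fun h => hwJ (h ▸ hv)
  have huv : u ≠ v := fun h => hτ₁.1.ne' (hindep _ _ h).1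
  have hsegint : ∀ z ∈ segment ℝ w u, z ∈ segment ℝ w v → z = w := by
    intro z hz hz'
    obtain ⟨σ, -, rfl⟩ := (mem_segment_smul_iff hτ₁.1).1 hz
    obtain ⟨σ', -, h⟩ := (mem_segment_smul_iff hτ₂.1).1 hz'
    rw [(hindep _ _ h).1]
    simp
  have hsegu : ∀ z ∈ segment ℝ w u, z ∈ J' → z = u := by
    intro z hz hzJ
    obtain ⟨σ, hσ, rfl⟩ := (mem_segment_smul_iff hτ₁.1).1 hz
    rcases hσ.2.lt_or_eq with h | h
    · exact absurd hzJ (humin σ ⟨hσ.1, h⟩)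
    · rw [h]
  have hsegv : ∀ z ∈ segment ℝ w v, z ∈ J' → z = v := by
    intro z hz hzJ
    obtain ⟨σ, hσ, rfl⟩ := (mem_segment_smul_iff hτ₂.1).1 hz
    rcases hσ.2.lt_or_eq with h | h
    · exact absurd hzJ (hvmin σ ⟨hσ.1, h⟩)
    · rw [h]
  obtain ⟨su, hsu, hsuu⟩ := hu
  obtain ⟨sv, hsv, hsvv⟩ := hv
  have huD : u ∈ D := hsuu ▸ hfD hsu
  have hvD : v ∈ D := hsvv ▸ hfD hsv
  set V := segment ℝ w u ∪ segment ℝ w v with hV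
  have hsegc : ∀ z z' : ℂ, IsClosed (segment ℝ z z') := fun z z' => by
    rw [segment_eq_image']
    exact (isCompact_Icc.image (by fun_prop)).isClosed
  have hVc : IsClosed V := (hsegc _ _).union (hsegc _ _)
  set t₁ := min su sv with ht₁
  set t₂ := max su sv with ht₂
  have hsub : Icc t₁ t₂ ⊆ Icc s₁ s₂ :=
    Icc_subset_Icc (le_min hsu.1 hsv.1) (max_le hsu.2 hsv.2)
  have hsuI : su ∈ Icc t₁ t₂ := ⟨min_le_left _ _, le_max_left _ _⟩
  have hsvI : sv ∈ Icc t₁ t₂ := ⟨min_le_right _ _, le_max_right _ _⟩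
  have hVJ : ∀ s ∈ Icc t₁ t₂, f s ∈ V → s = t₁ ∨ s = t₂ := by
    have hend : ∀ s, s = su ∨ s = sv → s = t₁ ∨ s = t₂ := by
      rintro s (rfl | rfl)
      · rcases le_total s sv with h | h
        · exact Or.inl (min_eq_left h).symm
        · exact Or.inr (max_eq_left h).symm
      · rcases le_total su s with h | h
        · exact Or.inr (max_eq_right h).symm
        · exact Or.inl (min_eq_right h).symm
    intro s hsI hsV
    apply hend
    rcases hsV with h | h
    · exact Or.inl (hinj (hsub hsI) hsu ((hsegu _ h (mem_image_of_mem f (hsub hsI))).trans hsuu.symm))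
    · exact Or.inr (hinj (hsub hsI) hsv ((hsegv _ h (mem_image_of_mem f (hsub hsI))).trans hsvv.symm))
  set J := f '' Icc t₁ t₂ with hJ
  have hJJ' : J ⊆ J' := image_mono hsub
  have hJc : IsClosed J := (isCompact_Icc.image_of_continuousOn (hf.mono hsub)).isClosed
  have hJi : interior J = ∅ := by
    rw [← subset_empty_iff, ← hJ'i]
    exact interior_mono hJJ'
  have hwv' : IsPreconnected (segment ℝ w v) := (convex_segment w v).isPreconnected
  have hJpre : IsPreconnected J := isPreconnected_Icc.image _ (hf.mono hsub)
  have huJ : u ∈ J := ⟨su, hsuI, hsuu⟩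
  have hvJ : v ∈ J := ⟨sv, hsvI, hsvv⟩
  set R := segment ℝ w v ∪ J with hR
  have hRpre : IsPreconnected R :=
    IsPreconnected.union v (right_mem_segment _ _ _) hvJ hwv' hJpre
  have hRc : IsClosed R := (hsegc _ _).union hJc
  set m := (w + u) / 2 with hm
  have hmseg : m ∈ segment ℝ w u := by
    rw [hudef, mem_segment_smul_iff hτ₁.1]
    refine ⟨τ₁ / 2, ⟨by linarith [hτ₁.1], by linarith [hτ₁.1]⟩, ?_⟩
    rw [hm, hudef]
    push_cast
    ring
  have hmR : m ∉ R := by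
    rintro (h | h)
    · have h1 := hsegint m hmseg h
      rw [hm] at h1
      exact hwu (by linear_combination (-2 : ℂ) * h1)
    · have h1 := hsegu m hmseg (hJJ' h)
      rw [hm] at h1
      exact hwu (by linear_combination 2 * h1)
  have hmD : m ∈ D := hD.segment_subset hwD huD hmseg
  have hdu : u - w ≠ 0 := sub_ne_zero.2 hwu.symm
  obtain ⟨r, hr, hball⟩ := Metric.isOpen_iff.1 (hDo.inter hRc.isOpen_compl) m ⟨hmD, hmR⟩
  set ε := r / (2 * ‖u - w‖) with hε
  have hnorm : 0 < ‖u - w‖ := norm_pos_iff.2 hdu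
  have hε0 : 0 < ε := by positivity
  have hmem : ∀ s ∈ Icc (-ε) ε, m + s * Complex.I * (u - w) ∈ D ∩ Rᶜ := by
    intro s hsI
    apply hball
    rw [Metric.mem_ball, dist_eq_norm, add_sub_cancel_left, norm_mul, norm_mul, Complex.norm_I,
      mul_one, Complex.norm_real, Real.norm_eq_abs]
    have h1 : |s| ≤ ε := abs_le.2 hsI
    have h2 : ε * ‖u - w‖ = r / 2 := by rw [hε]; field_simp
    nlinarith
  -- A short perpendicular through the midpoint of `[w, u]` misses the rest `R` of the closed curve,
  -- so its end points are separated.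
  have hnot := not_logEquiv_of_single_crossing hwu hRpre (Or.inl (left_mem_segment _ _ _))
    (Or.inr huJ) hε0 fun s hsI => (hmem s hsI).2
  have hK : segment ℝ w u ∪ R = J ∪ V := by
    rw [hR, hV, ← union_assoc, union_comm]
  rw [hK] at hnot
  have hside : ∀ s ∈ Icc (-ε) ε, s ≠ 0 → m + s * Complex.I * (u - w) ∈ (D \ V) \ J := by
    intro s hsI hs0
    have h := hmem s hsI
    refine ⟨⟨h.1, ?_⟩, fun hJ => h.2 (Or.inr hJ)⟩
    rintro (h1 | h1)
    · rw [segment_eq_image'] at h1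
      obtain ⟨t, -, ht⟩ := h1
      simp only [Complex.real_smul, hm] at ht
      have h2 : ((t - 1 / 2 : ℝ) : ℂ) = s * Complex.I := by
        apply mul_right_cancel₀ hdu
        push_cast
        linear_combination ht
      have := congrArg Complex.im h2
      simp at this
      exact hs0 this.symm
    · exact h.2 (Or.inl h1)
  have hC := isPreconnected_diff_two_segments hD hDo hwD huD hvD hwu hwv hsegint
  have hc1 := hside ε ⟨by linarith, le_rfl⟩ hε0.ne'
  have hc2 := hside (-ε) ⟨le_rfl, by linarith⟩ (by linarith)
  have hc2' : m + ((-ε : ℝ) : ℂ) * Complex.I * (u - w) = m - ε * Complex.I * (u - w) := by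
    push_cast; ring
  rw [hc2'] at hc2
  -- Removing the two segments alone leaves `D` connected, so the separation must already be visible
  -- near some point of the arc off the segments.
  obtain ⟨p, ⟨⟨t, ht, rfl⟩, hpC⟩, hp⟩ := exists_not_logEquiv_near hC (hDo.sdiff hVc) hJc hJi hVc
    disjoint_sdiff_left hc1 hc2 hnot
  have huV : u ∈ V := Or.inl (right_mem_segment _ _ _)
  have hvV : v ∈ V := Or.inr (right_mem_segment _ _ _)
  have hends : f t₁ ∈ V ∧ f t₂ ∈ V := by
    rcases le_total su sv with h | h
    · rw [ht₁, ht₂, min_eq_left h, max_eq_right h, hsuu, hsvv]; exact ⟨huV, hvV⟩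
    · rw [ht₁, ht₂, min_eq_right h, max_eq_left h, hsuu, hsvv]; exact ⟨hvV, huV⟩
  refine ⟨t₁, t₂, t, le_min hsu.1 hsv.1, max_le hsu.2 hsv.2, ⟨lt_of_le_of_ne ht.1 ?_,
    lt_of_le_of_ne ht.2 ?_⟩, V, hVc, hVJ, hpC.2, hp⟩
  · rintro rfl
    exact hpC.2 hends.1
  · intro h
    rw [h] at hpC
    exact hpC.2 hends.2

/-! ### Flat arcs and the construction of the legs -/

/-- An injective path which is walkable in both directions. -/
structure FlatArc {a b : X} (p : Path a b) : Prop where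
  injective : Function.Injective p
  walkable : Walkable p
  walkable_symm : Walkable p.symm

theorem FlatArc.trans [T2Space X] {a b c : X} {p : Path a b} {q : Path b c} (hp : FlatArc p)
    (hq : FlatArc q) (hpq : ∀ s, s ≠ 1 → p s ∉ range q) : FlatArc (p.trans q) := by
  refine ⟨injective_trans hp.injective hq.injective hpq, hp.walkable.trans hq.walkable hpq, ?_⟩
  rw [Path.trans_symm]
  refine hq.walkable_symm.trans hp.walkable_symm fun s hs => ?_
  rintro ⟨t, ht⟩
  rw [Path.symm_apply, Path.symm_apply, Function.comp_apply, Function.comp_apply] at ht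
  have h1 : unitInterval.symm t = 1 := by
    by_contra h
    exact hpq _ h ⟨_, ht.symm⟩
  rw [h1, p.target] at ht
  have h2 := hq.injective (q.source.trans ht)
  exact hs (by rw [← unitInterval.symm_symm s, ← h2, unitInterval.symm_zero])

theorem FlatArc.map {Y : Type*} [TopologicalSpace Y] {a b : X} {p : Path a b} (hp : FlatArc p)
    (Ψ : X ≃ₜ Y) : FlatArc (p.map Ψ.continuous) :=
  ⟨Ψ.injective.comp hp.injective, hp.walkable.map Ψ, by
    rw [Path.map_symm]
    exact hp.walkable_symm.map Ψ⟩

theorem FlatArc.cast {a b a' b' : X} {p : Path a b} (hp : FlatArc p) (ha : a' = a) (hb : b' = b) :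
    FlatArc (p.cast ha hb) :=
  ⟨hp.injective, hp.walkable, hp.walkable_symm⟩

theorem flatArc_chartSegment (e : OpenPartialHomeomorph X ℂ) {z w : ℂ}
    (h : segment ℝ z w ⊆ e.target) (hzw : z ≠ w) : FlatArc (chartSegment e z w h) :=
  ⟨injective_chartSegment e h hzw, walkable_chartSegment e h hzw, by
    rw [chartSegment_symm]
    exact walkable_chartSegment e _ hzw.symm⟩

theorem isClosed_range_path [T2Space X] {a b : X} (p : Path a b) : IsClosed (range p) :=
  (isCompact_range p.continuous).isClosed

theorem isClosed_segment_complex (z w : ℂ) : IsClosed (segment ℝ z w) := by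
  rw [segment_eq_image']
  exact (isCompact_Icc.image (by fun_prop)).isClosed

theorem interior_singleton_eq_empty [ChartedSpace ℂ X] [T2Space X] (x : X) :
    interior ({x} : Set X) = ∅ := by
  obtain ⟨e, r, hr, hx, -, htar⟩ := exists_disc_chart x (Filter.univ_mem)
  have hc : e x ∈ Metric.ball (e x) r := Metric.mem_ball_self hr
  have hw : e x + ((r / 2 : ℝ) : ℂ) ∈ Metric.ball (e x) r := by
    rw [Metric.mem_ball, dist_eq_norm, add_sub_cancel_left, Complex.norm_real, Real.norm_eq_abs,
      abs_of_pos (by linarith)]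
    linarith
  have hseg : segment ℝ (e x) (e x + ((r / 2 : ℝ) : ℂ)) ⊆ e.target := by
    rw [htar]
    exact (convex_ball _ _).segment_subset hc hw
  have hne : e x ≠ e x + ((r / 2 : ℝ) : ℂ) := by
    intro h
    have : ((r / 2 : ℝ) : ℂ) = 0 := by linear_combination -h
    rw [Complex.ofReal_eq_zero] at this
    linarith
  rw [← subset_empty_iff, ← interior_range_path_eq_empty (injective_chartSegment e hseg hne)]
  refine interior_mono (singleton_subset_iff.2 ?_)
  rw [range_chartSegment]
  exact ⟨e x, left_mem_segment _ _ _, e.left_inv hx⟩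

theorem isOpen_diff_connectedComponentIn [LocallyConnectedSpace X] {F : Set X} (hF : IsOpen F)
    (x : X) : IsOpen (F \ connectedComponentIn F x) := by
  rw [isOpen_iff_mem_nhds]
  rintro y ⟨hyF, hy⟩
  filter_upwards [hF.connectedComponentIn.mem_nhds (mem_connectedComponentIn hyF)] with q hq
  refine ⟨connectedComponentIn_subset F y hq, fun hqx => hy ?_⟩
  rw [connectedComponentIn_eq hqx, ← connectedComponentIn_eq hq]
  exact mem_connectedComponentIn hyF

/-- The complementary regions of finitely many arcs which emanate from `x₀` and leave `O` all have
`x₀` in their closure. -/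
theorem mem_closure_of_star [T2Space X] {ι : Type*} {O : Set X} (hO : IsOpen O)
    (hpre : IsPreconnected O) {x₀ : X} (hx₀ : x₀ ∈ O) {a : ι → X} {s : Finset ι}
    {p : ∀ k, Path (a k) x₀} (hp : ∀ k ∈ s, FlatArc (p k))
    (hpO : ∀ k ∈ s, ∀ t, t ≠ 0 → p k t ∈ O)
    (hdisj : ∀ k ∈ s, ∀ l ∈ s, k ≠ l → range (p k) ∩ range (p l) ⊆ {x₀}) {T : Set X}
    (hT : T = {x₀} ∪ ⋃ k ∈ s, range (p k)) (hTi : interior T = ∅)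
    (haO : ∀ k ∈ s, a k ∉ O) {U V : Set X} (hU : IsOpen U) (hV : IsOpen V) (hUV : Disjoint U V)
    (hun : U ∪ V = O \ T) (hne : U.Nonempty) : x₀ ∈ closure U := by
  classical
  by_contra hcon
  have hOc : O ⊆ closure (U ∪ V) := by
    rw [hun]; exact IsOpen.subset_closure_diff hO hTi
  have hZ := disjoint_inter_closure hU hV hUV
  have hZT : ∀ z ∈ O, z ∈ closure U ∩ closure V → z ∈ T := by
    intro z hzO hz
    by_contra hzT
    exact hZ.le_bot ⟨by rw [hun]; exact ⟨hzO, hzT⟩, hz⟩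
  -- If `x₀` is not a limit point of `U`, one can walk from `x₀` outwards along each leg. This
  -- excludes all common limit points in `O`, so `O` would lie in the closure of `U` or of `V`, and
  -- both are impossible.
  have hwalk : ∀ k ∈ s, ∀ t, t ≠ 0 → p k t ∉ closure U ∩ closure V := by
    intro k hk t ht
    have hd : Disjoint (U ∪ V) (range (p k).symm) := by
      rw [hun, Path.symm_range]
      refine disjoint_sdiff_left.mono_right ?_
      rw [hT]
      exact (subset_biUnion_of_mem (u := fun k => range (p k)) hk).trans subset_union_right
    have key := (hp k hk).walkable_symm U V hU hV hUV hd ?_ (unitInterval.symm t) ?_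
    · rwa [Path.symm_apply, Function.comp_apply, unitInterval.symm_symm] at key
    · intro t ht
      rw [Path.symm_range]
      have htO : (p k).symm t ∈ O := by
        rw [Path.symm_apply, Function.comp_apply]
        refine hpO k hk _ fun h => ht ?_
        rw [← unitInterval.symm_symm t, h, unitInterval.symm_zero]
      by_cases hx : (p k).symm t = x₀
      · rw [hx]
        refine ⟨O ∩ (closure U)ᶜ, Filter.inter_mem (hO.mem_nhds hx₀)
          (isClosed_closure.isOpen_compl.mem_nhds hcon), inter_subset_left.trans hOc, ?_⟩
        rintro z ⟨⟨-, hz⟩, hz', -⟩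
        exact absurd hz' hz
      · have hcl : IsClosed (⋃ l ∈ s.erase k, range (p l)) :=
          isClosed_biUnion_finset fun l _ => isClosed_range_path (p l)
        refine ⟨O ∩ (⋃ l ∈ s.erase k, range (p l))ᶜ, Filter.inter_mem (hO.mem_nhds htO)
          (hcl.isOpen_compl.mem_nhds ?_), inter_subset_left.trans hOc, ?_⟩
        · intro h
          simp only [mem_iUnion, Finset.mem_erase] at h
          obtain ⟨l, ⟨hlk, hl⟩, h⟩ := h
          refine hx (hdisj k hk l hl hlk.symm ⟨?_, h⟩)
          rw [← Path.symm_range]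
          exact mem_range_self t
        · rintro z ⟨⟨hzO, hz⟩, hzZ⟩
          have h1 := hZT z hzO hzZ
          rw [hT] at h1
          rcases h1 with h1 | h1
          · rw [mem_singleton_iff.1 h1]
            exact (p k).target_mem_range
          · simp only [mem_iUnion] at h1
            obtain ⟨l, hl, h1⟩ := h1
            by_cases hlk : l = k
            · rwa [hlk] at h1
            · exact absurd (mem_biUnion (t := fun l => range (p l))
                (Finset.mem_coe.2 (Finset.mem_erase.2 ⟨hlk, hl⟩)) h1) hz
    · intro h
      exact ht (by rw [← unitInterval.symm_symm t, h, unitInterval.symm_one])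
  have hOZ : Disjoint O (closure U ∩ closure V) := by
    rw [disjoint_left]
    intro z hzO hz
    have h1 := hZT z hzO hz
    rw [hT] at h1
    rcases h1 with h1 | h1
    · rw [mem_singleton_iff.1 h1] at hz
      exact hcon hz.1
    · simp only [mem_iUnion] at h1
      obtain ⟨l, hl, t, rfl⟩ := h1
      by_cases ht : t = 0
      · rw [ht, (p l).source] at hzO
        exact haO l hl hzO
      · exact hwalk l hl t ht hz
  rcases subset_closure_or_of_isPreconnected hpre hOc hOZ with h | h
  · exact hcon (h hx₀)
  · obtain ⟨z, hz⟩ := hne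
    have hzO : z ∈ O := (hun.subset (Or.inl hz)).1
    exact (hUV.closure_right hU).le_bot ⟨hz, h hzO⟩

/-- A boundary point `a` and a boundary point `x₀` of a connected open set, both accessible along
straight segments, are joined by an arc through the open set which ends in a straight segment. -/
theorem exists_flatArc_accessible [ChartedSpace ℂ X] [T2Space X] {O : Set X} (hO : IsOpen O)
    (hpre : IsPreconnected O) {a x₀ : X} (haO : a ∉ O) (hxO : x₀ ∉ O) (hax : a ≠ x₀)
    (e : OpenPartialHomeomorph X ℂ) {z w : ℂ} (hzw : z ≠ w) (hseg : segment ℝ z w ⊆ e.target)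
    (hza : e.symm z = a) (hport : ∀ q ∈ segment ℝ z w, q ≠ z → e.symm q ∈ O)
    (e₀ : OpenPartialHomeomorph X ℂ) {c y : ℂ} (hcy : c ≠ y) (hseg₀ : segment ℝ c y ⊆ e₀.target)
    (hcx : e₀.symm c = x₀) (hport₀ : ∀ q ∈ segment ℝ c y, q ≠ c → e₀.symm q ∈ O) :
    ∃ p : Path a x₀, FlatArc p ∧ (∀ t, t ≠ 0 → t ≠ 1 → p t ∈ O) ∧
      ∃ y' : ℂ, ∃ r > 0, r ≤ dist c y' ∧ ∀ q ∈ Metric.ball c r, q ∈ e₀.target ∧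
        (e₀.symm q ∈ range p ↔ q ∈ segment ℝ c y') := by
  -- The homeomorphism drags the free end of the segment at `a` onto the free end of the segment at
  -- `x₀` and fixes everything outside `O`, in particular `a`.
  obtain ⟨Ψ, hΨ, hΨO⟩ := exists_homeomorph_moving hO hpre (hport w (right_mem_segment _ _ _) hzw.symm)
    (hport₀ y (right_mem_segment _ _ _) hcy.symm)
  have hΨmem : ∀ x, Ψ x ∈ O ↔ x ∈ O := by
    intro x
    constructor
    · intro h
      by_contra hx
      rw [hΨO x hx] at h
      exact hx h
    · intro h
      by_contra hx
      have := Ψ.injective (hΨO _ hx)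
      rw [this] at hx
      exact hx h
  set H : Set X := Ψ '' (e.symm '' segment ℝ z w) with hH
  have hHc : IsClosed H := by
    have h1 : IsCompact (segment ℝ z w) := by
      rw [segment_eq_image']
      exact isCompact_Icc.image (by fun_prop)
    exact ((h1.image_of_continuousOn (e.continuousOn_symm.mono hseg)).image Ψ.continuous).isClosed
  have hHO : ∀ x ∈ H, x ∈ O ∨ x = a := by
    rintro _ ⟨_, ⟨q, hq, rfl⟩, rfl⟩
    by_cases hqz : q = z
    · right
      rw [hqz, hza, hΨO a haO]
    · left
      rw [hΨmem]
      exact hport q hq hqz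
  have hxH : x₀ ∉ H := fun h => (hHO _ h).elim hxO fun h => hax h.symm
  set K : Set ℂ := segment ℝ c y ∩ e₀.symm ⁻¹' H with hK
  have hKc : IsClosed K :=
    (e₀.continuousOn_symm.mono hseg₀).preimage_isClosed_of_isClosed (isClosed_segment_complex _ _) hHc
  have hcK : c ∉ K := fun h => hxH (hcx ▸ h.2)
  have hyK : y ∈ K := ⟨right_mem_segment _ _ _, e.symm w, ⟨w, right_mem_segment _ _ _, rfl⟩, hΨ⟩
  -- The dragged segment `H` and the segment at `x₀` may meet often. Both are cut at the point of
  -- `H` that is reached first from `x₀`, so that the remaining pieces meet only there.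
  obtain ⟨τ, hτ, hτK, hmin⟩ := exists_first_hit hKc hcK hyK
  set y' := c + (τ : ℂ) * (y - c) with hy'
  have hcy' : c ≠ y' := fun h => hcK (h ▸ hτK)
  have hsegy : ∀ q, q ∈ segment ℝ c y' ↔ ∃ σ ∈ Icc 0 τ, q = c + (σ : ℂ) * (y - c) :=
    fun q => mem_segment_smul_iff hτ.1
  have hsub : segment ℝ c y' ⊆ segment ℝ c y :=
    (convex_segment c y).segment_subset (left_mem_segment _ _ _) hτK.1
  have hyK' : ∀ q ∈ segment ℝ c y', e₀.symm q ∈ H → q = y' := by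
    intro q hq hqH
    obtain ⟨σ, hσ, rfl⟩ := (hsegy q).1 hq
    rcases hσ.2.lt_or_eq with h | h
    · exact absurd ⟨hsub hq, hqH⟩ (hmin σ ⟨hσ.1, h⟩)
    · rw [h]
  obtain ⟨_, ⟨w', hw', rfl⟩, hΨw'⟩ := hτK.2
  have hzw' : z ≠ w' := by
    rintro rfl
    have h1 := hport₀ y' (hsub (right_mem_segment _ _ _)) hcy'.symm
    rw [← hΨw', hΨmem, hza] at h1
    exact haO h1
  have hsegw : segment ℝ z w' ⊆ segment ℝ z w :=
    (convex_segment z w).segment_subset (left_mem_segment _ _ _) hw'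
  have hsegyc : segment ℝ y' c ⊆ e₀.target := by
    rw [segment_symm]; exact hsub.trans hseg₀
  set p₁ : Path a (e₀.symm y') := ((chartSegment e z w' (hsegw.trans hseg)).map Ψ.continuous).cast
    (by rw [hza, hΨO a haO]) hΨw'.symm with hp₁
  set p₂ : Path (e₀.symm y') x₀ := (chartSegment e₀ y' c hsegyc).cast rfl hcx.symm with hp₂
  have hf₁ : FlatArc p₁ := ((flatArc_chartSegment e _ hzw').map Ψ).cast _ _
  have hf₂ : FlatArc p₂ := (flatArc_chartSegment e₀ hsegyc hcy'.symm).cast _ _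
  have hr₁ : range p₁ ⊆ H := by
    rintro _ ⟨t, rfl⟩
    refine ⟨chartSegment e z w' (hsegw.trans hseg) t, ?_, rfl⟩
    exact image_mono hsegw ((range_chartSegment e (hsegw.trans hseg)).subset (mem_range_self t))
  have hr₂ : range p₂ = e₀.symm '' segment ℝ c y' := by
    rw [segment_symm, ← range_chartSegment e₀ hsegyc]
    rfl
  have h12 : ∀ s, s ≠ 1 → p₁ s ∉ range p₂ := by
    intro s hs h
    rw [hr₂] at h
    obtain ⟨q, hq, hqs⟩ := h
    have h1 := hyK' q hq (by rw [hqs]; exact hr₁ (mem_range_self s))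
    rw [h1] at hqs
    exact hs (hf₁.injective (hqs.symm.trans p₁.target.symm))
  have hx₁ : x₀ ∉ range p₁ := fun h => hxH (hr₁ h)
  have hct : c ∈ e₀.target := hseg₀ (left_mem_segment _ _ _)
  have hnb : e₀.target ∩ e₀.symm ⁻¹' (range p₁)ᶜ ∈ 𝓝 c := by
    refine Filter.inter_mem (e₀.open_target.mem_nhds hct)
      ((e₀.continuousAt_symm hct).preimage_mem_nhds ?_)
    rw [hcx]
    exact (isClosed_range_path p₁).isOpen_compl.mem_nhds hx₁
  obtain ⟨r, hr, hball⟩ := Metric.mem_nhds_iff.1 hnb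
  refine ⟨p₁.trans p₂, hf₁.trans hf₂ h12, ?_, y', min r (dist c y'), ?_, min_le_right _ _, ?_⟩
  · intro t ht0 ht1
    have hinj := (hf₁.trans hf₂ h12).injective
    have hta : (p₁.trans p₂) t ≠ a := fun h => ht0 (hinj (h.trans (Path.source _).symm))
    have htx : (p₁.trans p₂) t ≠ x₀ := fun h => ht1 (hinj (h.trans (Path.target _).symm))
    have hmem : (p₁.trans p₂) t ∈ range p₁ ∪ range p₂ := by
      rw [← Path.trans_range]; exact mem_range_self t
    rcases hmem with h | h
    · exact (hHO _ (hr₁ h)).resolve_right hta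
    · rw [hr₂] at h
      obtain ⟨q, hq, hqt⟩ := h
      rw [← hqt]
      refine hport₀ q (hsub hq) ?_
      rintro rfl
      exact htx (hqt.symm.trans hcx)
  · exact lt_min hr (dist_pos.2 hcy')
  · intro q hq
    have h1 := hball (Metric.ball_subset_ball (min_le_left _ _) hq)
    refine ⟨h1.1, ?_⟩
    rw [Path.trans_range]
    constructor
    · rintro (h | h)
      · exact absurd h h1.2
      · rw [hr₂] at h
        obtain ⟨q', hq', h⟩ := h
        rwa [← e₀.symm.injOn (hseg₀ (hsub hq')) h1.1 h]
    · intro h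
      right
      rw [hr₂]
      exact ⟨q, h, rfl⟩

theorem isClosed_star [T2Space X] {ι : Type*} {x₀ : X} {a : ι → X} (s : Finset ι)
    (p : ∀ k, Path (a k) x₀) : IsClosed ({x₀} ∪ ⋃ k ∈ s, range (p k)) :=
  isClosed_singleton.union (isClosed_biUnion_finset fun k _ => isClosed_range_path (p k))

theorem interior_biUnion_finset_eq_empty {ι : Type*} (s : Finset ι) {F : ι → Set X}
    (hF : ∀ k ∈ s, IsClosed (F k)) (hi : ∀ k ∈ s, interior (F k) = ∅) :
    interior (⋃ k ∈ s, F k) = ∅ := by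
  classical
  induction s using Finset.induction_on with
  | empty => simp
  | insert k s _ ih =>
    rw [Finset.set_biUnion_insert, interior_union_isClosed_of_interior_empty
      (hF k (Finset.mem_insert_self _ _))
      (ih (fun l hl => hF l (Finset.mem_insert_of_mem hl))
        fun l hl => hi l (Finset.mem_insert_of_mem hl))]
    exact hi k (Finset.mem_insert_self _ _)

theorem interior_star_eq_empty [ChartedSpace ℂ X] [T2Space X] {ι : Type*} {x₀ : X} {a : ι → X}
    (s : Finset ι) (p : ∀ k, Path (a k) x₀) (hp : ∀ k ∈ s, FlatArc (p k)) :
    interior ({x₀} ∪ ⋃ k ∈ s, range (p k)) = ∅ := by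
  rw [interior_union_isClosed_of_interior_empty isClosed_singleton
    (interior_biUnion_finset_eq_empty s (fun k _ => isClosed_range_path (p k))
      fun k hk => interior_range_path_eq_empty (hp k hk).injective)]
  exact interior_singleton_eq_empty x₀

/-- A finite family of flat arcs inside `O` (except for their start points), which end in `x₀` and
are disjoint otherwise; in the chart `e₀` centred at `c`, their union is a cone near `x₀`. -/
structure Star {ι : Type*} (O : Set X) {x₀ : X} {a : ι → X} (e₀ : OpenPartialHomeomorph X ℂ)
    (c : ℂ) (s : Finset ι) (p : ∀ k, Path (a k) x₀) : Prop where
  flat : ∀ k ∈ s, FlatArc (p k)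
  mem : ∀ k ∈ s, ∀ t, t ≠ 0 → p k t ∈ O
  disj : ∀ k ∈ s, ∀ l ∈ s, k ≠ l → range (p k) ∩ range (p l) ⊆ {x₀}
  conic : ∃ r > 0, Metric.ball c r ⊆ e₀.target ∧ ∀ y ∈ Metric.ball c r,
    e₀.symm y ∉ ({x₀} ∪ ⋃ k ∈ s, range (p k) : Set X) → ∀ τ ∈ Ioc (0 : ℝ) 1,
      e₀.symm (c + (τ : ℂ) * (y - c)) ∉ ({x₀} ∪ ⋃ k ∈ s, range (p k) : Set X)

theorem add_mul_mem_ball {c y : ℂ} {r τ : ℝ} (hy : y ∈ Metric.ball c r) (hτ : τ ∈ Icc (0 : ℝ) 1) :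
    c + (τ : ℂ) * (y - c) ∈ Metric.ball c r := by
  rw [Metric.mem_ball, dist_eq_norm] at hy ⊢
  rw [add_sub_cancel_left, norm_mul, Complex.norm_real, Real.norm_eq_abs, abs_of_nonneg hτ.1]
  exact (mul_le_of_le_one_left (norm_nonneg _) hτ.2).trans_lt hy

theorem isPreconnected_image_radius {e : OpenPartialHomeomorph X ℂ} {c y : ℂ}
    (h : segment ℝ c y ⊆ e.target) :
    IsPreconnected (e.symm '' ((fun τ : ℝ => c + (τ : ℂ) * (y - c)) '' Ioc 0 1)) := by
  refine (isPreconnected_Ioc.image _ (by fun_prop)).image _ (e.continuousOn_symm.mono ?_)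
  rintro _ ⟨τ, hτ, rfl⟩
  refine h ?_
  have := (mem_segment_smul_iff (w := c) (d := y - c) (τ := 1) one_pos
    (z := c + (τ : ℂ) * (y - c))).2 ⟨τ, ⟨hτ.1.le, hτ.2⟩, rfl⟩
  simpa using this

theorem mem_segment_iff_exists {c y q : ℂ} :
    q ∈ segment ℝ c y ↔ ∃ σ ∈ Icc (0 : ℝ) 1, q = c + (σ : ℂ) * (y - c) := by
  have := mem_segment_smul_iff (w := c) (d := y - c) (τ := 1) one_pos (z := q)
  simpa using this

theorem forall_mem_connectedComponentIn {F : Set X} {e : OpenPartialHomeomorph X ℂ} {z w : ℂ}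
    (h : segment ℝ z w ⊆ e.target) (hzw : z ≠ w)
    (hF : ∀ q ∈ segment ℝ z w, q ≠ z → e.symm q ∈ F) :
    ∀ q ∈ segment ℝ z w, q ≠ z → e.symm q ∈ connectedComponentIn F (e.symm w) := by
  intro q hq hqz
  refine (isPreconnected_image_radius h).subset_connectedComponentIn
    ⟨w, ⟨1, ⟨one_pos, le_rfl⟩, by simp⟩, rfl⟩ ?_ ?_
  · rintro _ ⟨_, ⟨τ, hτ, rfl⟩, rfl⟩
    refine hF _ (mem_segment_iff_exists.2 ⟨τ, ⟨hτ.1.le, hτ.2⟩, rfl⟩) fun h => ?_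
    have h5 : (τ : ℂ) * (w - z) = 0 := by linear_combination h
    rcases mul_eq_zero.1 h5 with h5 | h5
    · exact hτ.1.ne' (by exact_mod_cast h5)
    · exact hzw (sub_eq_zero.1 h5).symm
  · obtain ⟨σ, hσ, rfl⟩ := mem_segment_iff_exists.1 hq
    refine ⟨_, ⟨σ, ⟨hσ.1.lt_of_ne' ?_, hσ.2⟩, rfl⟩, rfl⟩
    rintro rfl
    exact hqz (by simp)

/-- The new leg runs in the component `O'` of `O \ T` that touches `a k`. By `mem_closure_of_star`
this component has points near `x₀`, and since `T` is a cone there, the whole radius to such a point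
lies in `O'`. So both `a k` and `x₀` are accessible from `O'` along segments. The new leg is
straight near `x₀`, which preserves the cone property. -/
theorem Star.exists_insert [ChartedSpace ℂ X] [T2Space X] {ι : Type*} [DecidableEq ι] {O : Set X}
    (hO : IsOpen O) (hpre : IsPreconnected O) {x₀ : X} {a : ι → X} (ha : Function.Injective a)
    (haO : ∀ k, a k ∉ O) {e₀ : OpenPartialHomeomorph X ℂ} (hx₀ : x₀ ∈ e₀.source)
    (he₀ : e₀.source ⊆ O) {s : Finset ι} {p : ∀ k, Path (a k) x₀} (hs : Star O e₀ (e₀ x₀) s p)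
    {k : ι} (hk : k ∉ s) (e : OpenPartialHomeomorph X ℂ) {z w : ℂ} (hzw : z ≠ w)
    (hseg : segment ℝ z w ⊆ e.target) (hza : e.symm z = a k)
    (hport : ∀ q ∈ segment ℝ z w, q ≠ z → e.symm q ∈ O) :
    ∃ p' : Path (a k) x₀, Star O e₀ (e₀ x₀) (insert k s) (Function.update p k p') := by
  have hlc : LocallyConnectedSpace X := ChartedSpace.locallyConnectedSpace ℂ X
  obtain ⟨r, hr, hrt, hcon⟩ := hs.conic
  set T : Set X := {x₀} ∪ ⋃ k ∈ s, range (p k) with hT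
  have hTc : IsClosed T := isClosed_star s p
  have hTi : interior T = ∅ := interior_star_eq_empty s p hs.flat
  have hxT : x₀ ∈ T := Or.inl rfl
  have hxO : x₀ ∈ O := he₀ hx₀
  have hkx : a k ≠ x₀ := fun h => haO k (h ▸ hxO)
  have hkT : a k ∉ T := by
    rintro (h | h)
    · exact hkx h
    · simp only [mem_iUnion] at h
      obtain ⟨l, hl, t, ht⟩ := h
      by_cases ht0 : t = 0
      · rw [ht0, (p l).source] at ht
        exact hk (ha ht ▸ hl)
      · exact haO k (ht ▸ hs.mem l hl t ht0)
  have hzt : z ∈ e.target := hseg (left_mem_segment _ _ _)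
  -- The segment at `a k` is shortened until it misses the closed set `T`; this is possible because
  -- `a k` is not on the earlier legs.
  obtain ⟨w', hzw', hsub, hw'T⟩ : ∃ w', z ≠ w' ∧ segment ℝ z w' ⊆ segment ℝ z w ∧
      ∀ q ∈ segment ℝ z w', e.symm q ∉ T := by
    have h1 : e.symm ⁻¹' Tᶜ ∈ 𝓝 z := by
      refine (e.continuousAt_symm hzt).preimage_mem_nhds (hTc.isOpen_compl.mem_nhds ?_)
      rwa [hza]
    obtain ⟨ε, hε, hb⟩ := Metric.mem_nhds_iff.1 h1
    have hn : 0 < ‖w - z‖ := norm_pos_iff.2 (sub_ne_zero.2 hzw.symm)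
    set τ := min 1 (ε / (2 * ‖w - z‖)) with hτ
    have hτ0 : 0 < τ := lt_min one_pos (by positivity)
    have hw : z + (τ : ℂ) * (w - z) ∈ Metric.ball z ε := by
      rw [Metric.mem_ball, dist_eq_norm, add_sub_cancel_left, norm_mul, Complex.norm_real,
        Real.norm_eq_abs, abs_of_pos hτ0]
      calc τ * ‖w - z‖ ≤ ε / (2 * ‖w - z‖) * ‖w - z‖ := by gcongr; exact min_le_right _ _
        _ = ε / 2 := by field_simp
        _ < ε := by linarith
    refine ⟨z + (τ : ℂ) * (w - z), ?_, ?_, ?_⟩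
    · intro h
      have h2 : (τ : ℂ) * (w - z) = 0 := by linear_combination -h
      rcases mul_eq_zero.1 h2 with h2 | h2
      · exact hτ0.ne' (by exact_mod_cast h2)
      · exact hzw (sub_eq_zero.1 h2).symm
    · exact (convex_segment z w).segment_subset (left_mem_segment _ _ _)
        (mem_segment_iff_exists.2 ⟨τ, ⟨hτ0.le, min_le_left _ _⟩, rfl⟩)
    · intro q hq
      exact hb ((convex_ball z ε).segment_subset (Metric.mem_ball_self hε) hw hq)
  have hport' : ∀ q ∈ segment ℝ z w', q ≠ z → e.symm q ∈ O \ T :=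
    fun q hq hqz => ⟨hport q (hsub hq) hqz, hw'T q hq⟩
  have hOT : IsOpen (O \ T) := hO.sdiff hTc
  set O' := connectedComponentIn (O \ T) (e.symm w') with hO'
  have hwO' : e.symm w' ∈ O' :=
    mem_connectedComponentIn (hport' w' (right_mem_segment _ _ _) hzw'.symm)
  have hO'sub : O' ⊆ O \ T := connectedComponentIn_subset _ _
  have hport'' := forall_mem_connectedComponentIn (hsub.trans hseg) hzw' hport'
  have hxcl : x₀ ∈ closure O' :=
    mem_closure_of_star hO hpre hxO hs.flat hs.mem hs.disj hT hTi (fun k _ => haO k)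
      hOT.connectedComponentIn (isOpen_diff_connectedComponentIn hOT _) disjoint_sdiff_right
      (union_sdiff_cancel hO'sub) ⟨_, hwO'⟩
  have hc : e₀.symm (e₀ x₀) = x₀ := e₀.left_inv hx₀
  obtain ⟨u, ⟨hus, hur⟩, huO⟩ := mem_closure_iff_nhds.1 hxcl
    (e₀.source ∩ e₀ ⁻¹' Metric.ball (e₀ x₀) r) (Filter.inter_mem (e₀.open_source.mem_nhds hx₀)
      ((e₀.continuousAt hx₀).preimage_mem_nhds (Metric.ball_mem_nhds _ hr)))
  set y := e₀ u with hy
  have hyu : e₀.symm y = u := e₀.left_inv hus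
  have hcy : e₀ x₀ ≠ y := by
    intro h
    rw [← h, hc] at hyu
    exact (hO'sub huO).2 (hyu ▸ hxT)
  have hball : segment ℝ (e₀ x₀) y ⊆ Metric.ball (e₀ x₀) r :=
    (convex_ball _ _).segment_subset (Metric.mem_ball_self hr) hur
  have hport₀ := forall_mem_connectedComponentIn (hball.trans hrt) hcy (F := O \ T) (by
    intro q hq hqz
    refine ⟨he₀ (e₀.map_target (hrt (hball hq))), ?_⟩
    obtain ⟨σ, hσ, rfl⟩ := mem_segment_iff_exists.1 hq
    refine hcon y hur (by rw [hyu]; exact (hO'sub huO).2) σ ⟨hσ.1.lt_of_ne' ?_, hσ.2⟩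
    rintro rfl
    exact hqz (by simp))
  rw [hyu, ← connectedComponentIn_eq huO] at hport₀
  obtain ⟨p', hp', hp'O, y', r', hr', hr'y, hconic⟩ := exists_flatArc_accessible
    hOT.connectedComponentIn isPreconnected_connectedComponentIn (fun h => haO k (hO'sub h).1)
    (fun h => (hO'sub h).2 hxT) hkx e hzw' (hsub.trans hseg) hza hport'' e₀ hcy (hball.trans hrt) hc
    hport₀
  have hp'T : range p' ∩ T ⊆ {x₀} := by
    rintro _ ⟨⟨t, rfl⟩, ht⟩
    by_cases ht0 : t = 0
    · rw [ht0, p'.source] at ht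
      exact absurd ht hkT
    · by_cases ht1 : t = 1
      · rw [ht1, p'.target]
        rfl
      · exact absurd ht (hO'sub (hp'O t ht0 ht1)).2
  have hup : ∀ l ∈ s, Function.update p k p' l = p l := fun l hl =>
    Function.update_of_ne (ne_of_mem_of_not_mem hl hk) _ _
  have hunion : ({x₀} ∪ ⋃ l ∈ insert k s, range (Function.update p k p' l) : Set X)
      = range p' ∪ T := by
    rw [Finset.set_biUnion_insert, Function.update_self, hT, ← union_assoc, union_comm {x₀},
      union_assoc]
    congr 2
    exact iUnion₂_congr fun l hl => by rw [hup l hl]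
  have hrT : ∀ l ∈ s, range (p l) ⊆ T := fun l hl =>
    (subset_biUnion_of_mem (u := fun l => range (p l)) hl).trans subset_union_right
  refine ⟨p', ?_, ?_, ?_, ?_⟩
  · intro l hl
    rcases Finset.mem_insert.1 hl with rfl | hl
    · rwa [Function.update_self]
    · rw [hup l hl]
      exact hs.flat l hl
  · intro l hl t ht
    rcases Finset.mem_insert.1 hl with rfl | hl
    · rw [Function.update_self]
      by_cases ht1 : t = 1
      · rwa [ht1, p'.target]
      · exact (hO'sub (hp'O t ht ht1)).1
    · rw [hup l hl]
      exact hs.mem l hl t ht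
  · intro l hl m hm hlm
    rcases Finset.mem_insert.1 hl with hlk | hl <;> rcases Finset.mem_insert.1 hm with hmk | hm
    · exact absurd (hlk.trans hmk.symm) hlm
    · rw [hlk, Function.update_self, hup m hm]
      exact (inter_subset_inter_right _ (hrT m hm)).trans hp'T
    · rw [hmk, Function.update_self, hup l hl, inter_comm]
      exact (inter_subset_inter_right _ (hrT l hl)).trans hp'T
    · rw [hup l hl, hup m hm]
      exact hs.disj l hl m hm hlm
  · rw [hunion]
    refine ⟨min r r', lt_min hr hr', (Metric.ball_subset_ball (min_le_left _ _)).trans hrt, ?_⟩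
    intro q hq hqT τ hτ
    have hq1 := Metric.ball_subset_ball (min_le_left _ _) hq
    have hq2 := Metric.ball_subset_ball (min_le_right _ _) hq
    rintro (h | h)
    · rw [(hconic _ (add_mul_mem_ball hq2 ⟨hτ.1.le, hτ.2⟩)).2] at h
      refine hqT (Or.inl ?_)
      rw [(hconic _ hq2).2]
      obtain ⟨σ, hσ, h⟩ := mem_segment_iff_exists.1 h
      have hτ0 : (τ : ℂ) ≠ 0 := by exact_mod_cast hτ.1.ne'
      have hqe : q = e₀ x₀ + ((σ / τ : ℝ) : ℂ) * (y' - e₀ x₀) := by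
        push_cast
        field_simp
        linear_combination h
      refine mem_segment_iff_exists.2 ⟨σ / τ, ⟨div_nonneg hσ.1 hτ.1.le, ?_⟩, hqe⟩
      -- The point `q` lies on the ray towards `y'`, and `r' ≤ dist (e₀ x₀) y'` shows that it has
      -- not passed `y'`, so it is on the leg itself.
      have h1 : dist q (e₀ x₀) = σ / τ * dist (e₀ x₀) y' := by
        rw [dist_comm (e₀ x₀), dist_eq_norm, dist_eq_norm, hqe, add_sub_cancel_left, norm_mul,
          Complex.norm_real, Real.norm_eq_abs, abs_of_nonneg (div_nonneg hσ.1 hτ.1.le)]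
      rw [Metric.mem_ball, h1] at hq2
      by_contra! h2
      nlinarith [hr'.trans_le hr'y]
    · exact hcon q hq1 (fun h => hqT (Or.inr h)) τ hτ h

/-- Accessible boundary points of a connected open set are joined to an interior point by arcs
which are disjoint up to this point. -/
theorem exists_legs [ChartedSpace ℂ X] [T2Space X] [ConnectedSpace X] {ι : Type*} [Fintype ι]
    {O : Set X}
    (hO : IsOpen O) (hpre : IsPreconnected O) {x₀ : X} (hx₀ : x₀ ∈ O) {a : ι → X}
    (ha : Function.Injective a) (haO : ∀ k, a k ∉ O)
    (hport : ∀ k, ∃ (e : OpenPartialHomeomorph X ℂ) (z w : ℂ), z ≠ w ∧ segment ℝ z w ⊆ e.target ∧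
      e.symm z = a k ∧ ∀ q ∈ segment ℝ z w, q ≠ z → e.symm q ∈ O) :
    ∃ p : ∀ k, Path (a k) x₀, (∀ k, FlatArc (p k)) ∧ (∀ k t, t ≠ 0 → p k t ∈ O) ∧
      ∀ k l, k ≠ l → range (p k) ∩ range (p l) ⊆ {x₀} := by
  classical
  have hlp : LocallyPathConnectedSpace X := ChartedSpace.locallyPathConnectedSpace ℂ X
  have hpc : PathConnectedSpace X := pathConnectedSpace_iff_connectedSpace.2 inferInstance
  obtain ⟨e₀, r, hr, hxe, he₀, htar⟩ := exists_disc_chart x₀ (hO.mem_nhds hx₀)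
  have key : ∀ s : Finset ι, ∃ p : ∀ k, Path (a k) x₀, Star O e₀ (e₀ x₀) s p := by
    intro s
    induction s using Finset.induction_on with
    | empty =>
      -- For indices outside the finite set the paths are arbitrary placeholders, replaced one by
      -- one during the induction.
      refine ⟨fun k => PathConnectedSpace.somePath _ _, by simp, by simp, by simp, r, hr, htar.ge, ?_⟩
      intro y hy hyx τ hτ hτx
      simp only [Finset.notMem_empty, iUnion_of_empty, iUnion_empty, union_empty,
        mem_singleton_iff] at hyx hτx
      have h1 := add_mul_mem_ball hy ⟨hτ.1.le, hτ.2⟩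
      rw [← htar] at hy h1
      have h2 : e₀ x₀ + (τ : ℂ) * (y - e₀ x₀) = e₀ x₀ := by
        conv_rhs => rw [← hτx, e₀.right_inv h1]
      have h3 : (τ : ℂ) * (y - e₀ x₀) = 0 := by linear_combination h2
      rcases mul_eq_zero.1 h3 with h3 | h3
      · exact hτ.1.ne' (by exact_mod_cast h3)
      · exact hyx (by rw [sub_eq_zero.1 h3, e₀.left_inv hxe])
    | insert k s hk ih =>
      obtain ⟨p, hp⟩ := ih
      obtain ⟨e, z, w, hzw, hseg, hza, hpt⟩ := hport k
      obtain ⟨p', hp'⟩ := hp.exists_insert hO hpre ha haO hxe he₀ hk e hzw hseg hza hpt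
      exact ⟨_, hp'⟩
  obtain ⟨p, hp⟩ := key Finset.univ
  exact ⟨p, fun k => hp.flat k (Finset.mem_univ k), fun k => hp.mem k (Finset.mem_univ k),
    fun k l => hp.disj k (Finset.mem_univ k) l (Finset.mem_univ l)⟩

/-! ### The two sides of a segment, and gaps of a closed set in it -/

theorem convex_setOf_im_div_pos (a d : ℂ) : Convex ℝ {z : ℂ | 0 < ((z - a) / d).im} := by
  intro x hx y hy s t hs ht hst
  have h : (s • x + t • y - a) / d = (s : ℂ) * ((x - a) / d) + (t : ℂ) * ((y - a) / d) := by
    have hst' : (s : ℂ) + t = 1 := by exact_mod_cast hst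
    simp only [Complex.real_smul, div_eq_mul_inv]
    linear_combination (a * d⁻¹) * hst'
  rw [mem_ofPred_eq, h, Complex.add_im, Complex.im_ofReal_mul, Complex.im_ofReal_mul]
  rw [mem_ofPred_eq] at hx hy
  rcases hs.eq_or_lt with rfl | hs
  · rw [zero_add] at hst
    rw [hst]
    simpa using hy
  · have := mul_pos hs hx
    have := mul_nonneg ht hy.le
    linarith

theorem im_div_eq_zero_of_mem_segment {a b z : ℂ} (hz : z ∈ segment ℝ a b) :
    ((z - a) / (b - a)).im = 0 := by
  obtain ⟨σ, -, rfl⟩ := mem_segment_iff_exists.1 hz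
  by_cases h : b - a = 0
  · simp [h]
  · rw [add_sub_cancel_left, mul_div_cancel_right₀ _ h, Complex.ofReal_im]

theorem im_div_swap {a b : ℂ} (hab : a ≠ b) (z : ℂ) :
    ((z - b) / (a - b)).im = -((z - a) / (b - a)).im := by
  have h1 : a - b ≠ 0 := sub_ne_zero.2 hab
  have h2 : b - a ≠ 0 := sub_ne_zero.2 hab.symm
  have : (z - b) / (a - b) = 1 - (z - a) / (b - a) := by
    rw [← neg_sub b a, div_neg]
    field_simp
    ring
  rw [this, Complex.sub_im, Complex.one_im, zero_sub]

theorem frequently_im_div_pos {a b : ℂ} (hab : a ≠ b) {i : ℂ} (hi : i ∈ segment ℝ a b) :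
    ∃ᶠ z in 𝓝 i, 0 < ((z - a) / (b - a)).im := by
  have h2 : b - a ≠ 0 := sub_ne_zero.2 hab.symm
  have ht : Filter.Tendsto (fun τ : ℝ => i + (τ : ℂ) * (Complex.I * (b - a))) (𝓝[>] 0) (𝓝 i) := by
    have : Continuous fun τ : ℝ => i + (τ : ℂ) * (Complex.I * (b - a)) := by fun_prop
    have h := this.tendsto 0
    simp only [Complex.ofReal_zero, zero_mul, add_zero] at h
    exact h.mono_left nhdsWithin_le_nhds
  refine ht.frequently (Filter.Eventually.frequently ?_)
  filter_upwards [self_mem_nhdsWithin] with τ hτ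
  have h3 : (i + (τ : ℂ) * (Complex.I * (b - a)) - a) / (b - a)
      = (i - a) / (b - a) + (τ : ℂ) * Complex.I := by
    field_simp
    ring
  rw [h3, Complex.add_im, im_div_eq_zero_of_mem_segment hi]
  simpa using hτ

/-- Along a segment which locally bounds `P ∪ Q`, the left side belongs to one of the two sets. -/
theorem eventually_left_or {a b : ℂ} (hab : a ≠ b) {P Q : Set ℂ} (hP : IsOpen P) (hQ : IsOpen Q)
    (hPQ : Disjoint P Q)
    (hnear : ∀ i ∈ openSegment ℝ a b, ∃ N ∈ 𝓝 i, N \ segment ℝ a b ⊆ P ∪ Q) :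
    (∀ i ∈ openSegment ℝ a b, ∀ᶠ z in 𝓝 i, 0 < ((z - a) / (b - a)).im → z ∈ P) ∨
      ∀ i ∈ openSegment ℝ a b, ∀ᶠ z in 𝓝 i, 0 < ((z - a) / (b - a)).im → z ∈ Q := by
  -- Small half-discs on the left are convex and covered by `P` and `Q`, so each lies in one of
  -- them. Which one is locally constant along the open segment, hence constant.
  refine isPreconnected_iff_subset_of_disjoint.1 (convex_openSegment a b).isPreconnected
    {i | ∀ᶠ z in 𝓝 i, 0 < ((z - a) / (b - a)).im → z ∈ P}
    {i | ∀ᶠ z in 𝓝 i, 0 < ((z - a) / (b - a)).im → z ∈ Q} isOpen_setOfPred_eventually_nhds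
    isOpen_setOfPred_eventually_nhds ?_ ?_
  · intro i hi
    obtain ⟨N, hN, hNs⟩ := hnear i hi
    obtain ⟨ρ, hρ, hb⟩ := Metric.mem_nhds_iff.1 hN
    have hpre : IsPreconnected (Metric.ball i ρ ∩ {z : ℂ | 0 < ((z - a) / (b - a)).im}) :=
      ((convex_ball i ρ).inter (convex_setOf_im_div_pos a (b - a))).isPreconnected
    have hsub : Metric.ball i ρ ∩ {z : ℂ | 0 < ((z - a) / (b - a)).im} ⊆ P ∪ Q := by
      rintro z ⟨hz, hz'⟩
      exact hNs ⟨hb hz, fun h => hz'.ne' (im_div_eq_zero_of_mem_segment h)⟩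
    rcases hpre.subset_or_subset hP hQ hPQ hsub with h | h
    · left
      filter_upwards [Metric.ball_mem_nhds i hρ] with z hz hz'
      exact h ⟨hz, hz'⟩
    · right
      filter_upwards [Metric.ball_mem_nhds i hρ] with z hz hz'
      exact h ⟨hz, hz'⟩
  · rw [eq_empty_iff_forall_notMem]
    rintro i ⟨hi, h1, h2⟩
    obtain ⟨z, hz, hz1, hz2⟩ :=
      ((frequently_im_div_pos hab (openSegment_subset_segment ℝ a b hi)).and_eventually
        (Filter.Eventually.and h1 h2)).exists
    exact hPQ.le_bot ⟨hz1 hz, hz2 hz⟩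

/-- Near an interior point of the segment, the points on neither side lie on the segment itself,
which `Q` avoids, and the points on both sides belong to `P`. -/
theorem notMem_closure_of_eventually_sides {a b : ℂ} {P Q : Set ℂ} (hPQ : Disjoint P Q)
    (hQI : Disjoint Q (segment ℝ a b)) (hab : a ≠ b)
    {i : ℂ} (hl : ∀ᶠ z in 𝓝 i, 0 < ((z - a) / (b - a)).im → z ∈ P)
    (hr : ∀ᶠ z in 𝓝 i, ((z - a) / (b - a)).im < 0 → z ∈ P) (hi : i ∈ openSegment ℝ a b) :
    i ∉ closure Q := by
  have hd : b - a ≠ 0 := sub_ne_zero.2 hab.symm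
  rw [openSegment_eq_image'] at hi
  obtain ⟨σ, hσ, rfl⟩ := hi
  intro hcl
  have hcont : Continuous fun z : ℂ => ((z - a) / (b - a)).re := by fun_prop
  have hσre : ((a + σ • (b - a) - a) / (b - a)).re = σ := by
    rw [add_sub_cancel_left, Complex.real_smul, mul_div_cancel_right₀ _ hd, Complex.ofReal_re]
  have hre : ∀ᶠ z in 𝓝 (a + σ • (b - a)), ((z - a) / (b - a)).re ∈ Ioo (0 : ℝ) 1 :=
    hcont.continuousAt.eventually_mem (by rw [hσre]; exact isOpen_Ioo.mem_nhds hσ)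
  obtain ⟨z, hzQ, h1, h2, h3⟩ := ((mem_closure_iff_frequently.1 hcl).and_eventually
    (hl.and (hr.and hre))).exists
  rcases lt_trichotomy 0 ((z - a) / (b - a)).im with h | h | h
  · exact hPQ.le_bot ⟨h1 h, hzQ⟩
  · refine hQI.le_bot ⟨hzQ, mem_segment_iff_exists.2
      ⟨((z - a) / (b - a)).re, ⟨h3.1.le, h3.2.le⟩, ?_⟩⟩
    have h4 : ((((z - a) / (b - a)).re : ℝ) : ℂ) = (z - a) / (b - a) :=
      Complex.ext (by simp) (by rw [Complex.ofReal_im]; exact h)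
    rw [h4]
    field_simp
    ring
  · exact hPQ.le_bot ⟨h2 h, hzQ⟩

/-- A segment whose end points are separated by `J ∪ V` has the same side on the left and on the
right. -/
theorem notMem_inter_closure_of_not_logEquiv {J V P Q : Set ℂ} {a b : ℂ} (hJ : IsClosed J)
    (hV : IsClosed V) (hP : IsOpen P) (hQ : IsOpen Q) (hPQ : Disjoint P Q) (haK : a ∉ J ∪ V)
    (hbK : b ∉ J ∪ V) (hVI : Disjoint V (segment ℝ a b)) (hPI : Disjoint P (segment ℝ a b))
    (hQI : Disjoint Q (segment ℝ a b)) (hcov : J ⊆ P ∪ Q ∪ segment ℝ a b)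
    (hJV : J ∩ V ⊆ P ∨ J ∩ V ⊆ Q)
    (hnear : ∀ i ∈ openSegment ℝ a b, ∃ N ∈ 𝓝 i, N \ segment ℝ a b ⊆ P ∪ Q)
    (hne : ¬ LogEquiv (J ∪ V) a b) {i : ℂ} (hi : i ∈ openSegment ℝ a b) :
    i ∉ closure P ∩ closure Q := by
  have hab : a ≠ b := by
    rintro rfl
    exact hne (LogEquiv.refl _ _)
  have hl := eventually_left_or hab hP hQ hPQ hnear
  have hr := eventually_left_or hab.symm hP hQ hPQ (by
    intro i hi
    rw [openSegment_symm] at hi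
    rw [segment_symm]
    exact hnear i hi)
  simp only [im_div_swap hab, neg_pos, openSegment_symm ℝ b a] at hr
  have hJI : ∀ i ∈ J ∩ segment ℝ a b, i ∈ openSegment ℝ a b := by
    rintro i ⟨hiJ, hi⟩
    refine mem_openSegment_of_ne_left_right ?_ ?_ hi
    · rintro rfl
      exact haK (Or.inl hiJ)
    · rintro rfl
      exact hbK (Or.inl hiJ)
  -- Different sets on the two sides contradict `hne` by `logEquiv_of_sides`. That lemma wants `J ∩
  -- V` in the set on the right; if it is in the set on the left, the segment is read from `b` to
  -- `a`.
  have hswap : ∀ {A B : Set ℂ}, (∀ i ∈ openSegment ℝ a b,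
        ∀ᶠ z in 𝓝 i, 0 < ((z - a) / (b - a)).im → z ∈ A) →
      (∀ i ∈ openSegment ℝ a b, ∀ᶠ z in 𝓝 i, ((z - a) / (b - a)).im < 0 → z ∈ B) →
      IsOpen A → IsOpen B → Disjoint A B → Disjoint A (segment ℝ a b) →
      Disjoint B (segment ℝ a b) → J ⊆ A ∪ B ∪ segment ℝ a b → J ∩ V ⊆ A ∨ J ∩ V ⊆ B → False := by
    intro A B hA hB hAo hBo hAB hAI hBI hc hJV
    rcases hJV with hJV | hJV
    · refine hne (LogEquiv.symm (logEquiv_of_sides (P := B) (Q := A) hJ hV hBo hAo hAB.symm hbK haK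
        ?_ ?_ ?_ hJV ?_ ?_))
      · rwa [segment_symm]
      · rwa [segment_symm]
      · rw [segment_symm, union_comm B A]
        exact hc
      · intro i hi
        rw [segment_symm] at hi
        simp only [im_div_swap hab, neg_pos]
        exact hB i (hJI i hi)
      · intro i hi
        rw [segment_symm] at hi
        simp only [im_div_swap hab, neg_lt_zero]
        exact hA i (hJI i hi)
    · exact hne (logEquiv_of_sides hJ hV hAo hBo hAB haK hbK hVI hAI hc hJV
        (fun i hi => hA i (hJI i hi)) fun i hi => hB i (hJI i hi))
  rcases hl with hl | hl <;> rcases hr with hr | hr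
  · exact fun h => notMem_closure_of_eventually_sides hPQ hQI hab (hl i hi) (hr i hi) hi h.2
  · exact (hswap hl hr hP hQ hPQ hPI hQI hcov hJV).elim
  · exact (hswap hl hr hQ hP hPQ.symm hQI hPI (by rwa [union_comm Q P]) hJV.symm).elim
  · exact fun h => notMem_closure_of_eventually_sides hPQ.symm hPI hab (hl i hi) (hr i hi) hi h.1

/-- If a closed set `A` meets a segment in its end points, which are separated by `K`, then there
is a gap of `A` in the segment across which one changes the side of `K`. -/
theorem exists_gap {K M A : Set ℂ} (hK : IsClosed K) (hM : IsOpen M) (hMK : Disjoint M K)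
    {a b : ℂ} (hA : IsClosed (A ∩ segment ℝ a b)) (hAM : A ∩ segment ℝ a b ⊆ M) (ha : a ∈ A)
    (hb : b ∈ A) (hne : ¬ LogEquiv K a b) :
    ∃ q a' b' q', q ∈ A ∧ q' ∈ A ∧ a' ≠ q ∧ b' ≠ q' ∧ a' ≠ b' ∧ ¬ LogEquiv K a' b' ∧
      segment ℝ a' b' ⊆ segment ℝ a b ∧ Disjoint A (segment ℝ a' b') ∧
      segment ℝ a' q ⊆ M ∧ segment ℝ b' q' ⊆ M ∧
      segment ℝ a' q ∩ segment ℝ a' b' ⊆ {a'} ∧ segment ℝ b' q' ∩ segment ℝ a' b' ⊆ {b'} := by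
  have hab : a ≠ b := by
    rintro rfl
    exact hne (LogEquiv.refl _ _)
  have hd : b - a ≠ 0 := sub_ne_zero.2 hab.symm
  set c : ℝ → ℂ := fun t => a + (t : ℂ) * (b - a) with hc
  have hcc : Continuous c := by fun_prop
  have hc0 : c 0 = a := by simp [hc]
  have hc1 : c 1 = b := by simp [hc]
  have hcinj : Function.Injective c := by
    intro s t h
    have h1 : ((s : ℂ) - t) * (b - a) = 0 := by
      simp only [hc] at h
      linear_combination h
    rcases mul_eq_zero.1 h1 with h1 | h1
    · exact_mod_cast sub_eq_zero.1 h1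
    · exact absurd h1 hd
  have hcseg : ∀ s t : ℝ, s ≤ t → segment ℝ (c s) (c t) = c '' Icc s t := by
    intro s t hst
    rw [← segment_eq_Icc hst]
    have : c = (AffineMap.lineMap a b : ℝ →ᵃ[ℝ] ℂ) := by
      ext1 r
      rw [AffineMap.lineMap_apply_module', Complex.real_smul, add_comm]
    rw [this, image_segment]
  have hc01 : segment ℝ a b = c '' Icc 0 1 := by rw [← hcseg 0 1 zero_le_one, hc0, hc1]
  set E : Set ℝ := {t | t ∈ Icc (0 : ℝ) 1 ∧ c t ∈ A} with hE
  have hEeq : E = Icc 0 1 ∩ c ⁻¹' (A ∩ segment ℝ a b) := by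
    ext t
    constructor
    · rintro ⟨h1, h2⟩
      exact ⟨h1, h2, by rw [hc01]; exact ⟨t, h1, rfl⟩⟩
    · rintro ⟨h1, h2, -⟩
      exact ⟨h1, h2⟩
  have hEc : IsClosed E := by
    rw [hEeq]
    exact isClosed_Icc.inter (hA.preimage hcc)
  have hEM : ∀ t ∈ E, c t ∈ M := fun t ht => hAM (by rw [hEeq] at ht; exact ht.2)
  have hEK : ∀ t ∈ E, ∀ᶠ s in 𝓝 t, LogEquiv K (c s) (c t) := fun t ht =>
    hcc.continuousAt.eventually (eventually_logEquiv hK fun h => hMK.le_bot ⟨hEM t ht, h⟩)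
  -- Let `s` be the last parameter of `A` on the side of `a`, and `s'` the infimum of the later
  -- parameters of `A`. The classes are locally constant on `E`, so `s` is still on the side of `a`,
  -- and the later parameters of `A` cannot accumulate at `s`; hence `s < s'`.
  set F : Set ℝ := {t | t ∈ E ∧ LogEquiv K (c t) a} with hF
  have hFb : BddAbove F := ⟨1, fun t ht => ht.1.1.2⟩
  have hF0 : (0 : ℝ) ∈ F := ⟨⟨⟨le_rfl, zero_le_one⟩, by rwa [hc0]⟩, by
    rw [hc0]; exact LogEquiv.refl _ _⟩
  set s := sSup F with hs
  have hscl : s ∈ closure F := csSup_mem_closure ⟨0, hF0⟩ hFb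
  have hsE : s ∈ E := hEc.closure_subset_iff.2 (fun t ht => ht.1) hscl
  have hsa : LogEquiv K (c s) a := by
    obtain ⟨t, ht, hts⟩ := ((mem_closure_iff_frequently.1 hscl).and_eventually (hEK s hsE)).exists
    exact hts.symm.trans ht.2
  have h1E : (1 : ℝ) ∈ E := ⟨⟨zero_le_one, le_rfl⟩, by rwa [hc1]⟩
  have hs1 : s ≠ 1 := by
    intro h
    rw [h, hc1] at hsa
    exact hne hsa.symm
  have hslt : s < 1 := lt_of_le_of_ne hsE.1.2 hs1
  set F' : Set ℝ := E ∩ Ioi s with hF'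
  have hF'b : BddBelow F' := ⟨s, fun t ht => ht.2.le⟩
  have hF'1 : (1 : ℝ) ∈ F' := ⟨h1E, hslt⟩
  set s' := sInf F' with hs'
  have hs'cl : s' ∈ closure F' := csInf_mem_closure ⟨1, hF'1⟩ hF'b
  have hs'E : s' ∈ E := hEc.closure_subset_iff.2 (fun t ht => ht.1) hs'cl
  have hF'not : ∀ t ∈ F', ¬ LogEquiv K (c t) a := fun t ht h =>
    (le_csSup hFb ⟨ht.1, h⟩).not_gt ht.2
  have hss' : s < s' := by
    refine lt_of_le_of_ne (le_csInf ⟨1, hF'1⟩ fun t ht => ht.2.le) fun h => ?_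
    rw [← h] at hs'cl
    obtain ⟨t, ht, hts⟩ := ((mem_closure_iff_frequently.1 hs'cl).and_eventually (hEK s hsE)).exists
    exact hF'not t ht (hts.trans hsa)
  have hgap : ∀ t ∈ Ioo s s', t ∉ E := fun t ht hE => (csInf_le hF'b ⟨hE, ht.1⟩).not_gt ht.2
  have hs'a := hF'not s' ⟨hs'E, hss'⟩
  have hnear : ∀ t ∈ E, ∃ ε > 0, ∀ r ∈ Icc (t - ε) (t + ε), c r ∈ M ∧ LogEquiv K (c r) (c t) := by
    intro t ht
    obtain ⟨ε, hε, h⟩ := Metric.nhds_basis_closedBall.eventually_iff.1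
      ((hcc.continuousAt.eventually_mem (hM.mem_nhds (hEM t ht))).and (hEK t ht))
    refine ⟨ε, hε, fun r hr => h ?_⟩
    rwa [Real.closedBall_eq_Icc]
  obtain ⟨ε, hε, hεs⟩ := hnear s hsE
  obtain ⟨ε', hε', hεs'⟩ := hnear s' hs'E
  -- The ends of the gap are moved slightly inwards, off `A`, without changing their classes; a
  -- third of the gap at most is cut off on either side, which leaves a nondegenerate segment.
  set δ := min (min ε ε') ((s' - s) / 3) with hδ
  have hδ0 : 0 < δ := lt_min (lt_min hε hε') (by linarith)
  have hδε : δ ≤ ε := (min_le_left _ _).trans (min_le_left _ _)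
  have hδε' : δ ≤ ε' := (min_le_left _ _).trans (min_le_right _ _)
  have hδs : δ ≤ (s' - s) / 3 := min_le_right _ _
  have hlt : s + δ < s' - δ := by linarith
  have hseg1 : segment ℝ (c (s + δ)) (c s) = c '' Icc s (s + δ) := by
    rw [segment_symm, hcseg _ _ (by linarith)]
  have hseg2 : segment ℝ (c (s' - δ)) (c s') = c '' Icc (s' - δ) s' := hcseg _ _ (by linarith)
  have hseg3 := hcseg _ _ hlt.le
  refine ⟨c s, c (s + δ), c (s' - δ), c s', hsE.2, hs'E.2, ?_, ?_, ?_, ?_, ?_, ?_, ?_, ?_, ?_, ?_⟩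
  · exact fun h => by linarith [hcinj h]
  · exact fun h => by linarith [hcinj h]
  · exact fun h => by linarith [hcinj h]
  · intro h
    have h1 := (hεs (s + δ) ⟨by linarith, by linarith⟩).2
    have h2 := (hεs' (s' - δ) ⟨by linarith, by linarith⟩).2
    exact hs'a (h2.symm.trans (h.symm.trans (h1.trans hsa)))
  · rw [hseg3, hc01]
    exact image_mono (Icc_subset_Icc (by linarith [hsE.1.1]) (by linarith [hs'E.1.2]))
  · rw [hseg3, disjoint_right]
    rintro _ ⟨t, ht, rfl⟩ htA
    exact hgap t ⟨by linarith [ht.1], by linarith [ht.2]⟩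
      ⟨⟨by linarith [ht.1, hsE.1.1], by linarith [ht.2, hs'E.1.2]⟩, htA⟩
  · rw [hseg1]
    rintro _ ⟨t, ht, rfl⟩
    exact (hεs t ⟨by linarith [ht.1], by linarith [ht.2]⟩).1
  · rw [hseg2]
    rintro _ ⟨t, ht, rfl⟩
    exact (hεs' t ⟨by linarith [ht.1], by linarith [ht.2]⟩).1
  · rw [hseg1, hseg3]
    rintro _ ⟨⟨t, ht, rfl⟩, r, hr, hrt⟩
    have := hcinj hrt
    exact congrArg c (by linarith [ht.2, hr.1])
  · rw [hseg2, hseg3]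
    rintro _ ⟨⟨t, ht, rfl⟩, r, hr, hrt⟩
    have := hcinj hrt
    exact congrArg c (by linarith [ht.1, hr.2])

/-! ### Loops, and complements of sets with legs -/

theorem injOn_trans_loop {x a : X} {p : Path x a} {q : Path a x} (hp : Function.Injective p)
    (hq : Function.Injective q)
    (hpq : ∀ s t, p s = q t → t = 0 ∨ t = 1) :
    InjOn (p.trans q) (Ico 0 1) := by
  have key : ∀ s t : unitInterval, s ∈ Ico (0 : unitInterval) 1 → t ∈ Ico (0 : unitInterval) 1 →
      (s : ℝ) ≤ 1 / 2 → ¬ (t : ℝ) ≤ 1 / 2 → (p.trans q) s ≠ (p.trans q) t := by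
    intro s t _ ht h1 h2 h
    rw [Path.trans_apply, Path.trans_apply, dif_pos h1, dif_neg h2] at h
    rcases hpq _ _ h with h3 | h3
    · have := congrArg Subtype.val h3
      simp only [Icc.coe_zero] at this
      exact h2 (by linarith)
    · have := congrArg Subtype.val h3
      simp only [Icc.coe_one] at this
      exact ht.2.ne (Subtype.ext (by rw [Icc.coe_one]; linarith))
  intro s hs t ht h
  by_cases h1 : (s : ℝ) ≤ 1 / 2 <;> by_cases h2 : (t : ℝ) ≤ 1 / 2
  · rw [Path.trans_apply, Path.trans_apply, dif_pos h1, dif_pos h2] at h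
    have := congrArg Subtype.val (hp h)
    simp only at this
    exact Subtype.ext (by linarith)
  · exact absurd h (key s t hs ht h1 h2)
  · exact absurd h.symm (key t s ht hs h2 h1)
  · rw [Path.trans_apply, Path.trans_apply, dif_neg h1, dif_neg h2] at h
    have := congrArg Subtype.val (hq h)
    simp only at this
    exact Subtype.ext (by linarith)

/-- The complement of a set `W`, which consists of legs that end in `x₀` and of a rest `R` along
which the two sides cannot be distinguished, is connected. -/
theorem isPreconnected_compl_of_legs [ChartedSpace ℂ X] [T2Space X] [PreconnectedSpace X]
    {κ : Type*} [Finite κ] {x₀ : X} {a : κ → X} {p : ∀ k, Path (a k) x₀}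
    (hp : ∀ k, FlatArc (p k)) (hdisj : ∀ k l, k ≠ l → range (p k) ∩ range (p l) ⊆ {x₀})
    {W : Set X} (hW : IsClosed W) (hWi : interior W = ∅) (hpW : ∀ k, range (p k) ⊆ W) (hx₀ : x₀ ∈ W)
    (hR : ∀ U V : Set X, IsOpen U → IsOpen V → Disjoint U V → U ∪ V = Wᶜ →
      ∀ z ∈ W, z ≠ x₀ → (∀ k, z ∉ range (p k)) → z ∉ closure U ∩ closure V) : IsPreconnected Wᶜ := by
  have hdense : Dense Wᶜ := interior_eq_empty_iff_dense_compl.1 hWi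
  refine isPreconnected_of_forall_disjoint_closure isPreconnected_univ hW.isOpen_compl
    (subset_univ _) (fun x _ => hdense x) ?_
  intro U V hU hV hUV hun
  have hZW : closure U ∩ closure V ⊆ W := by
    intro z hz
    by_contra h
    exact (disjoint_inter_closure hU hV hUV).le_bot ⟨hun.symm ▸ h, hz⟩
  have hcl : ∀ N : Set X, N ⊆ closure (U ∪ V) := fun N x _ => by rw [hun]; exact hdense x
  have hdisjW : ∀ R ⊆ W, Disjoint (U ∪ V) R := fun R hRW => by
    rw [hun]
    exact disjoint_compl_left.mono_right hRW
  -- Before `x₀`, a leg stays away from the other legs, and by `hR` the rest of `W` off the legs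
  -- contributes no common limit points; so one can walk along it.
  have hleg : ∀ k t, t ≠ 1 → p k t ∉ closure U ∩ closure V := by
    intro k
    refine (hp k).walkable U V hU hV hUV (hdisjW _ (hpW k)) fun t ht => ?_
    have hcl' : IsClosed (⋃ l ∈ {l | l ≠ k}, range (p l)) :=
      (toFinite _).isClosed_biUnion fun l _ => isClosed_range_path (p l)
    have hne : p k t ≠ x₀ := fun h => ht ((hp k).injective (h.trans (p k).target.symm))
    refine ⟨(⋃ l ∈ {l | l ≠ k}, range (p l))ᶜ ∩ {x₀}ᶜ, Filter.inter_mem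
      (hcl'.isOpen_compl.mem_nhds ?_) (isOpen_compl_singleton.mem_nhds hne), hcl _, ?_⟩
    · intro h
      simp only [mem_iUnion] at h
      obtain ⟨l, hl, h⟩ := h
      exact hne (hdisj l k hl ⟨h, mem_range_self t⟩)
    · rintro z ⟨⟨hz, hz0⟩, hzZ⟩
      by_contra hzk
      refine hR U V hU hV hUV hun z (hZW hzZ) hz0 (fun l hl => ?_) hzZ
      by_cases hlk : l = k
      · exact hzk (hlk ▸ hl)
      · exact hz (mem_biUnion (t := fun l => range (p l)) hlk hl)
  have hZx : closure U ∩ closure V ⊆ {x₀} := by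
    intro z hz
    by_contra hzx
    refine hR U V hU hV hUV hun z (hZW hz) hzx ?_ hz
    rintro k ⟨t, rfl⟩
    refine hleg k t ?_ hz
    rintro rfl
    exact hzx (p k).target
  rw [disjoint_right]
  intro z hz _
  obtain rfl : z = x₀ := hZx hz
  -- Only `x₀` is left, and a single common limit point is impossible because a punctured disc is
  -- connected.
  obtain ⟨D, -, hD, hxD, hpre⟩ := exists_isPreconnected_diff_singleton z Filter.univ_mem
  exact notMem_inter_closure hU hV hUV hD (hdisjW _ (singleton_subset_iff.2 hx₀)) hpre (hcl D)
    (disjoint_sdiff_left.mono_right hZx) hxD hz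

/-! ### Properly embedded lines and discs crossed by them -/

section ProperLines

variable {ι : Type*}

/-- Disjoint properly embedded open arcs, the two ends of each of which cannot be separated by a
compact set. -/
structure ProperLines (ℓ : ι → ℝ → X) : Prop where
  continuousOn : ∀ j, ContinuousOn (ℓ j) (Ioo 0 1)
  injOn : ∀ j, InjOn (ℓ j) (Ioo 0 1)
  disjoint : ∀ i j, i ≠ j → Disjoint (ℓ i '' Ioo 0 1) (ℓ j '' Ioo 0 1)
  proper : ∀ j (W : Set X), IsCompact W → ∃ δ > 0, ∀ s ∈ Ioo (0 : ℝ) 1, ∀ t ∈ Ioo (0 : ℝ) 1,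
    s < δ → 1 - δ < t → ∃ C ⊆ Wᶜ, IsPreconnected C ∧ ℓ j s ∈ C ∧ ℓ j t ∈ C

/-- A point near one end of the line is joined outside `W` to a point near the other end, and so is
itself outside `W`. The auxiliary parameter is taken with `min δ 1` to keep it in the unit interval.
-/
theorem ProperLines.exists_mem_Icc {ℓ : ι → ℝ → X} (hℓ : ProperLines ℓ) (j : ι) {W : Set X}
    (hW : IsCompact W) : ∃ δ > 0, ∀ s ∈ Ioo (0 : ℝ) 1, ℓ j s ∈ W → s ∈ Icc δ (1 - δ) := by
  obtain ⟨δ, hδ, h⟩ := hℓ.proper j W hW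
  have h1 : 0 < min δ 1 := lt_min hδ one_pos
  have h2 : min δ 1 ≤ 1 := min_le_right _ _
  have h3 : min δ 1 ≤ δ := min_le_left _ _
  refine ⟨δ, hδ, fun s hs hsW => ⟨?_, ?_⟩⟩
  · by_contra! hlt
    obtain ⟨C, hC, -, hs', -⟩ := h s hs (1 - min δ 1 / 2) ⟨by linarith, by linarith⟩ hlt (by linarith)
    exact hC hs' hsW
  · by_contra! hlt
    obtain ⟨C, hC, -, -, hs'⟩ := h (min δ 1 / 2) ⟨by linarith, by linarith⟩ s hs (by linarith) hlt
    exact hC hs' hsW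

/-- Inside a compact neighbourhood of a point, only a compact interval of parameters contributes,
and its part in `F` has closed image. -/
theorem ProperLines.isClosed_image [LocallyCompactSpace X] [T2Space X] {ℓ : ι → ℝ → X}
    (hℓ : ProperLines ℓ) (j : ι) {F : Set ℝ} (hF : IsClosed F) :
    IsClosed (ℓ j '' (Ioo 0 1 ∩ F)) := by
  rw [← closure_subset_iff_isClosed]
  intro x hx
  obtain ⟨W, hW, hxW⟩ := exists_compact_mem_nhds x
  obtain ⟨δ, hδ, h⟩ := hℓ.exists_mem_Icc j hW
  have hsub : Icc δ (1 - δ) ⊆ Ioo (0 : ℝ) 1 := fun s hs => ⟨by linarith [hs.1], by linarith [hs.2]⟩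
  have hcl : IsClosed (ℓ j '' (Icc δ (1 - δ) ∩ F)) :=
    ((isCompact_Icc.inter_right hF).image_of_continuousOn
      ((hℓ.continuousOn j).mono (inter_subset_left.trans hsub))).isClosed
  have hmem : x ∈ ℓ j '' (Icc δ (1 - δ) ∩ F) := by
    rw [← hcl.closure_eq]
    rw [mem_closure_iff_nhds] at hx ⊢
    intro N hN
    obtain ⟨_, ⟨hy, hyW⟩, s, ⟨hs, hsF⟩, rfl⟩ := hx (N ∩ W) (Filter.inter_mem hN hxW)
    exact ⟨ℓ j s, hy, s, ⟨h s hs hyW, hsF⟩, rfl⟩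
  exact image_mono (inter_subset_inter_left _ hsub) hmem

theorem ProperLines.isClosed_range [LocallyCompactSpace X] [T2Space X] {ℓ : ι → ℝ → X}
    (hℓ : ProperLines ℓ) (j : ι) : IsClosed (ℓ j '' Ioo 0 1) := by
  simpa using hℓ.isClosed_image j isClosed_univ

/-- A convex region `B` of the chart `e` which is crossed by the arc `J` of the line `ℓ j` and by no
other point of the lines; `G` is a set off `B` that closes up `J`. -/
structure CrossingDisc (ℓ : ι → ℝ → X) (j : ι) (e : OpenPartialHomeomorph X ℂ) (B J G : Set ℂ)
    (s₁ s₂ : ℝ) : Prop where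
  isOpen : IsOpen B
  convex : Convex ℝ B
  subset_target : B ⊆ e.target
  pos : 0 < s₁
  le : s₁ ≤ s₂
  lt_one : s₂ < 1
  mapsTo : ∀ s ∈ Icc s₁ s₂, ℓ j s ∈ e.source
  eq_image : J = (fun s => e (ℓ j s)) '' Icc s₁ s₂
  isClosed_arc : IsClosed J
  isClosed_closing : IsClosed G
  disjoint : Disjoint G B
  ends : ∀ s ∈ Icc s₁ s₂, e (ℓ j s) ∈ G → s = s₁ ∨ s = s₂
  avoid : ∀ i, ∀ s ∈ Ioo (0 : ℝ) 1, ℓ i s ∈ e.symm '' B → i = j ∧ s ∈ Ioo s₁ s₂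

theorem exists_crossing_chart [ChartedSpace ℂ X] {ℓ : ℝ → X} (hc : ContinuousOn ℓ (Ioo 0 1))
    (hi : InjOn ℓ (Ioo 0 1)) : ∃ (e : OpenPartialHomeomorph X ℂ) (s₁ s₂ t : ℝ) (G : Set ℂ),
      0 < s₁ ∧ s₂ < 1 ∧ t ∈ Ioo s₁ s₂ ∧ (∀ s ∈ Icc s₁ s₂, ℓ s ∈ e.source) ∧ IsClosed G ∧
      (∀ s ∈ Icc s₁ s₂, e (ℓ s) ∈ G → s = s₁ ∨ s = s₂) ∧ e (ℓ t) ∉ G ∧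
      ∀ N ∈ 𝓝 (e (ℓ t)), ∃ a ∈ N \ ((fun s => e (ℓ s)) '' Icc s₁ s₂ ∪ G),
        ∃ b ∈ N \ ((fun s => e (ℓ s)) '' Icc s₁ s₂ ∪ G),
          ¬ LogEquiv ((fun s => e (ℓ s)) '' Icc s₁ s₂ ∪ G) a b := by
  obtain ⟨e, r, hr, hx, -, htar⟩ := exists_disc_chart (ℓ (1 / 2)) Filter.univ_mem
  have hmem : Ioo (0 : ℝ) 1 ∈ 𝓝 (1 / 2 : ℝ) := isOpen_Ioo.mem_nhds ⟨by norm_num, by norm_num⟩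
  have hev : ∀ᶠ s in 𝓝 (1 / 2 : ℝ), s ∈ Ioo (0 : ℝ) 1 ∧ ℓ s ∈ e.source :=
    (Filter.eventually_mem_set.2 hmem).and
      ((hc.continuousAt hmem).eventually_mem (e.open_source.mem_nhds hx))
  obtain ⟨ρ, hρ, h⟩ := Metric.nhds_basis_closedBall.eventually_iff.1 hev
  rw [Real.closedBall_eq_Icc] at h
  have hsub : Icc (1 / 2 - ρ) (1 / 2 + ρ) ⊆ Ioo (0 : ℝ) 1 := fun s hs => (h hs).1
  have hsrc : MapsTo ℓ (Icc (1 / 2 - ρ) (1 / 2 + ρ)) e.source := fun s hs => (h hs).2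
  obtain ⟨t₁, t₂, t, ht₁, ht₂, ht, V, hV, hends, htV, hN⟩ := exists_crossing
    (f := fun s => e (ℓ s)) (convex_ball (e (ℓ (1 / 2))) r) Metric.isOpen_ball
    (show (1 / 2 : ℝ) - ρ < 1 / 2 + ρ by linarith)
    (e.continuousOn.comp (hc.mono hsub) hsrc)
    (fun s hs s' hs' hss => hi (hsub hs) (hsub hs') (e.injOn (hsrc hs) (hsrc hs') hss))
    (fun s hs => by
      rw [← htar]
      exact e.map_source (hsrc hs))
  have hlt : t₁ < t₂ := ht.1.trans ht.2
  refine ⟨e, t₁, t₂, t, V, (hsub ⟨ht₁, by linarith⟩).1, (hsub ⟨by linarith, ht₂⟩).2, ht,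
    fun s hs => hsrc ⟨ht₁.trans hs.1, hs.2.trans ht₂⟩, hV, hends, htV, hN⟩

/-- The disc is a small ball about the point of the line near which separated points abound. It is
shrunk until it avoids the closing set, the other lines and the rest of its own line, which are
closed; Hausdorff separation makes the finitely many discs disjoint. -/
theorem ProperLines.exists_crossingDisc [ChartedSpace ℂ X] [T2Space X] [Finite ι] {ℓ : ι → ℝ → X}
    (hℓ : ProperLines ℓ) : ∃ (e : ι → OpenPartialHomeomorph X ℂ) (B J G : ι → Set ℂ)
      (s₁ s₂ : ι → ℝ), (∀ j, CrossingDisc ℓ j (e j) (B j) (J j) (G j) (s₁ j) (s₂ j)) ∧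
      (∀ j, ∃ a ∈ B j \ J j, ∃ b ∈ B j \ J j, ¬ LogEquiv (J j ∪ G j) a b) ∧
      ∀ i j, i ≠ j → Disjoint ((e i).symm '' B i) ((e j).symm '' B j) := by
  have hlc : LocallyCompactSpace X := ChartedSpace.locallyCompactSpace ℂ X
  choose e s₁ s₂ t G hs₁ hs₂ ht hsrc hG hends htG hN using
    fun j => exists_crossing_chart (hℓ.continuousOn j) (hℓ.injOn j)
  have ht01 : ∀ j, t j ∈ Ioo (0 : ℝ) 1 := fun j => ⟨(hs₁ j).trans (ht j).1, (ht j).2.trans (hs₂ j)⟩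
  obtain ⟨M, hM, hMd⟩ := (finite_range fun j => ℓ j (t j)).t2_separation
  have hball : ∀ j, ∃ r > 0, Metric.ball (e j (ℓ j (t j))) r ⊆
      (e j).target ∩ ((e j).symm ⁻¹' (M (ℓ j (t j)) ∩ ((⋃ i ∈ {i | i ≠ j}, ℓ i '' Ioo 0 1)ᶜ ∩
        (ℓ j '' (Ioo 0 1 ∩ (Ioo (s₁ j) (s₂ j))ᶜ))ᶜ)) ∩ (G j)ᶜ) := by
    intro j
    have hxs : ℓ j (t j) ∈ (e j).source := hsrc j _ ⟨(ht j).1.le, (ht j).2.le⟩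
    refine Metric.mem_nhds_iff.1 (Filter.inter_mem ((e j).open_target.mem_nhds
      ((e j).map_source hxs)) (Filter.inter_mem (((e j).continuousAt_symm
        ((e j).map_source hxs)).preimage_mem_nhds ?_) ((hG j).isOpen_compl.mem_nhds (htG j))))
    rw [(e j).left_inv hxs]
    refine Filter.inter_mem ((hM _).2.mem_nhds (hM _).1) (Filter.inter_mem ?_ ?_)
    · refine ((toFinite _).isClosed_biUnion fun i _ => hℓ.isClosed_range i).isOpen_compl.mem_nhds ?_
      intro h
      simp only [mem_iUnion] at h
      obtain ⟨i, hi, h⟩ := h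
      exact (hℓ.disjoint i j hi).le_bot ⟨h, t j, ht01 j, rfl⟩
    · refine (hℓ.isClosed_image j isOpen_Ioo.isClosed_compl).isOpen_compl.mem_nhds ?_
      rintro ⟨s, ⟨hs, hs'⟩, hst⟩
      exact hs' (hℓ.injOn j hs (ht01 j) hst ▸ ht j)
  choose r hr hsub using hball
  refine ⟨e, fun j => Metric.ball (e j (ℓ j (t j))) (r j),
    fun j => (fun s => e j (ℓ j s)) '' Icc (s₁ j) (s₂ j), G, s₁, s₂, fun j => ?_, fun j => ?_, ?_⟩
  · refine ⟨Metric.isOpen_ball, convex_ball _ _, hsub j |>.trans inter_subset_left, hs₁ j,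
      ((ht j).1.trans (ht j).2).le, hs₂ j, hsrc j, rfl, ?_, hG j, ?_, hends j, ?_⟩
    · refine (isCompact_Icc.image_of_continuousOn ((e j).continuousOn.comp
        ((hℓ.continuousOn j).mono fun s hs => ?_) (hsrc j))).isClosed
      exact ⟨(hs₁ j).trans_le hs.1, hs.2.trans_lt (hs₂ j)⟩
    · exact disjoint_right.2 fun z hz => (hsub j hz).2.2
    · rintro i s hs ⟨z, hz, hzs⟩
      obtain ⟨-, ⟨-, h1, h2⟩, -⟩ := hsub j hz
      rw [hzs] at h1 h2
      have hij : i = j := by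
        by_contra hij
        exact h1 (mem_biUnion (t := fun i => ℓ i '' Ioo 0 1) hij ⟨s, hs, rfl⟩)
      subst hij
      refine ⟨rfl, ?_⟩
      by_contra h3
      exact h2 ⟨s, ⟨hs, h3⟩, rfl⟩
  · obtain ⟨a, ha, b, hb, hab⟩ := hN j _ (Metric.ball_mem_nhds _ (hr j))
    exact ⟨a, ⟨ha.1, fun h => ha.2 (Or.inl h)⟩, b, ⟨hb.1, fun h => hb.2 (Or.inl h)⟩, hab⟩
  · intro i j hij
    have hne : ℓ i (t i) ≠ ℓ j (t j) := fun h =>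
      (hℓ.disjoint i j hij).le_bot ⟨⟨t i, ht01 i, rfl⟩, t j, ht01 j, h.symm⟩
    refine (hMd (mem_range_self i) (mem_range_self j) hne).mono ?_ ?_
    · rintro _ ⟨z, hz, rfl⟩
      exact (hsub i hz).2.1.1
    · rintro _ ⟨z, hz, rfl⟩
      exact (hsub j hz).2.1.1

end ProperLines

/-! ### Both sides of a crossing segment agree -/

section CrossingDisc

variable {ι : Type*} {ℓ : ι → ℝ → X} {j : ι}
  {e : OpenPartialHomeomorph X ℂ} {B J G : Set ℂ} {s₁ s₂ : ℝ}

theorem CrossingDisc.symm_mem_iff (h : CrossingDisc ℓ j e B J G s₁ s₂) {z : ℂ} (hz : z ∈ B) :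
    e.symm z ∈ (⋃ i, ℓ i '' Ioo 0 1)ᶜ ↔ z ∉ J := by
  rw [mem_compl_iff, not_iff_not, mem_iUnion]
  constructor
  · rintro ⟨i, s, hs, hsz⟩
    obtain ⟨rfl, hs'⟩ := h.avoid i s hs ⟨z, hz, hsz.symm⟩
    rw [h.eq_image]
    exact ⟨s, ⟨hs'.1.le, hs'.2.le⟩, by simp only [hsz, e.right_inv (h.subset_target hz)]⟩
  · rw [h.eq_image]
    rintro ⟨s, hs, rfl⟩
    exact ⟨j, s, ⟨h.pos.trans_le hs.1, hs.2.trans_lt h.lt_one⟩, (e.left_inv (h.mapsTo s hs)).symm⟩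

theorem CrossingDisc.exists_gap (h : CrossingDisc ℓ j e B J G s₁ s₂) {Y : Set X} (hY : IsClosed Y)
    (hYS : Y ⊆ (⋃ i, ℓ i '' Ioo 0 1)ᶜ) {a b : ℂ} (ha : a ∈ B) (hb : b ∈ B) (haY : e.symm a ∈ Y)
    (hbY : e.symm b ∈ Y) (hne : ¬ LogEquiv (J ∪ G) a b) :
    ∃ q a' b' q', e.symm q ∈ Y ∧ e.symm q' ∈ Y ∧ a' ≠ q ∧ b' ≠ q' ∧ a' ≠ b' ∧
      ¬ LogEquiv (J ∪ G) a' b' ∧ segment ℝ a' b' ⊆ B ∧ Disjoint Y (e.symm '' segment ℝ a' b') ∧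
      segment ℝ a' q ⊆ B \ J ∧ segment ℝ b' q' ⊆ B \ J ∧
      segment ℝ a' q ∩ segment ℝ a' b' ⊆ {a'} ∧ segment ℝ b' q' ∩ segment ℝ a' b' ⊆ {b'} := by
  have hseg : segment ℝ a b ⊆ B := h.convex.segment_subset ha hb
  obtain ⟨q, a', b', q', h1, h2, h3, h4, h5, h6, h7, h8, h9⟩ := SurfaceCurves.exists_gap
    (K := J ∪ G) (M := B \ J) (A := e.symm ⁻¹' Y) (a := a) (b := b)
    (h.isClosed_arc.union h.isClosed_closing) (h.isOpen.sdiff h.isClosed_arc)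
    (disjoint_union_right.2 ⟨disjoint_sdiff_left, h.disjoint.symm.mono_left sdiff_subset⟩)
    (by
      rw [inter_comm]
      exact (e.continuousOn_symm.mono (hseg.trans h.subset_target)).preimage_isClosed_of_isClosed
        (isClosed_segment_complex a b) hY)
    (fun z hz => ⟨hseg hz.2, (h.symm_mem_iff (hseg hz.2)).1 (hYS hz.1)⟩) haY hbY hne
  refine ⟨q, a', b', q', h1, h2, h3, h4, h5, h6, h7.trans hseg, ?_, h9⟩
  rw [disjoint_right]
  rintro _ ⟨z, hz, rfl⟩ hzY
  exact h8.le_bot ⟨hzY, hz⟩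

theorem mem_closure_target_inter_preimage (e : OpenPartialHomeomorph X ℂ) {z : ℂ}
    (hz : z ∈ e.target) {U : Set X} (h : e.symm z ∈ closure U) :
    z ∈ closure (e.target ∩ e.symm ⁻¹' U) := by
  have h1 : z ∈ e.symm.source ∩ closure (e.symm ⁻¹' U) := by
    rw [← e.symm.preimage_closure]
    exact ⟨hz, h⟩
  exact e.open_target.inter_closure h1

/-- The two sides of a segment which crosses the line `ℓ j` are not separated by a compact set `W`
which meets the line only in this segment. -/
theorem CrossingDisc.notMem_inter_closure (hℓ : ProperLines ℓ)
    (h : CrossingDisc ℓ j e B J G s₁ s₂) {a b : ℂ} (hB : segment ℝ a b ⊆ B) (ha : a ∉ J)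
    (hb : b ∉ J) (hne : ¬ LogEquiv (J ∪ G) a b) {W : Set X} (hW : IsCompact W)
    (hWI : e.symm '' segment ℝ a b ⊆ W)
    (hWℓ : ∀ s ∈ Ioo (0 : ℝ) 1, ℓ j s ∈ W → ℓ j s ∈ e.symm '' segment ℝ a b)
    (hnear : ∀ i ∈ openSegment ℝ a b, ∃ N ∈ 𝓝 (e.symm i), N ∩ W ⊆ e.symm '' segment ℝ a b)
    {U V : Set X} (hU : IsOpen U) (hV : IsOpen V) (hUV : Disjoint U V) (hun : U ∪ V = Wᶜ) {i : ℂ}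
    (hi : i ∈ openSegment ℝ a b) : e.symm i ∉ closure U ∩ closure V := by
  have htar : segment ℝ a b ⊆ e.target := hB.trans h.subset_target
  have hGI : Disjoint G (segment ℝ a b) := h.disjoint.mono_right hB
  have hnot : ∀ {z}, z ∈ segment ℝ a b → e.symm z ∉ U ∪ V := fun hz hzU => by
    rw [hun] at hzU
    exact hzU (hWI ⟨_, hz, rfl⟩)
  have hmemI : ∀ {z}, z ∈ e.target → e.symm z ∈ e.symm '' segment ℝ a b → z ∈ segment ℝ a b := by
    rintro z hz ⟨w, hw, hwz⟩
    rwa [← e.symm.injOn (htar hw) hz hwz]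
  have hJpt : ∀ z ∈ J, z ∈ e.target ∧ ∃ s ∈ Icc s₁ s₂, z = e (ℓ j s) ∧ e.symm z = ℓ j s := by
    intro z hz
    rw [h.eq_image] at hz
    obtain ⟨s, hs, rfl⟩ := hz
    exact ⟨e.map_source (h.mapsTo s hs), s, hs, rfl, e.left_inv (h.mapsTo s hs)⟩
  have hIcc : ∀ s ∈ Icc s₁ s₂, s ∈ Ioo (0 : ℝ) 1 := fun s hs =>
    ⟨h.pos.trans_le hs.1, hs.2.trans_lt h.lt_one⟩
  have htail : ∀ s ∈ Ioo (0 : ℝ) 1, s ∉ Ioo s₁ s₂ → ℓ j s ∈ U ∪ V := by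
    intro s hs hs'
    rw [hun]
    exact fun hsW => hs' (h.avoid j s hs (image_mono hB (hWℓ s hs hsW))).2
  -- The detour: the two tails of the line, joined near its ends by a connected set outside `W`. It
  -- is connected and misses `W`, so both end points of `J` lie in the same one of `U` and `V`.
  obtain ⟨T, hT, hTUV, hT₁, hT₂⟩ : ∃ T, IsPreconnected T ∧ T ⊆ U ∪ V ∧ ℓ j s₁ ∈ T ∧ ℓ j s₂ ∈ T := by
    obtain ⟨δ, hδ, hprop⟩ := hℓ.proper j W hW
    have hpos := h.pos
    have hle := h.le
    have hlt := h.lt_one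
    have hs0 : 0 < min (δ / 2) s₁ := lt_min (by linarith) hpos
    have hs1 : min (δ / 2) s₁ ≤ s₁ := min_le_right _ _
    have hs2 : min (δ / 2) s₁ ≤ δ / 2 := min_le_left _ _
    have ht0 : max (1 - δ / 2) s₂ < 1 := max_lt (by linarith) hlt
    have ht1 : s₂ ≤ max (1 - δ / 2) s₂ := le_max_right _ _
    have ht2 : 1 - δ / 2 ≤ max (1 - δ / 2) s₂ := le_max_left _ _
    obtain ⟨C, hC, hCp, hsC, htC⟩ := hprop (min (δ / 2) s₁) ⟨hs0, by linarith⟩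
      (max (1 - δ / 2) s₂) ⟨by linarith, ht0⟩ (by linarith) (by linarith)
    have hp₁ : IsPreconnected (ℓ j '' Ioc 0 s₁) := isPreconnected_Ioc.image _
      ((hℓ.continuousOn j).mono fun s hs => ⟨hs.1, by linarith [hs.2]⟩)
    have hp₂ : IsPreconnected (ℓ j '' Ico s₂ 1) := isPreconnected_Ico.image _
      ((hℓ.continuousOn j).mono fun s hs => ⟨by linarith [hs.1], hs.2⟩)
    have hp₃ := IsPreconnected.union (s := ℓ j '' Ioc 0 s₁) (t := C) _ ⟨_, ⟨hs0, hs1⟩, rfl⟩ hsC hp₁ hCp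
    have hp₄ := IsPreconnected.union (s := ℓ j '' Ioc 0 s₁ ∪ C) (t := ℓ j '' Ico s₂ 1) _
      (Or.inr htC) ⟨_, ⟨ht1, ht0⟩, rfl⟩ hp₃ hp₂
    refine ⟨_, hp₄, union_subset (union_subset ?_ (hun ▸ hC)) ?_, Or.inl (Or.inl ⟨s₁, ⟨hpos, le_rfl⟩, rfl⟩),
      Or.inr ⟨s₂, ⟨le_rfl, hlt⟩, rfl⟩⟩
    · rintro _ ⟨s, hs, rfl⟩
      exact htail s ⟨hs.1, by linarith [hs.2]⟩ fun h => h.1.not_ge hs.2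
    · rintro _ ⟨s, hs, rfl⟩
      exact htail s ⟨by linarith [hs.1], hs.2⟩ fun h => h.2.not_ge hs.1
  have hends : ∀ {D : Set X}, T ⊆ D → J ∩ G ⊆ e.target ∩ e.symm ⁻¹' D := by
    rintro D hD z ⟨hzJ, hzG⟩
    obtain ⟨hzt, s, hs, rfl, hzs⟩ := hJpt z hzJ
    refine ⟨hzt, ?_⟩
    rw [mem_preimage, hzs]
    rcases h.ends s hs hzG with rfl | rfl
    · exact hD hT₁
    · exact hD hT₂
  -- In the chart, `J ∩ G` consists at most of the end points of `J`, so by the detour it lies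
  -- entirely in `P` or entirely in `Q`, as the planar statement demands.
  have key := notMem_inter_closure_of_not_logEquiv (P := e.target ∩ e.symm ⁻¹' U)
    (Q := e.target ∩ e.symm ⁻¹' V) h.isClosed_arc h.isClosed_closing
    (e.symm.isOpen_inter_preimage hU) (e.symm.isOpen_inter_preimage hV)
    (disjoint_left.2 fun z hz hz' => hUV.le_bot ⟨hz.2, hz'.2⟩)
    (a := a) (b := b)
    (fun ha' => ha'.elim ha fun ha' => hGI.le_bot ⟨ha', left_mem_segment _ _ _⟩)
    (fun hb' => hb'.elim hb fun hb' => hGI.le_bot ⟨hb', right_mem_segment _ _ _⟩) hGI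
    (disjoint_left.2 fun z hz hz' => hnot hz' (Or.inl hz.2))
    (disjoint_left.2 fun z hz hz' => hnot hz' (Or.inr hz.2)) ?_ ?_ ?_ hne hi
  · have hit : i ∈ e.target := htar (openSegment_subset_segment ℝ a b hi)
    exact fun hc => key ⟨mem_closure_target_inter_preimage e hit hc.1,
      mem_closure_target_inter_preimage e hit hc.2⟩
  · intro z hz
    obtain ⟨hzt, s, hs, -, hzs⟩ := hJpt z hz
    by_cases hsW : ℓ j s ∈ W
    · right
      refine hmemI hzt ?_
      rw [hzs]
      exact hWℓ s (hIcc s hs) hsW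
    · left
      have : e.symm z ∈ U ∪ V := by
        rw [hun, hzs]
        exact hsW
      exact this.imp (fun h => ⟨hzt, h⟩) fun h => ⟨hzt, h⟩
  · exact (hT.subset_or_subset hU hV hUV hTUV).imp (fun h => hends h) fun h => hends h
  · intro i hi
    obtain ⟨N, hN, hNW⟩ := hnear i hi
    have hit : i ∈ e.target := htar (openSegment_subset_segment ℝ a b hi)
    refine ⟨e.target ∩ e.symm ⁻¹' N, Filter.inter_mem (e.open_target.mem_nhds hit)
      ((e.continuousAt_symm hit).preimage_mem_nhds hN), ?_⟩
    rintro z ⟨⟨hzt, hzN⟩, hzI⟩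
    have : e.symm z ∈ U ∪ V := by
      rw [hun]
      exact fun hzW => hzI (hmemI hzt (hNW ⟨hzN, hzW⟩))
    exact this.imp (fun h => ⟨hzt, h⟩) fun h => ⟨hzt, h⟩

end CrossingDisc

/-! ### Assembly of the loops -/

theorem exists_compact_connected_superset [LocallyPathConnectedSpace X] {S : Set X}
    (hS : IsOpen S) (hSc : IsConnected S) {κ : Type*} [Finite κ] {f : κ → X} (hf : ∀ k, f k ∈ S)
    {x₀ : X} (hx₀ : x₀ ∈ S) :
    ∃ Y ⊆ S, IsCompact Y ∧ IsPreconnected Y ∧ x₀ ∈ Y ∧ ∀ k, f k ∈ Y := by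
  have hpc : IsPathConnected S := hS.isConnected_iff_isPathConnected.1 hSc
  choose p hp using fun k => hpc.joinedIn x₀ hx₀ (f k) (hf k)
  refine ⟨{x₀} ∪ ⋃ k, range (p k), ?_, isCompact_singleton.union
    (isCompact_iUnion fun k => isCompact_range (p k).continuous), ?_, Or.inl rfl, fun k =>
      Or.inr (mem_iUnion.2 ⟨k, (p k).target_mem_range⟩)⟩
  · refine union_subset (singleton_subset_iff.2 hx₀) (iUnion_subset fun k => ?_)
    rintro _ ⟨t, rfl⟩
    exact hp k t
  · refine isPreconnected_of_forall x₀ ?_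
    rintro y (rfl | hy)
    · exact ⟨{y}, subset_union_left, rfl, rfl, isPreconnected_singleton⟩
    · obtain ⟨k, hk⟩ := mem_iUnion.1 hy
      exact ⟨range (p k), (subset_iUnion (fun k => range (p k)) k).trans subset_union_right,
        (p k).source_mem_range, hk, isPreconnected_range (p k).continuous⟩

theorem exists_simpleClosedCurve {x₀ a b : X} {p₀ : Path a x₀} {p₁ : Path b x₀} {I : Path a b}
    (hp₀ : Function.Injective p₀) (hp₁ : Function.Injective p₁) (hI : Function.Injective I)
    (h₀ : ∀ t, t ≠ 0 → p₀ t ∉ range I) (h₁ : ∀ t, t ≠ 0 → p₁ t ∉ range I)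
    (h₀₁ : range p₀ ∩ range p₁ ⊆ {x₀}) :
    ∃ γ : C(unitInterval, X), IsSimpleClosedCurve γ ∧
      range γ = range p₀ ∪ (range I ∪ range p₁) := by
  have hinj : Function.Injective (I.trans p₁) := by
    refine injective_trans hI hp₁ fun s hs => ?_
    rintro ⟨t, ht⟩
    by_cases ht0 : t = 0
    · rw [ht0, p₁.source] at ht
      exact hs (hI (ht.symm.trans I.target.symm))
    · exact h₁ t ht0 ⟨s, ht.symm⟩
  have hinj' : Function.Injective p₀.symm := by
    intro s t h
    rw [Path.symm_apply, Path.symm_apply] at h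
    exact unitInterval.symm_bijective.1 (hp₀ h)
  refine ⟨(p₀.symm.trans (I.trans p₁)).toContinuousMap, ⟨?_, ?_⟩, ?_⟩
  · exact (Path.source _).trans (Path.target _).symm
  · refine injOn_trans_loop hinj' hinj fun s t hst => ?_
    have hmem : (I.trans p₁) t ∈ range I ∪ range p₁ := by
      rw [← Path.trans_range]; exact mem_range_self t
    rcases hmem with h | h
    · left
      rw [← hst, Path.symm_apply, Function.comp_apply] at h
      have h2 : unitInterval.symm s = 0 := by
        by_contra h2
        exact h₀ _ h2 h
      rw [Path.symm_apply, Function.comp_apply, h2, p₀.source] at hst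
      exact hinj (hst.symm.trans (Path.source _).symm)
    · right
      have h2 : (I.trans p₁) t = x₀ := h₀₁ ⟨⟨_, hst⟩, h⟩
      exact hinj (h2.trans (Path.target _).symm)
  · change range (p₀.symm.trans (I.trans p₁)) = _
    rw [Path.trans_range, Path.trans_range, Path.symm_range]

/-- If disjoint properly embedded arcs, whose ends cannot be separated by compact sets, have
connected complement, then there is a non-separating bouquet of as many simple closed curves. -/
theorem ProperLines.exists_isNonSeparating [ChartedSpace ℂ X] [T2Space X] [ConnectedSpace X]
    {ι : Type*} [Finite ι] {ℓ : ι → ℝ → X} (hℓ : ProperLines ℓ)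
    (hS : IsConnected (⋃ i, ℓ i '' Ioo 0 1)ᶜ) :
    ∃ (x : X) (γ : ι → C(unitInterval, X)), (∀ i, IsSimpleClosedCurve (γ i)) ∧
      (∀ i, x ∈ range (γ i)) ∧ (∀ i j, i ≠ j → range (γ i) ∩ range (γ j) = {x}) ∧
      IsNonSeparating γ := by
  have hlc : LocallyCompactSpace X := ChartedSpace.locallyCompactSpace ℂ X
  have hlp : LocallyPathConnectedSpace X := ChartedSpace.locallyPathConnectedSpace ℂ X
  have hlcs : LocallyConnectedSpace X := ChartedSpace.locallyConnectedSpace ℂ X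
  have hft : Fintype ι := Fintype.ofFinite ι
  set S : Set X := (⋃ i, ℓ i '' Ioo 0 1)ᶜ with hSdef
  have hSo : IsOpen S := (isClosed_iUnion_of_finite fun i => hℓ.isClosed_range i).isOpen_compl
  obtain ⟨x₀, hx₀S⟩ := hS.nonempty
  obtain ⟨e, B, J, G, s₁, s₂, hD, hab, hBd⟩ := hℓ.exists_crossingDisc
  choose a₁ ha₁ b₁ hb₁ hne₁ using hab
  -- The connectedness of `S` enters here: a compact connected set off the lines contains `x₀` and
  -- both separated points of every disc.
  obtain ⟨Y, hYS, hYc, hYp, hx₀Y, hYf⟩ := exists_compact_connected_superset hSo hS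
    (f := fun k : ι × Bool => (e k.1).symm (bif k.2 then b₁ k.1 else a₁ k.1)) (x₀ := x₀) (by
      rintro ⟨j, β⟩
      cases β
      · exact ((hD j).symm_mem_iff (ha₁ j).1).2 (ha₁ j).2
      · exact ((hD j).symm_mem_iff (hb₁ j).1).2 (hb₁ j).2) hx₀S
  -- The crossing segment is a gap of `Y`. It can thus be removed without disconnecting `Y`, while
  -- its end points are joined to `Y` by short segments off the line.
  choose q a b q' hqY hq'Y haq hbq hab hne hsegB hYI hsa hsb hta htb using fun j =>
    (hD j).exists_gap hYc.isClosed hYS (ha₁ j).1 (hb₁ j).1 (hYf (j, false)) (hYf (j, true)) (hne₁ j)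
  have htar : ∀ j, segment ℝ (a j) (b j) ⊆ (e j).target := fun j =>
    (hsegB j).trans (hD j).subset_target
  set I : ∀ j, Path ((e j).symm (a j)) ((e j).symm (b j)) := fun j =>
    chartSegment (e j) (a j) (b j) (htar j) with hI
  have hIr : ∀ j, range (I j) = (e j).symm '' segment ℝ (a j) (b j) := fun j =>
    range_chartSegment (e j) (htar j)
  have hIinj : ∀ j, Function.Injective (I j) := fun j =>
    injective_chartSegment (e j) (htar j) (hab j)
  have hIB : ∀ j, range (I j) ⊆ (e j).symm '' B j := fun j => by
    rw [hIr]; exact image_mono (hsegB j)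
  have hII : ∀ i j, i ≠ j → Disjoint (range (I i)) (range (I j)) := fun i j hij =>
    (hBd i j hij).mono (hIB i) (hIB j)
  have hIc : ∀ j, IsClosed (range (I j)) := fun j => isClosed_range_path _
  set F : Set X := S \ ⋃ j, range (I j) with hF
  have hFo : IsOpen F := hSo.sdiff (isClosed_iUnion_of_finite hIc)
  -- All legs are to run in this region off the lines and off the crossing segments. It contains
  -- `Y`, and therefore every end of a crossing segment is accessible from it.
  set O := connectedComponentIn F x₀ with hO
  have hYF : Y ⊆ F := fun y hy => ⟨hYS hy, fun h => by
    obtain ⟨j, hj⟩ := mem_iUnion.1 h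
    rw [hIr] at hj
    exact (hYI j).le_bot ⟨hy, hj⟩⟩
  have hYO : Y ⊆ O := hYp.subset_connectedComponentIn hx₀Y hYF
  have hOF : O ⊆ F := connectedComponentIn_subset _ _
  have hOI : ∀ x ∈ O, ∀ j, x ∉ range (I j) := fun x hx j hj => (hOF hx).2 (mem_iUnion.2 ⟨j, hj⟩)
  set z : ι × Bool → ℂ := fun k => bif k.2 then b k.1 else a k.1 with hz
  set w : ι × Bool → ℂ := fun k => bif k.2 then q' k.1 else q k.1 with hw
  have hzw : ∀ k, z k ≠ w k := by rintro ⟨j, β⟩; cases β; exacts [haq j, hbq j]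
  have hzI : ∀ k, z k ∈ segment ℝ (a k.1) (b k.1) := by
    rintro ⟨j, β⟩
    cases β
    exacts [left_mem_segment _ _ _, right_mem_segment _ _ _]
  have hwY : ∀ k, (e k.1).symm (w k) ∈ Y := by rintro ⟨j, β⟩; cases β; exacts [hqY j, hq'Y j]
  have hsz : ∀ k, segment ℝ (z k) (w k) ⊆ B k.1 \ J k.1 := by
    rintro ⟨j, β⟩; cases β; exacts [hsa j, hsb j]
  have htz : ∀ k, segment ℝ (z k) (w k) ∩ segment ℝ (a k.1) (b k.1) ⊆ {z k} := by
    rintro ⟨j, β⟩; cases β; exacts [hta j, htb j]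
  set A : ι × Bool → X := fun k => (e k.1).symm (z k) with hA
  have hAI : ∀ k, A k ∈ range (I k.1) := fun k => by rw [hIr]; exact ⟨_, hzI k, rfl⟩
  have hAS : ∀ k, A k ∈ S := fun k =>
    ((hD k.1).symm_mem_iff (hsegB _ (hzI k))).2 (hsz k (left_mem_segment _ _ _)).2
  have hAinj : Function.Injective A := by
    rintro ⟨i, β⟩ ⟨j, β'⟩ h
    obtain rfl : i = j := by
      by_contra hij
      exact (hII i j hij).le_bot ⟨hAI (i, β), by rw [h]; exact hAI (j, β')⟩
    have h1 : z (i, β) = z (i, β') :=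
      (e i).symm.injOn (htar i (hzI (i, β))) (htar i (hzI (i, β'))) h
    cases β <;> cases β'
    · rfl
    · exact absurd h1 (hab i)
    · exact absurd h1.symm (hab i)
    · rfl
  have hport : ∀ k, ∃ (e' : OpenPartialHomeomorph X ℂ) (z' w' : ℂ), z' ≠ w' ∧
      segment ℝ z' w' ⊆ e'.target ∧ e'.symm z' = A k ∧
      ∀ q ∈ segment ℝ z' w', q ≠ z' → e'.symm q ∈ O := by
    intro k
    have htk : segment ℝ (z k) (w k) ⊆ (e k.1).target :=
      (hsz k).trans (sdiff_subset.trans (hD k.1).subset_target)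
    refine ⟨e k.1, z k, w k, hzw k, htk, rfl, ?_⟩
    have h1 := forall_mem_connectedComponentIn (F := F) htk (hzw k) ?_
    · rwa [← connectedComponentIn_eq (hYO (hwY k))] at h1
    · intro q hq hqz
      refine ⟨((hD k.1).symm_mem_iff (hsz k hq).1).2 (hsz k hq).2, fun h => ?_⟩
      obtain ⟨j, hj⟩ := mem_iUnion.1 h
      by_cases hjk : j = k.1
      · subst hjk
        rw [hIr] at hj
        obtain ⟨r, hr, hrq⟩ := hj
        have := (e k.1).symm.injOn (htar k.1 hr) (htk hq) hrq
        exact hqz (htz k ⟨hq, this ▸ hr⟩)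
      · exact (hBd j k.1 hjk).le_bot ⟨hIB j hj, q, (hsz k hq).1, rfl⟩
  obtain ⟨p, hp, hpO, hpd⟩ := exists_legs hFo.connectedComponentIn
    isPreconnected_connectedComponentIn (hYO hx₀Y) hAinj (fun k hk => hOI _ hk k.1 (hAI k)) hport
  have hpI : ∀ k j t, t ≠ 0 → p k t ∉ range (I j) := fun k j t ht => hOI _ (hpO k t ht) j
  have hpI' : ∀ k j t, p k t ∈ range (I j) → j = k.1 ∧ p k t = A k := by
    intro k j t h
    by_cases ht : t = 0
    · rw [ht, (p k).source] at h ⊢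
      refine ⟨?_, rfl⟩
      by_contra hjk
      exact (hII j k.1 hjk).le_bot ⟨h, hAI k⟩
    · exact absurd h (hpI k j t ht)
  have hpS : ∀ k t, p k t ∈ S := by
    intro k t
    by_cases ht : t = 0
    · rw [ht, (p k).source]
      exact hAS k
    · exact (hOF (hpO k t ht)).1
  have hx₀I : ∀ j, x₀ ∉ range (I j) := hOI _ (hYO hx₀Y)
  choose γ hγ hγr using fun j => exists_simpleClosedCurve (p₀ := p (j, false)) (p₁ := p (j, true))
    (I := I j) (hp _).injective (hp _).injective (hIinj j) (hpI (j, false) j) (hpI (j, true) j)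
    (hpd (j, false) (j, true) (by simp))
  have hγx : ∀ j, x₀ ∈ range (γ j) := fun j => by
    rw [hγr]; exact Or.inl (p (j, false)).target_mem_range
  have hγmem : ∀ j x, x ∈ range (γ j) ↔ (∃ β, x ∈ range (p (j, β))) ∨ x ∈ range (I j) := by
    intro j x
    rw [hγr, Bool.exists_bool]
    simp only [mem_union]
    tauto
  set W : Set X := ⋃ j, range (γ j) with hW
  have hWmem : ∀ x, x ∈ W ↔ (∃ k, x ∈ range (p k)) ∨ ∃ j, x ∈ range (I j) := by
    intro x
    simp only [hW, mem_iUnion, hγmem, exists_or, Prod.exists]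
  have hWc : IsCompact W := isCompact_iUnion fun j => isCompact_range (γ j).continuous
  refine ⟨x₀, γ, hγ, hγx, ?_, ?_⟩
  · intro i j hij
    refine Subset.antisymm ?_ (singleton_subset_iff.2 ⟨hγx i, hγx j⟩)
    rintro x ⟨hxi, hxj⟩
    rw [hγmem] at hxi hxj
    rcases hxi with ⟨β, t, rfl⟩ | hxi <;> rcases hxj with ⟨β', hxj⟩ | hxj
    · exact hpd (i, β) (j, β') (by simp [hij]) ⟨mem_range_self t, hxj⟩
    · exact absurd (hpI' _ _ _ hxj).1.symm hij
    · obtain ⟨t, rfl⟩ := hxj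
      exact absurd (hpI' _ _ _ hxi).1 hij
    · exact ((hII i j hij).le_bot ⟨hxi, hxj⟩).elim
  · have hWi : interior W = ∅ := by
      have hWu : W = (⋃ k ∈ (Finset.univ : Finset (ι × Bool)), range (p k)) ∪
          ⋃ j ∈ (Finset.univ : Finset ι), range (I j) := by
        ext x
        rw [hWmem]
        simp only [Finset.mem_univ, iUnion_true, mem_union, mem_iUnion]
      rw [hWu, interior_union_isClosed_of_interior_empty
        (isClosed_biUnion_finset fun k _ => isClosed_range_path (p k))
        (interior_biUnion_finset_eq_empty _ (fun j _ => hIc j)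
          fun j _ => interior_range_path_eq_empty (hIinj j))]
      exact interior_biUnion_finset_eq_empty _ (fun k _ => isClosed_range_path (p k))
        fun k _ => interior_range_path_eq_empty (hp k).injective
    have hpre : IsPreconnected Wᶜ := by
      rcases isEmpty_or_nonempty ι with hι | ⟨⟨j₀⟩⟩
      · have : W = ∅ := by rw [hW, iUnion_of_empty]
        rw [this, compl_empty]
        exact isPreconnected_univ
      refine isPreconnected_compl_of_legs hp hpd hWc.isClosed hWi
        (fun k x hx => (hWmem x).2 (Or.inl ⟨k, hx⟩)) ((hWmem x₀).2 (Or.inl ⟨(j₀, false),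
          (p _).target_mem_range⟩)) ?_
      intro U V hU hV hUV hun x hxW hxx hxp
      obtain ⟨j, hj⟩ := ((hWmem x).1 hxW).resolve_left fun ⟨k, hk⟩ => hxp k hk
      rw [hIr] at hj
      obtain ⟨i, hi, rfl⟩ := hj
      have hio : i ∈ openSegment ℝ (a j) (b j) := by
        refine mem_openSegment_of_ne_left_right ?_ ?_ hi
        · rintro rfl
          exact hxp (j, false) (p (j, false)).source_mem_range
        · rintro rfl
          exact hxp (j, true) (p (j, true)).source_mem_range
      -- Applicable because the legs stay in `S` and the other crossing segments lie in other discs: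
      -- `W` meets the line `ℓ j` only in its own crossing segment.
      refine (hD j).notMem_inter_closure hℓ (hsegB j) (hsa j (left_mem_segment _ _ _)).2
        (hsb j (left_mem_segment _ _ _)).2 (hne j) hWc ?_ ?_ ?_ hU hV hUV hun hio
      · rw [← hIr]
        exact fun x hx => (hWmem x).2 (Or.inr ⟨j, hx⟩)
      · intro s hs hsW
        rcases (hWmem _).1 hsW with ⟨k, t, ht⟩ | ⟨i, hi⟩
        · exact (hpS k t (mem_iUnion.2 ⟨j, s, hs, ht.symm⟩)).elim
        · obtain rfl := ((hD i).avoid j s hs (hIB i hi)).1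
          rwa [hIr] at hi
      · intro r hr
        have hrs := openSegment_subset_segment ℝ _ _ hr
        have hrI : (e j).symm r ∈ range (I j) := by rw [hIr]; exact ⟨r, hrs, rfl⟩
        refine ⟨(⋃ k, range (p k))ᶜ ∩ (⋃ i ∈ {i | i ≠ j}, range (I i))ᶜ, Filter.inter_mem
          ((isClosed_iUnion_of_finite fun k => isClosed_range_path (p k)).isOpen_compl.mem_nhds ?_)
          (((toFinite _).isClosed_biUnion fun i _ => hIc i).isOpen_compl.mem_nhds ?_), ?_⟩
        · intro h
          obtain ⟨⟨i, β⟩, t, ht⟩ := mem_iUnion.1 h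
          obtain ⟨hji, h2⟩ := hpI' (i, β) j t (ht ▸ hrI)
          obtain rfl : j = i := hji
          have h3 : r = z (j, β) := (e j).symm.injOn (htar j hrs) (htar j (hzI (j, β)))
            (ht.symm.trans h2)
          rw [h3] at hr
          cases β
          · exact hab j ((left_mem_openSegment_iff (𝕜 := ℝ)).1 hr)
          · exact hab j ((right_mem_openSegment_iff (𝕜 := ℝ)).1 hr)
        · intro h
          simp only [mem_iUnion] at h
          obtain ⟨i, hi, h⟩ := h
          exact (hII i j hi).le_bot ⟨h, hrI⟩
        · rintro y ⟨⟨hy, hy'⟩, hyW⟩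
          rw [← hIr]
          rcases (hWmem y).1 hyW with ⟨k, hk⟩ | ⟨i, hi⟩
          · exact absurd (mem_iUnion.2 ⟨k, hk⟩) hy
          · by_cases hij : i = j
            · rwa [hij] at hi
            · exact absurd (mem_biUnion (t := fun i => range (I i)) hij hi) hy'
    rw [IsNonSeparating, ← compl_eq_univ_sdiff]
    refine ⟨?_, hpre⟩
    exact (interior_eq_empty_iff_dense_compl.1 hWi).nonempty

end SurfaceCurves

/-! ### From the completion to the surface -/

namespace TranslationSurface

variable {X : Type*} [TopologicalSpace X] [ChartedSpace Plane X] [TranslationSurface X]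

/-- The complement in `X` of a closed set of the completion is connected if its complement in the
completion is. -/
theorem isConnected_preimage_toCompletion {F : Set (MetricCompletion X)} (hF : IsOpen F)
    (hc : IsConnected F) : IsConnected ((toCompletion : X → MetricCompletion X) ⁻¹' F) := by
  have hd := denseRange_toCompletion (X := X)
  refine ⟨hd.exists_mem_open hF hc.nonempty, ?_⟩
  rw [isPreconnected_iff_subset_of_disjoint]
  intro U V hU hV hUV hdisj
  set S := (toCompletion : X → MetricCompletion X) ⁻¹' F with hS
  -- `L U` consists of the points of the completion near which all points of `X` belong to `U`. A
  -- splitting of `S` by `U` and `V` becomes one of `F` by `L U` and `L V`: they cover `F` because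
  -- nearby points of `X` are joined inside `S`, and are disjoint on `F` because `X` is dense.
  set L : Set X → Set (MetricCompletion X) :=
    fun U => {τ | ∀ᶠ τ' in 𝓝 τ, ∀ x : X, toCompletion x = τ' → x ∈ U} with hL
  have hLo : ∀ U, IsOpen (L U) := fun U => isOpen_setOfPred_eventually_nhds
  have hLS : ∀ U, F ⊆ L U → S ⊆ U := fun U h x hx => (h hx).self_of_nhds x rfl
  have hcov : F ⊆ L U ∪ L V := by
    intro τ hτ
    obtain ⟨N, hN, hj⟩ := exists_nhds_joinedIn τ (hF.mem_nhds hτ)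
    obtain ⟨M, hMN, hM, hτM⟩ := mem_nhds_iff.1 hN
    obtain ⟨x, hx⟩ := hd.exists_mem_open hM ⟨τ, hτM⟩
    have hside : ∀ y, toCompletion y ∈ N → ∃ T : Set X, IsPreconnected T ∧ T ⊆ S ∧ x ∈ T ∧ y ∈ T := by
      intro y hy
      have h := hj x y (hMN hx) hy
      refine ⟨range h.somePath, isPreconnected_range h.somePath.continuous, ?_,
        h.somePath.source_mem_range, h.somePath.target_mem_range⟩
      rintro _ ⟨t, rfl⟩
      exact h.somePath_mem t
    have hxS : x ∈ S := by
      obtain ⟨T, -, hT, hxT, -⟩ := hside x (hMN hx)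
      exact hT hxT
    have hgo : ∀ y, toCompletion y ∈ N → (x ∈ U → y ∈ U) ∧ (x ∈ V → y ∈ V) := by
      intro y hy
      obtain ⟨T, hTp, hT, hxT, hyT⟩ := hside y hy
      have hem : T ∩ (U ∩ V) = ∅ :=
        subset_empty_iff.1 ((inter_subset_inter_left _ hT).trans hdisj.subset)
      rcases isPreconnected_iff_subset_of_disjoint.1 hTp U V hU hV (hT.trans hUV) hem with h | h
      · refine ⟨fun _ => h hyT, fun hxV => ?_⟩
        exact absurd ⟨hxT, h hxT, hxV⟩ (eq_empty_iff_forall_notMem.1 hem x)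
      · refine ⟨fun hxU => ?_, fun _ => h hyT⟩
        exact absurd ⟨hxT, hxU, h hxT⟩ (eq_empty_iff_forall_notMem.1 hem x)
    refine (hUV hxS).imp (fun h => ?_) fun h => ?_
    · filter_upwards [hN] with τ' hτ' y hy
      exact (hgo y (hy ▸ hτ')).1 h
    · filter_upwards [hN] with τ' hτ' y hy
      exact (hgo y (hy ▸ hτ')).2 h
  have hLd : F ∩ (L U ∩ L V) = ∅ := by
    rw [eq_empty_iff_forall_notMem]
    rintro τ ⟨hτ, h1, h2⟩
    obtain ⟨M, hM, hMo, hτM⟩ := mem_nhds_iff.1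
      (Filter.inter_mem (hF.mem_nhds hτ) (Filter.inter_mem h1 h2))
    obtain ⟨x, hx⟩ := hd.exists_mem_open hMo ⟨τ, hτM⟩
    obtain ⟨hxF, hxU, hxV⟩ := hM hx
    exact eq_empty_iff_forall_notMem.1 hdisj x ⟨hxF, hxU x rfl, hxV x rfl⟩
  exact (isPreconnected_iff_subset_of_disjoint.1 hc.isPreconnected _ _ (hLo U) (hLo V) hcov
    hLd).imp (hLS U) (hLS V)

end TranslationSurface

-- The image of a compact `W ⊆ X` in the completion is closed and misses `σ`. Both ends of each
-- curve tend to `σ`, and points of `X` close to `σ` are joined by curves close to `σ`, hence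
-- outside `W`.
open TranslationSurface SurfaceCurves in
theorem TranslationSurface.exists_properLines {X : Type*} [TopologicalSpace X] [ChartedSpace Plane X]
    [TranslationSurface X] {σ : MetricCompletion X} (hσ : σ ∈ singularities X)
    {n : ℕ} {γ : Fin n → C(unitInterval, MetricCompletion X)}
    (hsimple : ∀ i, IsSimpleClosedCurve (γ i))
    (hrange : ∀ i, range (γ i) ⊆ range (toCompletion : X → MetricCompletion X) ∪ {σ})
    (hendpoints : ∀ i t, γ i t = σ ↔ t = 0 ∨ t = 1)
    (hmeet : ∀ i j, i ≠ j → range (γ i) ∩ range (γ j) = {σ}) :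
    ∃ ℓ : Fin n → ℝ → X, ProperLines ℓ ∧
      (⋃ i, ℓ i '' Ioo 0 1)ᶜ = toCompletion ⁻¹' (⋃ i, range (γ i))ᶜ := by
  have hne : Nonempty X := inferInstance
  have hemb := isEmbedding_toCompletion (X := X)
  set π : ℝ → unitInterval := projIcc (0 : ℝ) 1 zero_le_one with hπ
  have hπc : Continuous π := continuous_projIcc
  have hπe : ∀ t (ht : t ∈ Ioo (0 : ℝ) 1), π t = ⟨t, ht.1.le, ht.2.le⟩ := fun t ht =>
    projIcc_of_mem zero_le_one ⟨ht.1.le, ht.2.le⟩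
  -- Outside the open unit interval the value of the curve is `σ`, which has no preimage, so `ℓ` is
  -- arbitrary there; only parameters in `Ioo 0 1` are used.
  set ℓ : Fin n → ℝ → X := fun j t => Function.invFun toCompletion (γ j (π t)) with hℓ
  have hσ' : ∀ x : X, toCompletion x ≠ σ := fun x h => hσ ⟨x, h⟩
  have hval : ∀ j, ∀ t ∈ Ioo (0 : ℝ) 1, toCompletion (ℓ j t) = γ j (π t) := by
    intro j t ht
    refine Function.invFun_eq ((hrange j (mem_range_self _)).resolve_right fun h => ?_)
    rw [mem_singleton_iff, hendpoints, hπe t ht] at h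
    rcases h with h | h
    · exact ht.1.ne' (congrArg Subtype.val h)
    · exact ht.2.ne (congrArg Subtype.val h)
  refine ⟨ℓ, ⟨fun j => ?_, fun j => ?_, fun i j hij => ?_, fun j W hW => ?_⟩, ?_⟩
  · rw [hemb.continuousOn_iff]
    exact ((γ j).continuous.comp hπc).continuousOn.congr fun t ht => hval j t ht
  · intro s hs t ht hst
    have h1 : γ j (π s) = γ j (π t) := by rw [← hval j s hs, ← hval j t ht, hst]
    have h2 : ∀ t ∈ Ioo (0 : ℝ) 1, π t ∈ Ico (0 : unitInterval) 1 := fun t ht => by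
      rw [hπe t ht]
      exact ⟨Subtype.mk_le_mk.2 ht.1.le, Subtype.mk_lt_mk.2 ht.2⟩
    have h3 := (hsimple j).2 (h2 s hs) (h2 t ht) h1
    rw [hπe s hs, hπe t ht] at h3
    exact congrArg Subtype.val h3
  · rw [disjoint_left]
    rintro _ ⟨s, hs, rfl⟩ ⟨t, ht, hst⟩
    have h1 : toCompletion (ℓ i s) ∈ range (γ i) ∩ range (γ j) :=
      ⟨⟨_, (hval i s hs).symm⟩, ⟨_, by rw [← hst, hval j t ht]⟩⟩
    rw [hmeet i j hij] at h1
    exact hσ' _ h1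
  · have hWc : IsClosed (toCompletion '' W) := (hW.image hemb.continuous).isClosed
    obtain ⟨N, hN, hj⟩ := exists_nhds_joinedIn σ (hWc.isOpen_compl.mem_nhds (by
      rintro ⟨x, -, hx⟩
      exact hσ' x hx))
    have hend : ∀ t : ℝ, γ j (π t) = σ → ∃ δ > 0, ∀ s, |s - t| < δ → γ j (π s) ∈ N := by
      intro t ht
      have h1 : Filter.Tendsto (fun s => γ j (π s)) (𝓝 t) (𝓝 σ) := by
        have := ((γ j).continuous.comp hπc).tendsto t
        rwa [Function.comp_apply, ht] at this
      obtain ⟨δ, hδ, h⟩ := Metric.eventually_nhds_iff.1 (h1.eventually_mem hN)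
      exact ⟨δ, hδ, fun s hs => h (by rwa [Real.dist_eq])⟩
    obtain ⟨δ₀, hδ₀, h₀⟩ := hend 0 ((hendpoints j _).2 (Or.inl (projIcc_left zero_le_one)))
    obtain ⟨δ₁, hδ₁, h₁⟩ := hend 1 ((hendpoints j _).2 (Or.inr (projIcc_right zero_le_one)))
    refine ⟨min δ₀ δ₁, lt_min hδ₀ hδ₁, fun s hs t ht hsδ htδ => ?_⟩
    have hsN : toCompletion (ℓ j s) ∈ N := by
      rw [hval j s hs]
      refine h₀ s ?_
      rw [sub_zero, abs_of_pos hs.1]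
      exact hsδ.trans_le (min_le_left _ _)
    have htN : toCompletion (ℓ j t) ∈ N := by
      rw [hval j t ht]
      refine h₁ t ?_
      rw [abs_sub_comm, abs_of_pos (by linarith [ht.2])]
      linarith [min_le_right δ₀ δ₁]
    have h := hj _ _ hsN htN
    refine ⟨range h.somePath, ?_, isPreconnected_range h.somePath.continuous,
      h.somePath.source_mem_range, h.somePath.target_mem_range⟩
    rintro _ ⟨r, rfl⟩ hr
    exact h.somePath_mem r ⟨_, hr, rfl⟩
  · rw [preimage_compl]
    congr 1
    ext x
    simp only [mem_iUnion, mem_preimage, preimage_iUnion]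
    refine exists_congr fun j => ⟨?_, ?_⟩
    · rintro ⟨t, ht, rfl⟩
      exact ⟨_, (hval j t ht).symm⟩
    · rintro ⟨t, ht⟩
      have h01 : (t : ℝ) ∈ Ioo (0 : ℝ) 1 := by
        have hne : ¬ (t = 0 ∨ t = 1) := by
          rw [← hendpoints j, ht]
          exact hσ' x
        rw [not_or] at hne
        exact ⟨t.2.1.lt_of_ne fun h => hne.1 (Subtype.ext h.symm),
          t.2.2.lt_of_ne fun h => hne.2 (Subtype.ext h)⟩
      refine ⟨t, h01, hemb.injective ?_⟩
      rw [hval j _ h01, hπe _ h01, ← ht]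

/-- A surface with charts in `ℝ²` has charts in `ℂ`. -/
abbrev chartedSpaceComplex (X : Type*) [TopologicalSpace X] [ChartedSpace Plane X] :
    ChartedSpace ℂ X :=
  letI : ChartedSpace ℂ Plane :=
    Complex.orthonormalBasisOneI.repr.symm.toHomeomorph.toOpenPartialHomeomorph.singletonChartedSpace
      rfl
  ChartedSpace.comp ℂ Plane X

end

open TranslationSurface in
theorem mainTheorem7 {X : Type*} [TopologicalSpace X] [ChartedSpace Plane X]
    [TranslationSurface X] (σ : MetricCompletion X) (hσ : σ ∈ singularities X)
    (n : ℕ) (γ : Fin n → C(unitInterval, MetricCompletion X))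
    (hsimple : ∀ i, IsSimpleClosedCurve (γ i))
    (hrange : ∀ i, range (γ i) ⊆ range (toCompletion : X → MetricCompletion X) ∪ {σ})
    (hendpoints : ∀ i t, γ i t = σ ↔ t = 0 ∨ t = 1)
    (hmeet : ∀ i j, i ≠ j → range (γ i) ∩ range (γ j) = {σ})
    (hnonsep : IsNonSeparating γ) :
    ∃ (x : X) (γ' : Fin n → C(unitInterval, X)),
      (∀ i, IsSimpleClosedCurve (γ' i)) ∧
      (∀ i, x ∈ range (γ' i)) ∧
      (∀ i j, i ≠ j → range (γ' i) ∩ range (γ' j) = {x}) ∧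
      IsNonSeparating γ' := by
  obtain ⟨ℓ, hℓ, hS⟩ := exists_properLines hσ hsimple hrange hendpoints hmeet
  -- From here on the surface is purely topological; the plane is read as `ℂ` for the sake of the
  -- logarithms.
  let _ : ChartedSpace ℂ X := chartedSpaceComplex X
  refine hℓ.exists_isNonSeparating ?_
  rw [IsNonSeparating, ← compl_eq_univ_sdiff] at hnonsep
  rw [hS]
  exact isConnected_preimage_toCompletion
    (isClosed_iUnion_of_finite fun i => (isCompact_range (γ i).continuous).isClosed).isOpen_compl
    hnonsep
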